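/- **Conventions.** A *(split) display map category* $(\mathbf C,\mathcal D)$ is a category with a chosen terminal object and a class $\mathcal D$ of arrows (*display maps*, written $P_A:\Gamma.A\to\Gamma$ and called types over $\Gamma$), with, for every $P_A$ over $\Gamma$ and every $f:\Delta\to\Gamma$, a chosen display map $P_{A[f]}:\Delta.A[f]\to\Delta$ and a chosen arrow $f^\bullet:\Delta.A[f]\to\Gamma.A$ forming a pullback of $P_A$ along $f$, such that strictly $P_{A[1]}=P_A$, $1^\bullet=1$, $P_{A[fg]}=P_{A[f][g]}$, $f^\bullet g^\bullet=(fg)^\bullet$. Terms of $A$ are sections of $P_A$; $a[f]$ denotes the induced section of $P_{A[f]}$. Put $A^\blacktriangledown=A[P_A]$; $a;b:\Gamma\to\Gamma.A.A^\blacktriangledown$ is the arrow with components $a,b$, and $\delta_A:\Gamma.A\to\Gamma.A.A^\blacktriangledown$ is the diagonal. A *display map 2-category* $(\mathcal C,\mathcal D)$ is a strict $(2,1)$-category with a display map category structure on its underlying category, such that the terminal object is 2-terminal, the chosen pullbacks are 2-pullbacks, and every display map is a *cloven isofibration*: each 2-cell $p:f\Rightarrow P_Ag$ has a chosen lift $\tau_g^p:t_g^p\Rightarrow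 g$ with $P_A*\tau^p_g=p$ and $\tau^{p*h}_{gh}=\tau^p_g*h$ for every 1-cell $h$, and the lifts are stable under re-indexing: if $n\ge 1$, $\Gamma.A_1.\cdots.A_n=:\Gamma.A\to\cdots\to\Gamma$ is a composable string of display maps, $P_C$ is a display map over $\Gamma.A$, and $p:h\Rightarrow P_Cg$ is a 2-cell with $P_A*p$ an identity, then the chosen lift of the re-indexing of $p$ along any $f:\Delta\to\Gamma$ is the re-indexing of $\tau_g^p$. All display maps are *normal* if $t_g^{1}=g$ and $\tau_g^{1}=1_g$ for all $g$. Write $\mathcal C/\Gamma$ for the strict slice; $(\mathcal C/\Gamma)(f,P)$ has as objects the $a$ with $Pa=f$ and as arrows the 2-cells $\theta$ with $P*\theta$ an identity. The display map 2-category is endowed with axiomatic type formers when there are chosen data as follows, all stable under re-indexing along every $f:\Delta\to\Gamma$: * ($=$) display maps $P_{\mathsf{Id}_A}$ over $\Gamma.A.A^\blacktriangledown$ and 2-cells $\alpha_A:P_{A^\blacktriangledown}P_{\mathsf{Id}_A}\Rightarrow P_A^\bullet P_{\mathsf{Id}_A}$ over $\Gamma$ which are arrow objects of $P_A$, i.e.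 post-composition with $\alpha_A$ gives isomorphisms of categories $(\mathcal C/\Gamma)(h,P_AP_{A^\blacktriangledown}P_{\mathsf{Id}_A})\cong(\mathcal C/\Gamma)(h,P_A)^{\to}$; * ($\Sigma$) display maps $P_{\Sigma_A^B}$ over $\Gamma$, 1-cells $\mathsf p_A^B:\Gamma.A.B\to\Gamma.\Sigma_A^B$, $\pi_A^B:\Gamma.\Sigma_A^B\to\Gamma.A.B$ over $\Gamma$, and 2-cells $\eta_A^B:1\Rightarrow\mathsf p_A^B\pi_A^B$, $\beta_A^B:\pi_A^B\mathsf p_A^B\Rightarrow1$ over $\Gamma$; * ($\Pi$ and function extensionality) display maps $P_{\Pi_A^B}$ over $\Gamma$ and, for every $f:\Delta\to\Gamma$, functors $\mathsf{app}:(\mathcal C/\Gamma)(f,P_{\Pi_A^B})\to(\mathcal C/\Gamma.A)(f^\bullet,P_B)$ with pseudo-inverses $\lambda$ and natural isomorphisms $\beta^{A,B}:\mathsf{app}\,\lambda\Rightarrow1$, $\eta^{A,B}:1\Rightarrow\lambda\,\mathsf{app}$, compatible with pre-composition by every $g:\Delta'\to\Delta$; * ($0,1,2$) display maps $\Gamma.0,\Gamma.1,\Gamma.2\to\Gamma$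 and sections $\star$ of $\Gamma.1$ and $\bot,\top$ of $\Gamma.2$ such that, for every display map $P_C$ over $\Gamma.0$, $\Gamma.1$, $\Gamma.2$ respectively, the functor from the category of sections of $P_C$ to the terminal category (for $0$), to $(\mathcal C/\Gamma.1)(\star,P_C)$ by pre-composition with $\star$ (for $1$), to $(\mathcal C/\Gamma.2)(\bot,P_C)\times(\mathcal C/\Gamma.2)(\top,P_C)$ by pre-composition with $\bot,\top$ (for $2$), has a chosen pseudo-inverse, with natural isomorphisms $\beta^1$, $\beta^2$ from "inverse, then functor" to the identity, and $\eta$ for the other composite; * ($\mathbb N$) display maps $\Gamma.\mathbb N\to\Gamma$, sections $\mathsf 0$, and 1-cells $\mathsf s:\Gamma.\mathbb N\to\Gamma.\mathbb N$ over $\Gamma$ and, for every $P_C$ over $\Gamma.\mathbb N$, every $c$ with $P_Cc=\mathsf 0$ and every $d:\Gamma.\mathbb N.C\to\Gamma.\mathbb N.C$ with $P_Cd=\mathsf sP_C$, a section $\mathsf{ind}_{c,d}$ of $P_C$ and 2-cells $\beta^{\mathbb N}:\mathsf{ind}_{c,d}\mathsf 0\Rightarrow c$ and $\beta^{\mathbb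 N}:\mathsf{ind}_{c,d}\mathsf s\Rightarrow d\,\mathsf{ind}_{c,d}$ over $\Gamma.\mathbb N$. (This holds in particular if pre-composition with $(\mathsf 0,\mathsf sP_C)$, from the sections of $P_C$ to $(\mathcal C/\Gamma.\mathbb N)(\mathsf 0,P_C)\times(\mathcal C/\Gamma.\mathbb N)(\mathsf sP_C,P_C)$, has a chosen pseudo-inverse stable under re-indexing.) **Theorem.** Let $(\mathcal C,\mathcal D)$ be a display map 2-category endowed with axiomatic $0$-, $1$-, $2$-, $\mathbb N$-, $=$-, $\Sigma$-, $\Pi$-types and function extensionality. Assume that all the 2-cells $\beta_A^B$, $\beta^{A,B}$, $\beta^1$, $\beta^2$, $\beta^{\mathbb N}$ are identities and that all display maps are normal isofibrations. Then the underlying display map category $(\mathbf C,\mathcal D)$, with the same display maps $\mathsf{Id}_A,\Sigma_A^B,\Pi_A^B,0,1,2,\mathbb N$ and the same $\star,\bot,\top,\mathsf 0,\mathsf s$, is a model of intensional type theory. That is, it carries the following choices, all stable under re-indexing: * sections $\mathsf{refl}_A$ of $P_{\mathsf{Id}_A[\delta_A]}$, with corresponding arrow $\mathsf r_A=\delta_A^\bullet\mathsf{refl}_A:\Gamma.A\to\Gamma.A.A^\blacktriangledown.\mathsf{Id}_A$,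 and, for every $P_C$ over $\Gamma.A.A^\blacktriangledown.\mathsf{Id}_A$ and every section $c$ of $P_{C[\mathsf r_A]}$, a section $\mathsf j_c$ of $P_C$ with $\mathsf j_c[\mathsf r_A]=c$; * sections $\mathsf{pair}$ of $P_{\Sigma_A^B[P_AP_B]}$, with corresponding arrow $\mathsf p:\Gamma.A.B\to\Gamma.\Sigma_A^B$, and, for every $P_C$ over $\Gamma.\Sigma_A^B$ and every section $c$ of $P_{C[\mathsf p]}$, a section $\mathsf{split}_c$ of $P_C$ with $\mathsf{split}_c[\mathsf p]=c$; * sections $\mathsf{ev}$ of $P_{B[P_{\Pi_A^B}^\bullet]}$ and, for every section $\upsilon$ of $P_B$, a section $\mathsf{abst}_\upsilon$ of $P_{\Pi_A^B}$ with $\mathsf{ev}[\mathsf{abst}_\upsilon^\bullet]=\upsilon$; * for sections $z,z'$ of $P_{\Pi_A^B}$, with $\mathsf{Hom}(z,z'):=\Pi_A^{\mathsf{Id}_B[\mathsf{ev}[z^\bullet];\mathsf{ev}[z'^\bullet]]}$ and $\mathsf{happly}$ obtained by $\mathsf j$-elimination from $\mathsf{abst}$ of the reflexivity term of $\mathsf{ev}$: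 a term $\mathsf{funext}_q$ of $\mathsf{Id}_{\Pi_A^B}[z;z']$ for every term $q$ of $\mathsf{Hom}(z,z')$, a term of the identity type between $\mathsf{happly}[\mathsf{funext}_q]$ and $q$, and, for every term $p$ of $\mathsf{Id}_{\Pi_A^B}[z;z']$, a term of the identity type between $p$ and $\mathsf{funext}_{\mathsf{happly}[p]}$; * sections $\mathsf{ind}^0$ of every $P_C$ over $\Gamma.0$; sections $\mathsf{ind}^1_c$ with $\mathsf{ind}^1_c[\star]=c$; sections $\mathsf{ind}^2_{c,d}$ with $\mathsf{ind}^2_{c,d}[\bot]=c$ and $\mathsf{ind}^2_{c,d}[\top]=d$; sections $\mathsf{ind}^{\mathbb N}_{c,d}$ with $\mathsf{ind}^{\mathbb N}_{c,d}[\mathsf 0]=c$ and $\mathsf{ind}^{\mathbb N}_{c,d}[\mathsf s]=d[\mathsf{ind}^{\mathbb N}_{c,d}]$ (where $c$, $d$ are sections of $P_{C[\star]}$; of $P_{C[\bot]}$, $P_{C[\top]}$; of $P_{C[\mathsf 0]}$, $P_{C[\mathsf sP_C]}$ respectively). Moreover these choices can be made so that $\alpha_A*\mathsf r_A=1_{1_{\Gamma.A}}$,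 the arrow $\mathsf p$ is $\mathsf p_A^B$, $\mathsf{abst}_\upsilon=\lambda_A^B\upsilon$, and $P_{\Pi_A^B}^{\bullet\bullet}\,\mathsf{ev}=\mathsf{app}_A^B(1_{\Gamma.\Pi_A^B})$. -/

import Mathlib

open CategoryTheory

universe w v u

namespace AxiomaticTypes

/-! ### Split display map categories -/

noncomputable section DisplayMapCategories

/-- A display map `tot ⟶ Γ` of the class `D` with codomain `Γ`, i.e. a type in context `Γ`. -/
structure Disp {𝒞 : Type u} [Category.{v} 𝒞] (D : MorphismProperty 𝒞) (Γ : 𝒞) where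
  tot : 𝒞
  proj : tot ⟶ Γ
  mem : D proj

/-- A section of a display map, i.e. a term of a type. -/
@[ext]
structure Sec {𝒞 : Type u} [Category.{v} 𝒞] {D : MorphismProperty 𝒞} {Γ : 𝒞} (A : Disp D Γ) where
  hom : Γ ⟶ A.tot
  hom_proj : hom ≫ A.proj = 𝟙 Γ

/-- A (split) display map category: a category with a chosen terminal object and a class `D` of
display maps, with chosen pullbacks `sub A f` (written `A[f]`) and `q A f` (written `f.A`)
satisfying the splitness equations strictly. -/
structure DisplayMapCategory (𝒞 : Type u) [Category.{v} 𝒞] where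
  empty : 𝒞
  emptyTerminal : Limits.IsTerminal empty
  D : MorphismProperty 𝒞
  sub : ∀ {Γ Δ : 𝒞}, Disp D Γ → (Δ ⟶ Γ) → Disp D Δ
  q : ∀ {Γ Δ : 𝒞} (A : Disp D Γ) (f : Δ ⟶ Γ), (sub A f).tot ⟶ A.tot
  isPullback : ∀ {Γ Δ : 𝒞} (A : Disp D Γ) (f : Δ ⟶ Γ),
    IsPullback (q A f) (sub A f).proj A.proj f
  sub_id : ∀ {Γ : 𝒞} (A : Disp D Γ), sub A (𝟙 Γ) = A
  sub_comp : ∀ {Γ Δ Θ : 𝒞} (A : Disp D Γ) (f : Δ ⟶ Γ) (g : Θ ⟶ Δ),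
    sub A (g ≫ f) = sub (sub A f) g
  q_id : ∀ {Γ : 𝒞} (A : Disp D Γ), q A (𝟙 Γ) = eqToHom (congrArg Disp.tot (sub_id A))
  q_comp : ∀ {Γ Δ Θ : 𝒞} (A : Disp D Γ) (f : Δ ⟶ Γ) (g : Θ ⟶ Δ),
    q A (g ≫ f) = eqToHom (congrArg Disp.tot (sub_comp A f g)) ≫ q (sub A f) g ≫ q A f

section Sections

variable {𝒞 : Type u} [Category.{v} 𝒞] {D : MorphismProperty 𝒞} {Γ : 𝒞}

/-- Equality of two terms whose types are only propositionally equal: the types coincide, and so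
do the terms. -/
def Sec.Same {A B : Disp D Γ} (a : Sec A) (b : Sec B) : Prop :=
  (⟨A, a⟩ : Σ X : Disp D Γ, Sec X) = ⟨B, b⟩

/-- A term of `A`, seen as a term of a type `B` equal to `A`. -/
def Sec.cast {A B : Disp D Γ} (h : A = B) (a : Sec A) : Sec B := h ▸ a

/-- The identity arrow between the total objects of two equal display maps. -/
def castHom {A B : Disp D Γ} (h : A = B) : A.tot ⟶ B.tot := eqToHom (congrArg Disp.tot h)

theorem castHom_proj {A B : Disp D Γ} (h : A = B) : castHom h ≫ B.proj = A.proj := by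
  subst h; simp [castHom]

end Sections

namespace DisplayMapCategory

variable {𝒞 : Type u} [Category.{v} 𝒞] (𝒟 : DisplayMapCategory 𝒞)

/-- Types in context `Γ`. -/
abbrev Ty (Γ : 𝒞) := Disp 𝒟.D Γ

variable {Γ Δ : 𝒞}

/-- The section of `A[f]` induced by an arrow `u` into the total object of `A` lying over `f`. -/
def secOf (A : 𝒟.Ty Γ) (f : Δ ⟶ Γ) (u : Δ ⟶ A.tot) (h : u ≫ A.proj = f) :
    Sec (𝒟.sub A f) where
  hom := (𝒟.isPullback A f).lift u (𝟙 Δ) (by simp [h])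
  hom_proj := (𝒟.isPullback A f).lift_snd _ _ _

/-- The re-indexing `a[f]` of a term. -/
def subSec {A : 𝒟.Ty Γ} (a : Sec A) (f : Δ ⟶ Γ) : Sec (𝒟.sub A f) :=
  𝒟.secOf A f (f ≫ a.hom) (by simp [a.hom_proj])

/-- The weakening `A▼ = A[P_A]` of `A` along itself. -/
abbrev wk (A : 𝒟.Ty Γ) : 𝒟.Ty A.tot := 𝒟.sub A A.proj

/-- The arrow `a;b : Γ ⟶ Γ.A.A▼`. -/
def pair {A : 𝒟.Ty Γ} (a b : Sec A) : Γ ⟶ (𝒟.wk A).tot :=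
  (𝒟.isPullback A A.proj).lift b.hom a.hom (by rw [a.hom_proj, b.hom_proj])

/-- The diagonal `δ_A : Γ.A ⟶ Γ.A.A▼`. -/
def diag (A : 𝒟.Ty Γ) : A.tot ⟶ (𝒟.wk A).tot :=
  (𝒟.isPullback A A.proj).lift (𝟙 _) (𝟙 _) rfl

/-- The arrow `f•• : Δ.A[f].A[f]▼ ⟶ Γ.A.A▼`. -/
def wkMap (A : 𝒟.Ty Γ) (f : Δ ⟶ Γ) :
    (𝒟.wk (𝒟.sub A f)).tot ⟶ (𝒟.wk A).tot :=
  (𝒟.isPullback A A.proj).lift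
    (𝒟.q (𝒟.sub A f) (𝒟.sub A f).proj ≫ 𝒟.q A f)
    ((𝒟.wk (𝒟.sub A f)).proj ≫ 𝒟.q A f)
    (by
      have h := (𝒟.isPullback A f).w
      have h' := (𝒟.isPullback (𝒟.sub A f) (𝒟.sub A f).proj).w
      simp only [Category.assoc, h]
      simp only [← Category.assoc, h'])

end DisplayMapCategory

end DisplayMapCategories

/-! ### Formation rules, stable under re-indexing

These are shared by the one-dimensional and by the two-dimensional semantics. -/

noncomputable section Formers

variable {𝒞 : Type u} [Category.{v} 𝒞] (𝒟 : DisplayMapCategory 𝒞)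

/-- Formation of identity types. -/
structure IdForm where
  Id : ∀ {Γ : 𝒞} (A : 𝒟.Ty Γ), 𝒟.Ty (𝒟.wk A).tot
  Id_sub : ∀ {Γ Δ : 𝒞} (A : 𝒟.Ty Γ) (f : Δ ⟶ Γ),
    𝒟.sub (Id A) (𝒟.wkMap A f) = Id (𝒟.sub A f)

/-- Formation of dependent sums. -/
structure SigmaForm where
  Sig : ∀ {Γ : 𝒞} (A : 𝒟.Ty Γ) (_ : 𝒟.Ty A.tot), 𝒟.Ty Γ
  Sig_sub : ∀ {Γ Δ : 𝒞} (A : 𝒟.Ty Γ) (B : 𝒟.Ty A.tot) (f : Δ ⟶ Γ),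
    𝒟.sub (Sig A B) f = Sig (𝒟.sub A f) (𝒟.sub B (𝒟.q A f))

/-- Formation of dependent products. -/
structure PiForm where
  Pi : ∀ {Γ : 𝒞} (A : 𝒟.Ty Γ) (_ : 𝒟.Ty A.tot), 𝒟.Ty Γ
  Pi_sub : ∀ {Γ Δ : 𝒞} (A : 𝒟.Ty Γ) (B : 𝒟.Ty A.tot) (f : Δ ⟶ Γ),
    𝒟.sub (Pi A B) f = Pi (𝒟.sub A f) (𝒟.sub B (𝒟.q A f))

/-- Formation of a type constant. -/
structure ConstForm where
  ty : ∀ Γ : 𝒞, 𝒟.Ty Γ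
  ty_sub : ∀ {Γ Δ : 𝒞} (f : Δ ⟶ Γ), 𝒟.sub (ty Γ) f = ty Δ

/-- Formation of the empty type `0`. -/
structure ZeroForm extends ConstForm 𝒟

/-- Formation and introduction for the unit type `1`. -/
structure OneForm extends ConstForm 𝒟 where
  star : ∀ Γ : 𝒞, Sec (ty Γ)
  star_sub : ∀ {Γ Δ : 𝒞} (f : Δ ⟶ Γ), (𝒟.subSec (star Γ) f).Same (star Δ)

/-- Formation and introduction for the type `2`. -/
structure TwoForm extends ConstForm 𝒟 where
  bot : ∀ Γ : 𝒞, Sec (ty Γ)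
  top : ∀ Γ : 𝒞, Sec (ty Γ)
  bot_sub : ∀ {Γ Δ : 𝒞} (f : Δ ⟶ Γ), (𝒟.subSec (bot Γ) f).Same (bot Δ)
  top_sub : ∀ {Γ Δ : 𝒞} (f : Δ ⟶ Γ), (𝒟.subSec (top Γ) f).Same (top Δ)

variable {𝒟}

/-- The arrow `f••• : Δ.A[f].A[f]▼.Id ⟶ Γ.A.A▼.Id`. -/
def IdForm.map (I : IdForm 𝒟) {Γ Δ : 𝒞} (A : 𝒟.Ty Γ) (f : Δ ⟶ Γ) :
    (I.Id (𝒟.sub A f)).tot ⟶ (I.Id A).tot :=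
  castHom (I.Id_sub A f).symm ≫ 𝒟.q (I.Id A) (𝒟.wkMap A f)

/-- The arrow `f• : Δ.Σ ⟶ Γ.Σ`. -/
def SigmaForm.map (S : SigmaForm 𝒟) {Γ Δ : 𝒞} (A : 𝒟.Ty Γ) (B : 𝒟.Ty A.tot) (f : Δ ⟶ Γ) :
    (S.Sig (𝒟.sub A f) (𝒟.sub B (𝒟.q A f))).tot ⟶ (S.Sig A B).tot :=
  castHom (S.Sig_sub A B f).symm ≫ 𝒟.q (S.Sig A B) f

/-- The arrow `f• : Δ.Π ⟶ Γ.Π`. -/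
def PiForm.map (P : PiForm 𝒟) {Γ Δ : 𝒞} (A : 𝒟.Ty Γ) (B : 𝒟.Ty A.tot) (f : Δ ⟶ Γ) :
    (P.Pi (𝒟.sub A f) (𝒟.sub B (𝒟.q A f))).tot ⟶ (P.Pi A B).tot :=
  castHom (P.Pi_sub A B f).symm ≫ 𝒟.q (P.Pi A B) f

/-- The arrow `f• : Δ.K ⟶ Γ.K` for a type constant `K`. -/
def ConstForm.map (K : ConstForm 𝒟) {Γ Δ : 𝒞} (f : Δ ⟶ Γ) : (K.ty Δ).tot ⟶ (K.ty Γ).tot :=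
  castHom (K.ty_sub f).symm ≫ 𝒟.q (K.ty Γ) f

variable (𝒟) in
/-- Formation and introduction for the type `ℕ`. The successor is given as an arrow over `Γ`;
by the pullback property of `Γ.ℕ.ℕ▼` this is the same as a section of `Γ.ℕ.ℕ▼ ⟶ Γ.ℕ`. -/
structure NatForm extends ConstForm 𝒟 where
  zero : ∀ Γ : 𝒞, Sec (ty Γ)
  zero_sub : ∀ {Γ Δ : 𝒞} (f : Δ ⟶ Γ), (𝒟.subSec (zero Γ) f).Same (zero Δ)
  s : ∀ Γ : 𝒞, (ty Γ).tot ⟶ (ty Γ).tot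
  s_proj : ∀ Γ : 𝒞, s Γ ≫ (ty Γ).proj = (ty Γ).proj
  s_sub : ∀ {Γ Δ : 𝒞} (f : Δ ⟶ Γ), s Δ ≫ toConstForm.map f = toConstForm.map f ≫ s Γ

end Formers

/-! ### The rules of intensional type theory in a display map category

Each structure consists of choice functions interpreting the introduction and elimination rules,
of the computation rules as equalities, and of the stability of all the choices under
re-indexing. -/

noncomputable section Rules

variable {𝒞 : Type u} [Category.{v} 𝒞] {𝒟 : DisplayMapCategory 𝒞}

/-- Introduction for identity types. -/
structure IdIntro (I : IdForm 𝒟) where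
  refl : ∀ {Γ : 𝒞} (A : 𝒟.Ty Γ), Sec (𝒟.sub (I.Id A) (𝒟.diag A))
  refl_sub : ∀ {Γ Δ : 𝒞} (A : 𝒟.Ty Γ) (f : Δ ⟶ Γ),
    (𝒟.subSec (refl A) (𝒟.q A f)).Same (refl (𝒟.sub A f))

/-- The arrow `r_A : Γ.A ⟶ Γ.A.A▼.Id_A`. -/
def IdIntro.r {I : IdForm 𝒟} (R : IdIntro I) {Γ : 𝒞} (A : 𝒟.Ty Γ) : A.tot ⟶ (I.Id A).tot :=
  (R.refl A).hom ≫ 𝒟.q (I.Id A) (𝒟.diag A)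

/-- Intensional identity types. -/
structure IdRules (I : IdForm 𝒟) extends IdIntro I where
  j : ∀ {Γ : 𝒞} {A : 𝒟.Ty Γ} (C : 𝒟.Ty (I.Id A).tot) (_ : Sec (𝒟.sub C (toIdIntro.r A))), Sec C
  comp : ∀ {Γ : 𝒞} {A : 𝒟.Ty Γ} (C : 𝒟.Ty (I.Id A).tot) (c : Sec (𝒟.sub C (toIdIntro.r A))),
    𝒟.subSec (j C c) (toIdIntro.r A) = c
  j_sub : ∀ {Γ Δ : 𝒞} {A : 𝒟.Ty Γ} (C : 𝒟.Ty (I.Id A).tot)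
    (c : Sec (𝒟.sub C (toIdIntro.r A))) (f : Δ ⟶ Γ),
    ∃ c₁ : Sec (𝒟.sub (𝒟.sub C (I.map A f)) (toIdIntro.r (𝒟.sub A f))),
      c₁.Same (𝒟.subSec c (𝒟.q A f)) ∧
      𝒟.subSec (j C c) (I.map A f) = j (𝒟.sub C (I.map A f)) c₁

/-- Introduction for dependent sums. -/
structure SigmaIntro (S : SigmaForm 𝒟) where
  pair : ∀ {Γ : 𝒞} (A : 𝒟.Ty Γ) (B : 𝒟.Ty A.tot), Sec (𝒟.sub (S.Sig A B) (B.proj ≫ A.proj))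
  pair_sub : ∀ {Γ Δ : 𝒞} (A : 𝒟.Ty Γ) (B : 𝒟.Ty A.tot) (f : Δ ⟶ Γ),
    (𝒟.subSec (pair A B) (𝒟.q B (𝒟.q A f))).Same (pair (𝒟.sub A f) (𝒟.sub B (𝒟.q A f)))

/-- The arrow `p : Γ.A.B ⟶ Γ.Σ`. -/
def SigmaIntro.p {S : SigmaForm 𝒟} (R : SigmaIntro S) {Γ : 𝒞} (A : 𝒟.Ty Γ) (B : 𝒟.Ty A.tot) :
    B.tot ⟶ (S.Sig A B).tot :=
  (R.pair A B).hom ≫ 𝒟.q (S.Sig A B) (B.proj ≫ A.proj)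

/-- Intensional dependent sums. -/
structure SigmaRules (S : SigmaForm 𝒟) extends SigmaIntro S where
  split : ∀ {Γ : 𝒞} {A : 𝒟.Ty Γ} {B : 𝒟.Ty A.tot} (C : 𝒟.Ty (S.Sig A B).tot)
    (_ : Sec (𝒟.sub C (toSigmaIntro.p A B))), Sec C
  comp : ∀ {Γ : 𝒞} {A : 𝒟.Ty Γ} {B : 𝒟.Ty A.tot} (C : 𝒟.Ty (S.Sig A B).tot)
    (c : Sec (𝒟.sub C (toSigmaIntro.p A B))), 𝒟.subSec (split C c) (toSigmaIntro.p A B) = c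
  split_sub : ∀ {Γ Δ : 𝒞} {A : 𝒟.Ty Γ} {B : 𝒟.Ty A.tot} (C : 𝒟.Ty (S.Sig A B).tot)
    (c : Sec (𝒟.sub C (toSigmaIntro.p A B))) (f : Δ ⟶ Γ),
    ∃ c₁ : Sec (𝒟.sub (𝒟.sub C (S.map A B f))
        (toSigmaIntro.p (𝒟.sub A f) (𝒟.sub B (𝒟.q A f)))),
      c₁.Same (𝒟.subSec c (𝒟.q B (𝒟.q A f))) ∧
      𝒟.subSec (split C c) (S.map A B f) = split (𝒟.sub C (S.map A B f)) c₁

/-- For `u : X ⟶ Γ.Π` lying over `f : X ⟶ Γ`, the arrow `u• : X.A[f] ⟶ Γ.Π.A[P_Π]`. -/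
def PiForm.bullet (P : PiForm 𝒟) {Γ X : 𝒞} {A : 𝒟.Ty Γ} {B : 𝒟.Ty A.tot}
    (u : X ⟶ (P.Pi A B).tot) (f : X ⟶ Γ) (h : u ≫ (P.Pi A B).proj = f) :
    (𝒟.sub A f).tot ⟶ (𝒟.sub A (P.Pi A B).proj).tot :=
  (𝒟.isPullback A (P.Pi A B).proj).lift (𝒟.q A f) ((𝒟.sub A f).proj ≫ u)
    (by rw [Category.assoc, h, (𝒟.isPullback A f).w])

theorem PiForm.bullet_q (P : PiForm 𝒟) {Γ X : 𝒞} {A : 𝒟.Ty Γ} {B : 𝒟.Ty A.tot}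
    (u : X ⟶ (P.Pi A B).tot) (f : X ⟶ Γ) (h : u ≫ (P.Pi A B).proj = f) :
    P.bullet u f h ≫ 𝒟.q A (P.Pi A B).proj = 𝒟.q A f :=
  (𝒟.isPullback A (P.Pi A B).proj).lift_fst _ _ _

/-- For a section `z` of `Γ.Π ⟶ Γ`, the arrow `z• : Γ.A ⟶ Γ.Π.A[P_Π]`. -/
def PiForm.secBullet (P : PiForm 𝒟) {Γ : 𝒞} {A : 𝒟.Ty Γ} {B : 𝒟.Ty A.tot}
    (z : Sec (P.Pi A B)) : A.tot ⟶ (𝒟.sub A (P.Pi A B).proj).tot :=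
  (𝒟.isPullback A (P.Pi A B).proj).lift (𝟙 _) (A.proj ≫ z.hom)
    (by rw [Category.assoc, z.hom_proj, Category.id_comp, Category.comp_id])

theorem PiForm.secBullet_q (P : PiForm 𝒟) {Γ : 𝒞} {A : 𝒟.Ty Γ} {B : 𝒟.Ty A.tot}
    (z : Sec (P.Pi A B)) : P.secBullet z ≫ 𝒟.q A (P.Pi A B).proj = 𝟙 _ :=
  (𝒟.isPullback A (P.Pi A B).proj).lift_fst _ _ _

/-- The arrow `f•• : Δ.Π.A[f][P_Π] ⟶ Γ.Π.A[P_Π]`. -/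
def PiForm.evMap (P : PiForm 𝒟) {Γ Δ : 𝒞} (A : 𝒟.Ty Γ) (B : 𝒟.Ty A.tot) (f : Δ ⟶ Γ) :
    (𝒟.sub (𝒟.sub A f) (P.Pi (𝒟.sub A f) (𝒟.sub B (𝒟.q A f))).proj).tot ⟶
      (𝒟.sub A (P.Pi A B).proj).tot :=
  (𝒟.isPullback A (P.Pi A B).proj).lift
    (𝒟.q (𝒟.sub A f) (P.Pi (𝒟.sub A f) (𝒟.sub B (𝒟.q A f))).proj ≫ 𝒟.q A f)
    ((𝒟.sub (𝒟.sub A f) (P.Pi (𝒟.sub A f) (𝒟.sub B (𝒟.q A f))).proj).proj ≫ P.map A B f)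
    (by
      have h : P.map A B f ≫ (P.Pi A B).proj =
          (P.Pi (𝒟.sub A f) (𝒟.sub B (𝒟.q A f))).proj ≫ f := by
        rw [PiForm.map, Category.assoc, (𝒟.isPullback _ f).w, ← Category.assoc, castHom_proj]
      rw [Category.assoc, Category.assoc, h, (𝒟.isPullback A f).w, ← Category.assoc,
        ← Category.assoc, (𝒟.isPullback (𝒟.sub A f) _).w])

/-- Evaluation for dependent products. -/
structure PiEval (P : PiForm 𝒟) where
  ev : ∀ {Γ : 𝒞} (A : 𝒟.Ty Γ) (B : 𝒟.Ty A.tot), Sec (𝒟.sub B (𝒟.q A (P.Pi A B).proj))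
  ev_sub : ∀ {Γ Δ : 𝒞} (A : 𝒟.Ty Γ) (B : 𝒟.Ty A.tot) (f : Δ ⟶ Γ),
    (𝒟.subSec (ev A B) (P.evMap A B f)).Same (ev (𝒟.sub A f) (𝒟.sub B (𝒟.q A f)))

/-- Intensional dependent products, with the judgemental computation rule. -/
structure PiRules (P : PiForm 𝒟) extends PiEval P where
  lam : ∀ {Γ : 𝒞} {A : 𝒟.Ty Γ} {B : 𝒟.Ty A.tot} (_ : Sec B), Sec (P.Pi A B)
  comp : ∀ {Γ : 𝒞} {A : 𝒟.Ty Γ} {B : 𝒟.Ty A.tot} (v : Sec B),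
    (𝒟.subSec (ev A B) (P.secBullet (lam v))).Same v
  lam_sub : ∀ {Γ Δ : 𝒞} {A : 𝒟.Ty Γ} {B : 𝒟.Ty A.tot} (v : Sec B) (f : Δ ⟶ Γ),
    (𝒟.subSec (lam v) f).Same (lam (𝒟.subSec v (𝒟.q A f)))

/-! #### Function extensionality -/

/-- The evaluation of `u : X ⟶ Γ.Π` lying over `f : X ⟶ Γ`, a term of `B[f•]` in context
`X.A[f]`. -/
def PiEval.evAt {P : PiForm 𝒟} (E : PiEval P) {Γ X : 𝒞} {A : 𝒟.Ty Γ} {B : 𝒟.Ty A.tot}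
    (u : X ⟶ (P.Pi A B).tot) (f : X ⟶ Γ) (h : u ≫ (P.Pi A B).proj = f) :
    Sec (𝒟.sub B (𝒟.q A f)) :=
  (𝒟.subSec (E.ev A B) (P.bullet u f h)).cast (by rw [← 𝒟.sub_comp, P.bullet_q])

/-- The term `ev[z•]` of `B` for a section `z` of `Γ.Π ⟶ Γ`. -/
def PiEval.app {P : PiForm 𝒟} (E : PiEval P) {Γ : 𝒞} {A : 𝒟.Ty Γ} {B : 𝒟.Ty A.tot}
    (z : Sec (P.Pi A B)) : Sec B :=
  (𝒟.subSec (E.ev A B) (P.secBullet z)).cast (by rw [← 𝒟.sub_comp, P.secBullet_q, 𝒟.sub_id])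

/-- The type of pointwise identities between `z` and `z'`. -/
def PiEval.homotopy {P : PiForm 𝒟} (E : PiEval P) (I : IdForm 𝒟) {Γ : 𝒞} {A : 𝒟.Ty Γ}
    {B : 𝒟.Ty A.tot} (z z' : Sec (P.Pi A B)) : 𝒟.Ty Γ :=
  P.Pi A (𝒟.sub (I.Id B) (𝒟.pair (E.app z) (E.app z')))

/-- The universal type of pointwise identities, in the context `z, z' : Π, p : z = z'`. -/
def PiEval.genHomotopy {P : PiForm 𝒟} (E : PiEval P) (I : IdForm 𝒟) {Γ : 𝒞} (A : 𝒟.Ty Γ)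
    (B : 𝒟.Ty A.tot) : 𝒟.Ty (I.Id (P.Pi A B)).tot :=
  let T := P.Pi A B
  let s : (I.Id T).tot ⟶ T.tot := (I.Id T).proj ≫ (𝒟.wk T).proj
  let t : (I.Id T).tot ⟶ T.tot := (I.Id T).proj ≫ 𝒟.q T T.proj
  P.Pi (𝒟.sub A (s ≫ T.proj))
    (𝒟.sub (I.Id (𝒟.sub B (𝒟.q A (s ≫ T.proj))))
      (𝒟.pair (E.evAt s (s ≫ T.proj) rfl)
        (E.evAt t (s ≫ T.proj)
          (by
            rw [Category.assoc, Category.assoc]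
            exact congrArg _ (𝒟.isPullback T T.proj).w))))

theorem IdIntro.r_proj {I : IdForm 𝒟} (R : IdIntro I) {Γ : 𝒞} (A : 𝒟.Ty Γ) :
    R.r A ≫ (I.Id A).proj = 𝒟.diag A := by
  rw [IdIntro.r, Category.assoc, (𝒟.isPullback _ _).w, ← Category.assoc, (R.refl A).hom_proj,
    Category.id_comp]

theorem hom_diag {Γ : 𝒞} {A : 𝒟.Ty Γ} (a : Sec A) : a.hom ≫ 𝒟.diag A = 𝒟.pair a a := by
  apply (𝒟.isPullback A A.proj).hom_ext
  · simp [DisplayMapCategory.diag, DisplayMapCategory.pair]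
  · simp [DisplayMapCategory.diag, DisplayMapCategory.pair]

/-- The reflexivity term `r(a) : a = a` of a term `a`. -/
def IdIntro.reflAt {I : IdForm 𝒟} (R : IdIntro I) {Γ : 𝒞} {A : 𝒟.Ty Γ} (a : Sec A) :
    Sec (𝒟.sub (I.Id A) (𝒟.pair a a)) :=
  𝒟.secOf (I.Id A) (𝒟.pair a a) (a.hom ≫ R.r A) (by rw [Category.assoc, R.r_proj, hom_diag])

/-- Function extensionality, relative to given identity types and dependent products: the term
`happly`, sending an identity of functions to a pointwise identity, is obtained by elimination
from `λ x, r(ev(z, x))`; it has a section and a retraction `funext` up to identity terms. -/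
structure FunextRules {I : IdForm 𝒟} {P : PiForm 𝒟} (R : IdRules I) (L : PiRules P) where
  happly : ∀ {Γ : 𝒞} (A : 𝒟.Ty Γ) (B : 𝒟.Ty A.tot), Sec (L.genHomotopy I A B)
  happly_spec : ∀ {Γ : 𝒞} (A : 𝒟.Ty Γ) (B : 𝒟.Ty A.tot),
    ∃ c : Sec (𝒟.sub (L.genHomotopy I A B) (R.r (P.Pi A B))),
      c.Same (L.lam (R.reflAt (L.ev A B))) ∧ happly A B = R.j (L.genHomotopy I A B) c
  /-- the instance `happly[p]` -/
  happlyAt : ∀ {Γ : 𝒞} {A : 𝒟.Ty Γ} {B : 𝒟.Ty A.tot} {z z' : Sec (P.Pi A B)}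
    (_ : Sec (𝒟.sub (I.Id (P.Pi A B)) (𝒟.pair z z'))), Sec (L.homotopy I z z')
  happlyAt_spec : ∀ {Γ : 𝒞} {A : 𝒟.Ty Γ} {B : 𝒟.Ty A.tot} {z z' : Sec (P.Pi A B)}
    (p : Sec (𝒟.sub (I.Id (P.Pi A B)) (𝒟.pair z z'))),
    (happlyAt p).Same (𝒟.subSec (happly A B) (p.hom ≫ 𝒟.q (I.Id (P.Pi A B)) (𝒟.pair z z')))
  funext : ∀ {Γ : 𝒞} {A : 𝒟.Ty Γ} {B : 𝒟.Ty A.tot} {z z' : Sec (P.Pi A B)}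
    (_ : Sec (L.homotopy I z z')), Sec (𝒟.sub (I.Id (P.Pi A B)) (𝒟.pair z z'))
  beta : ∀ {Γ : 𝒞} {A : 𝒟.Ty Γ} {B : 𝒟.Ty A.tot} {z z' : Sec (P.Pi A B)}
    (h : Sec (L.homotopy I z z')),
    Sec (𝒟.sub (I.Id (L.homotopy I z z')) (𝒟.pair (happlyAt (funext h)) h))
  eta : ∀ {Γ : 𝒞} {A : 𝒟.Ty Γ} {B : 𝒟.Ty A.tot} {z z' : Sec (P.Pi A B)}
    (p : Sec (𝒟.sub (I.Id (P.Pi A B)) (𝒟.pair z z'))),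
    Sec (𝒟.sub (I.Id (𝒟.sub (I.Id (P.Pi A B)) (𝒟.pair z z')))
      (𝒟.pair p (funext (happlyAt p))))
  beta_sub : ∀ {Γ Δ : 𝒞} {A : 𝒟.Ty Γ} {B : 𝒟.Ty A.tot} {z z' : Sec (P.Pi A B)}
    (h : Sec (L.homotopy I z z')) (f : Δ ⟶ Γ),
    ∃ h₁ : Sec (L.homotopy I ((𝒟.subSec z f).cast (P.Pi_sub A B f))
        ((𝒟.subSec z' f).cast (P.Pi_sub A B f))),
      h₁.Same (𝒟.subSec h f) ∧
      (𝒟.subSec (funext h) f).Same (funext h₁) ∧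
      (𝒟.subSec (beta h) f).Same (beta h₁)
  eta_sub : ∀ {Γ Δ : 𝒞} {A : 𝒟.Ty Γ} {B : 𝒟.Ty A.tot} {z z' : Sec (P.Pi A B)}
    (p : Sec (𝒟.sub (I.Id (P.Pi A B)) (𝒟.pair z z'))) (f : Δ ⟶ Γ),
    ∃ p₁ : Sec (𝒟.sub (I.Id (P.Pi (𝒟.sub A f) (𝒟.sub B (𝒟.q A f))))
        (𝒟.pair ((𝒟.subSec z f).cast (P.Pi_sub A B f))
          ((𝒟.subSec z' f).cast (P.Pi_sub A B f)))),
      p₁.Same (𝒟.subSec p f) ∧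
      (𝒟.subSec (eta p) f).Same (eta p₁)

/-- The empty type. -/
structure ZeroRules (Z : ZeroForm 𝒟) where
  ind : ∀ {Γ : 𝒞} (C : 𝒟.Ty (Z.ty Γ).tot), Sec C
  ind_sub : ∀ {Γ Δ : 𝒞} (C : 𝒟.Ty (Z.ty Γ).tot) (f : Δ ⟶ Γ),
    𝒟.subSec (ind C) (Z.map f) = ind (𝒟.sub C (Z.map f))

/-- The intensional unit type. -/
structure OneRules (O : OneForm 𝒟) where
  ind : ∀ {Γ : 𝒞} (C : 𝒟.Ty (O.ty Γ).tot) (_ : Sec (𝒟.sub C (O.star Γ).hom)), Sec C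
  comp : ∀ {Γ : 𝒞} (C : 𝒟.Ty (O.ty Γ).tot) (c : Sec (𝒟.sub C (O.star Γ).hom)),
    𝒟.subSec (ind C c) (O.star Γ).hom = c
  ind_sub : ∀ {Γ Δ : 𝒞} (C : 𝒟.Ty (O.ty Γ).tot) (c : Sec (𝒟.sub C (O.star Γ).hom))
    (f : Δ ⟶ Γ),
    ∃ c₁ : Sec (𝒟.sub (𝒟.sub C (O.map f)) (O.star Δ).hom),
      c₁.Same (𝒟.subSec c f) ∧
      𝒟.subSec (ind C c) (O.map f) = ind (𝒟.sub C (O.map f)) c₁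

/-- The intensional type `2`. -/
structure TwoRules (T : TwoForm 𝒟) where
  ind : ∀ {Γ : 𝒞} (C : 𝒟.Ty (T.ty Γ).tot) (_ : Sec (𝒟.sub C (T.bot Γ).hom))
    (_ : Sec (𝒟.sub C (T.top Γ).hom)), Sec C
  comp_bot : ∀ {Γ : 𝒞} (C : 𝒟.Ty (T.ty Γ).tot) (c : Sec (𝒟.sub C (T.bot Γ).hom))
    (d : Sec (𝒟.sub C (T.top Γ).hom)), 𝒟.subSec (ind C c d) (T.bot Γ).hom = c
  comp_top : ∀ {Γ : 𝒞} (C : 𝒟.Ty (T.ty Γ).tot) (c : Sec (𝒟.sub C (T.bot Γ).hom))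
    (d : Sec (𝒟.sub C (T.top Γ).hom)), 𝒟.subSec (ind C c d) (T.top Γ).hom = d
  ind_sub : ∀ {Γ Δ : 𝒞} (C : 𝒟.Ty (T.ty Γ).tot) (c : Sec (𝒟.sub C (T.bot Γ).hom))
    (d : Sec (𝒟.sub C (T.top Γ).hom)) (f : Δ ⟶ Γ),
    ∃ (c₁ : Sec (𝒟.sub (𝒟.sub C (T.map f)) (T.bot Δ).hom))
      (d₁ : Sec (𝒟.sub (𝒟.sub C (T.map f)) (T.top Δ).hom)),
      c₁.Same (𝒟.subSec c f) ∧ d₁.Same (𝒟.subSec d f) ∧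
      𝒟.subSec (ind C c d) (T.map f) = ind (𝒟.sub C (T.map f)) c₁ d₁

/-- The intensional type of natural numbers. -/
structure NatRules (N : NatForm 𝒟) where
  ind : ∀ {Γ : 𝒞} (C : 𝒟.Ty (N.ty Γ).tot) (_ : Sec (𝒟.sub C (N.zero Γ).hom))
    (_ : Sec (𝒟.sub C (C.proj ≫ N.s Γ))), Sec C
  comp_zero : ∀ {Γ : 𝒞} (C : 𝒟.Ty (N.ty Γ).tot) (c : Sec (𝒟.sub C (N.zero Γ).hom))
    (d : Sec (𝒟.sub C (C.proj ≫ N.s Γ))), 𝒟.subSec (ind C c d) (N.zero Γ).hom = c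
  comp_succ : ∀ {Γ : 𝒞} (C : 𝒟.Ty (N.ty Γ).tot) (c : Sec (𝒟.sub C (N.zero Γ).hom))
    (d : Sec (𝒟.sub C (C.proj ≫ N.s Γ))),
    (𝒟.subSec (ind C c d) (N.s Γ)).Same (𝒟.subSec d (ind C c d).hom)
  ind_sub : ∀ {Γ Δ : 𝒞} (C : 𝒟.Ty (N.ty Γ).tot) (c : Sec (𝒟.sub C (N.zero Γ).hom))
    (d : Sec (𝒟.sub C (C.proj ≫ N.s Γ))) (f : Δ ⟶ Γ),
    ∃ (c₁ : Sec (𝒟.sub (𝒟.sub C (N.map f)) (N.zero Δ).hom))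
      (d₁ : Sec (𝒟.sub (𝒟.sub C (N.map f)) ((𝒟.sub C (N.map f)).proj ≫ N.s Δ))),
      c₁.Same (𝒟.subSec c f) ∧ d₁.Same (𝒟.subSec d (𝒟.q C (N.map f))) ∧
      𝒟.subSec (ind C c d) (N.map f) = ind (𝒟.sub C (N.map f)) c₁ d₁

/-- A model of intensional type theory on a display map category, with the given type formers. -/
structure ITTModel (I : IdForm 𝒟) (S : SigmaForm 𝒟) (P : PiForm 𝒟) (Z : ZeroForm 𝒟)
    (O : OneForm 𝒟) (T : TwoForm 𝒟) (N : NatForm 𝒟) where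
  id : IdRules I
  sigma : SigmaRules S
  pi : PiRules P
  funext : FunextRules id pi
  zero : ZeroRules Z
  one : OneRules O
  two : TwoRules T
  nat : NatRules N

end Rules

/-! ### Display map 2-categories -/

noncomputable section TwoDimensional

open Bicategory

/-- A 2-cell with its boundary. An equation `Cell.mk η = Cell.mk θ` states that two 2-cells, whose
source and target 1-cells are only propositionally equal, are the same 2-cell. -/
structure Cell {𝒞 : Type u} [Bicategory.{w, v} 𝒞] (X Y : 𝒞) where
  {src tgt : X ⟶ Y}
  hom : src ⟶ tgt

/-- The 2-cell `η` is an identity 2-cell (in particular its source and target are equal). -/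
def IsIdentity {𝒞 : Type u} [Bicategory.{w, v} 𝒞] {X Y : 𝒞} {f g : X ⟶ Y} (η : f ⟶ g) : Prop :=
  ∃ h : f = g, η = eqToHom h

section CellCalculus

variable {𝒞 : Type u} [Bicategory.{w, v} 𝒞] {X Y Z : 𝒞}

theorem cell_id {f g : X ⟶ Y} (h : f = g) : Cell.mk (𝟙 f) = Cell.mk (𝟙 g) := by
  subst h; rfl

theorem src_eq_of_cell {f g f' g' : X ⟶ Y} {η : f ⟶ g} {θ : f' ⟶ g'}
    (h : Cell.mk η = Cell.mk θ) : f = f' := congrArg Cell.src h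

theorem cell_eqToHom_comp {f g h : X ⟶ Y} (e : f = g) (η : g ⟶ h) :
    Cell.mk (eqToHom e ≫ η) = Cell.mk η := by
  subst e; simp

theorem cell_comp_eqToHom {f g h : X ⟶ Y} (η : f ⟶ g) (e : g = h) :
    Cell.mk (η ≫ eqToHom e) = Cell.mk η := by
  subst e; simp

theorem cell_whiskerLeft {k k' : X ⟶ Y} (e : k = k') {f g f' g' : Y ⟶ Z} {η : f ⟶ g}
    {θ : f' ⟶ g'} (h : Cell.mk η = Cell.mk θ) : Cell.mk (k ◁ η) = Cell.mk (k' ◁ θ) := by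
  subst e
  exact congrArg (fun c : Cell Y Z => Cell.mk (k ◁ c.hom)) h

variable [Bicategory.Strict 𝒞]

theorem cell_whisker_assoc {W : 𝒞} (k : W ⟶ X) {f g : X ⟶ Y} (η : f ⟶ g) (q : Y ⟶ Z) :
    Cell.mk ((k ◁ η) ▷ q) = Cell.mk (k ◁ η ▷ q) := by
  rw [whisker_assoc, Strict.associator_eqToIso, Strict.associator_eqToIso, eqToIso.hom,
    eqToIso.inv]
  exact (cell_eqToHom_comp _ _).trans (cell_comp_eqToHom _ _)

theorem cell_comp_whiskerLeft {W : 𝒞} (k : W ⟶ X) (l : X ⟶ Y) {f g : Y ⟶ Z} (η : f ⟶ g) :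
    Cell.mk ((k ≫ l) ◁ η) = Cell.mk (k ◁ l ◁ η) := by
  rw [comp_whiskerLeft, Strict.associator_eqToIso, Strict.associator_eqToIso, eqToIso.hom,
    eqToIso.inv]
  exact (cell_eqToHom_comp _ _).trans (cell_comp_eqToHom _ _)

end CellCalculus

section SliceHom

variable {𝒞 : Type u} [Bicategory.{w, v} 𝒞] [Bicategory.Strict 𝒞]

theorem isIdentity_comp {X Y : 𝒞} {f g h : X ⟶ Y} {η : f ⟶ g} {θ : g ⟶ h}
    (hη : IsIdentity η) (hθ : IsIdentity θ) : IsIdentity (η ≫ θ) := by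
  obtain ⟨rfl, rfl⟩ := hη
  obtain ⟨rfl, rfl⟩ := hθ
  exact ⟨rfl, by simp⟩

theorem isIdentity_eqToHom {X Y : 𝒞} {f g : X ⟶ Y} (h : f = g) : IsIdentity (eqToHom h) :=
  ⟨h, rfl⟩

theorem isIdentity_whiskerLeft {X Y Z : 𝒞} (k : X ⟶ Y) {f g : Y ⟶ Z} {η : f ⟶ g}
    (hη : IsIdentity η) : IsIdentity (k ◁ η) := by
  obtain ⟨rfl, rfl⟩ := hη
  exact ⟨rfl, by simp⟩

theorem isIdentity_whiskerLeft_whiskerRight {W X Y Z : 𝒞} (k : W ⟶ X) {f g : X ⟶ Y} {η : f ⟶ g}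
    {P : Y ⟶ Z} (hη : IsIdentity (η ▷ P)) : IsIdentity ((k ◁ η) ▷ P) := by
  rw [whisker_assoc, Strict.associator_eqToIso, Strict.associator_eqToIso, eqToIso.hom,
    eqToIso.inv]
  exact isIdentity_comp (isIdentity_eqToHom (Strict.assoc k f P))
    (isIdentity_comp (isIdentity_whiskerLeft k hη) (isIdentity_eqToHom (Strict.assoc k g P).symm))

/-- A 1-cell from `f : X ⟶ Γ` to `P : E ⟶ Γ` in the strict slice over `Γ`. -/
structure SliceHom {X E Γ : 𝒞} (P : E ⟶ Γ) (f : X ⟶ Γ) where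
  hom : X ⟶ E
  w : hom ≫ P = f

/-- The category of 1-cells from `f` to `P` in the strict slice over `Γ`: its arrows are the
2-cells `θ` such that `P * θ` is an identity 2-cell. -/
instance {X E Γ : 𝒞} (P : E ⟶ Γ) (f : X ⟶ Γ) : Category (SliceHom P f) where
  Hom a b := {θ : a.hom ⟶ b.hom // IsIdentity (θ ▷ P)}
  id a := ⟨𝟙 a.hom, rfl, by simp⟩
  comp θ φ := ⟨θ.1 ≫ φ.1, by rw [comp_whiskerRight]; exact isIdentity_comp θ.2 φ.2⟩
  id_comp θ := Subtype.ext (Category.id_comp _)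
  comp_id θ := Subtype.ext (Category.comp_id _)
  assoc θ φ ψ := Subtype.ext (Category.assoc _ _ _)

/-- Pre-composition with a 1-cell. -/
def SliceHom.pre {X Y E Γ : 𝒞} (P : E ⟶ Γ) {f : X ⟶ Γ} {f' : Y ⟶ Γ} (k : Y ⟶ X)
    (e : k ≫ f = f') : SliceHom P f ⥤ SliceHom P f' where
  obj a := ⟨k ≫ a.hom, by rw [Category.assoc, a.w, e]⟩
  map θ := ⟨k ◁ θ.1, isIdentity_whiskerLeft_whiskerRight k θ.2⟩
  map_id a := Subtype.ext (whiskerLeft_id k a.hom)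
  map_comp θ φ := Subtype.ext (whiskerLeft_comp k θ.1 φ.1)

end SliceHom

/-- A relation between the arrows of two categories. -/
def ArrowRel (𝒜 : Type*) (𝒜' : Type*) [Category 𝒜] [Category 𝒜'] :=
  ∀ ⦃a b : 𝒜⦄ ⦃a' b' : 𝒜'⦄, (a ⟶ b) → (a' ⟶ b') → Prop

/-- The relation expressing that the 2-cell `θ'` is the re-indexing of `θ` along `k` and `q`:
post-composing `θ'` with `q` gives the same 2-cell as pre-composing `θ` with `k`. On identities,
this is the analogous relation between 1-cells. -/
def SliceHom.rel {𝒞 : Type u} [Bicategory.{w, v} 𝒞] [Bicategory.Strict 𝒞]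
    {X E Γ X' E' Γ' : 𝒞} (P : E ⟶ Γ) (f : X ⟶ Γ) (P' : E' ⟶ Γ') (f' : X' ⟶ Γ')
    (k : X' ⟶ X) (q : E' ⟶ E) : ArrowRel (SliceHom P f) (SliceHom P' f') :=
  fun _ _ _ _ θ θ' => Cell.mk (θ'.1 ▷ q) = Cell.mk (k ◁ θ.1)

/-- The componentwise relation on product categories. -/
def ArrowRel.prod {𝒜 𝒜' ℬ ℬ' : Type*} [Category 𝒜] [Category 𝒜'] [Category ℬ] [Category ℬ']
    (R : ArrowRel 𝒜 𝒜') (S : ArrowRel ℬ ℬ') : ArrowRel (𝒜 × ℬ) (𝒜' × ℬ') :=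
  fun _ _ _ _ θ θ' => R θ.1 θ'.1 ∧ S θ.2 θ'.2

/-- A chosen pseudo-inverse of a functor, with its natural isomorphisms. -/
structure PseudoInverse {𝒜 ℬ : Type*} [Category 𝒜] [Category ℬ] (F : 𝒜 ⥤ ℬ) where
  inv : ℬ ⥤ 𝒜
  β : inv ⋙ F ≅ 𝟭 ℬ
  η : 𝟭 𝒜 ≅ F ⋙ inv

/-- Two functors with chosen pseudo-inverses correspond to each other under given relations. -/
structure Stable {𝒜 𝒜' ℬ ℬ' : Type*} [Category 𝒜] [Category 𝒜'] [Category ℬ] [Category ℬ']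
    (R : ArrowRel 𝒜 𝒜') (S : ArrowRel ℬ ℬ') {F : 𝒜 ⥤ ℬ} {F' : 𝒜' ⥤ ℬ'}
    (G : PseudoInverse F) (G' : PseudoInverse F') : Prop where
  map : ∀ {a b : 𝒜} {a' b' : 𝒜'} (θ : a ⟶ b) (θ' : a' ⟶ b'), R θ θ' → S (F.map θ) (F'.map θ')
  inv : ∀ {a b : ℬ} {a' b' : ℬ'} (θ : a ⟶ b) (θ' : a' ⟶ b'), S θ θ' →
    R (G.inv.map θ) (G'.inv.map θ')
  β : ∀ (b : ℬ) (b' : ℬ'), S (𝟙 b) (𝟙 b') → S (G.β.hom.app b) (G'.β.hom.app b')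
  η : ∀ (a : 𝒜) (a' : 𝒜'), R (𝟙 a) (𝟙 a') → R (G.η.hom.app a) (G'.η.hom.app a')

section Telescopes

variable {𝒞 : Type u} [Category.{v} 𝒞] (𝒟 : DisplayMapCategory 𝒞)

/-- Telescopes of display maps `Γ.A₁.⋯.Aₙ ⟶ ⋯ ⟶ Γ.A₁ ⟶ Γ`. -/
inductive Tel : 𝒞 → Type (max u v)
  | nil (Γ : 𝒞) : Tel Γ
  | cons {Γ : 𝒞} (A : 𝒟.Ty Γ) (T : Tel A.tot) : Tel Γ

variable {𝒟}

/-- The context `Γ.A₁.⋯.Aₙ`. -/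
def Tel.tot : ∀ {Γ : 𝒞}, Tel 𝒟 Γ → 𝒞
  | _, .nil Γ => Γ
  | _, .cons _ T => T.tot

/-- The composite projection `Γ.A₁.⋯.Aₙ ⟶ Γ`. -/
def Tel.proj : ∀ {Γ : 𝒞} (T : Tel 𝒟 Γ), T.tot ⟶ Γ
  | _, .nil Γ => 𝟙 Γ
  | _, .cons A T => T.proj ≫ A.proj

/-- Re-indexing of a telescope. -/
def Tel.sub : ∀ {Γ : 𝒞}, Tel 𝒟 Γ → ∀ {Ω : 𝒞}, (Ω ⟶ Γ) → Tel 𝒟 Ω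
  | _, .nil _, Ω, _ => .nil Ω
  | _, .cons A T, _, f => .cons (𝒟.sub A f) (T.sub (𝒟.q A f))

/-- The arrow `f.A₁.⋯.Aₙ : Ω.A₁[f].⋯ ⟶ Γ.A₁.⋯.Aₙ`. -/
def Tel.map : ∀ {Γ : 𝒞} (T : Tel 𝒟 Γ) {Ω : 𝒞} (f : Ω ⟶ Γ), (T.sub f).tot ⟶ T.tot
  | _, .nil _, _, f => f
  | _, .cons A T, _, f => T.map (𝒟.q A f)

end Telescopes

/-- A structure of cloven isofibration on all display maps: for every 2-cell `p : f ⟶ P_A g` a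
chosen 2-cell `τ g p : t g p ⟶ g` lying over `p`, stably under pre-composition, and stably under
re-indexing along 1-cells `f : Ω ⟶ Γ` when `P_C` is a display map over a telescope
`Γ.A₁.⋯.Aₙ` with `n ≥ 1` and `p` becomes an identity 2-cell in `Γ`. -/
structure Cleavage {𝒞 : Type u} [Bicategory.{w, v} 𝒞] [Bicategory.Strict 𝒞]
    (𝒟 : DisplayMapCategory 𝒞) where
  t : ∀ {Γ X : 𝒞} (A : 𝒟.Ty Γ) (g : X ⟶ A.tot) {f : X ⟶ Γ} (_ : f ⟶ g ≫ A.proj), X ⟶ A.tot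
  τ : ∀ {Γ X : 𝒞} (A : 𝒟.Ty Γ) (g : X ⟶ A.tot) {f : X ⟶ Γ} (p : f ⟶ g ≫ A.proj), t A g p ⟶ g
  τ_proj : ∀ {Γ X : 𝒞} (A : 𝒟.Ty Γ) (g : X ⟶ A.tot) {f : X ⟶ Γ} (p : f ⟶ g ≫ A.proj),
    Cell.mk (τ A g p ▷ A.proj) = Cell.mk p
  τ_comp : ∀ {Γ X Y : 𝒞} (A : 𝒟.Ty Γ) (g : X ⟶ A.tot) {f : X ⟶ Γ} (p : f ⟶ g ≫ A.proj)
    (k : Y ⟶ X),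
    Cell.mk (τ A (k ≫ g) (k ◁ p ≫ (α_ k g A.proj).inv)) = Cell.mk (k ◁ τ A g p)
  τ_sub : ∀ {Γ Ω X X' : 𝒞} (A : 𝒟.Ty Γ) (T : Tel 𝒟 A.tot) (f : Ω ⟶ Γ)
    (C : 𝒟.Ty (Tel.cons A T).tot) (k : X' ⟶ X)
    (g : X ⟶ C.tot) {h : X ⟶ (Tel.cons A T).tot} (p : h ⟶ g ≫ C.proj)
    (g' : X' ⟶ (𝒟.sub C ((Tel.cons A T).map f)).tot) {h' : X' ⟶ ((Tel.cons A T).sub f).tot}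
    (p' : h' ⟶ g' ≫ (𝒟.sub C ((Tel.cons A T).map f)).proj),
    g' ≫ 𝒟.q C ((Tel.cons A T).map f) = k ≫ g →
    IsIdentity (p ▷ (Tel.cons A T).proj) →
    IsIdentity (p' ▷ ((Tel.cons A T).sub f).proj) →
    Cell.mk (p' ▷ (Tel.cons A T).map f) = Cell.mk (k ◁ p) →
    Cell.mk (τ (𝒟.sub C ((Tel.cons A T).map f)) g' p' ▷ 𝒟.q C ((Tel.cons A T).map f)) =
      Cell.mk (k ◁ τ C g p)

/-- A (split) display map 2-category: a (2,1)-category, i.e. a strict bicategory whose 2-cells are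
invertible, with a split display map category structure on the underlying category, such that
the terminal object is 2-terminal, the chosen pullbacks are 2-pullbacks, and all display maps
are cloven isofibrations. -/
structure DisplayMap2Category (𝒞 : Type u) [Bicategory.{w, v} 𝒞] [Bicategory.Strict 𝒞]
    [IsLocallyGroupoid 𝒞] extends DisplayMapCategory 𝒞 where
  two_terminal : ∀ {X : 𝒞} {f g : X ⟶ empty} (σ τ : f ⟶ g), σ = τ
  two_pullback : ∀ {Γ Ω X : 𝒞} (A : Disp D Γ) (f : Ω ⟶ Γ) (a b : X ⟶ (sub A f).tot)
    (σ : a ≫ (sub A f).proj ⟶ b ≫ (sub A f).proj) (τ : a ≫ q A f ⟶ b ≫ q A f),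
    Cell.mk (σ ▷ f) = Cell.mk (τ ▷ A.proj) →
      ∃! ρ : a ⟶ b, ρ ▷ (sub A f).proj = σ ∧ ρ ▷ q A f = τ
  cleavage : Cleavage toDisplayMapCategory

variable {𝒞 : Type u} [Bicategory.{w, v} 𝒞] [Bicategory.Strict 𝒞] [IsLocallyGroupoid 𝒞]
  (𝒟 : DisplayMap2Category 𝒞)

namespace DisplayMap2Category

/-- Types in context `Γ`. -/
abbrev Ty (Γ : 𝒞) := Disp 𝒟.D Γ

/-- All display maps are normal isofibrations: the chosen lift of an identity 2-cell is the
identity 2-cell. -/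
def Normal : Prop :=
  ∀ {Γ X : 𝒞} (A : 𝒟.Ty Γ) (g : X ⟶ A.tot),
    Cell.mk (𝒟.cleavage.τ A g (𝟙 (g ≫ A.proj))) = Cell.mk (𝟙 g)

end DisplayMap2Category

/-! ### Axiomatic type formers in a display map 2-category -/

/-- Axiomatic identity types: the display map `Id A` carries an arrow object `α` of the display
map `A` in the slice over `Γ`, stably under re-indexing. -/
structure AxiomaticId extends IdForm 𝒟.toDisplayMapCategory where
  α : ∀ {Γ : 𝒞} (A : 𝒟.Ty Γ),
    (Id A).proj ≫ (𝒟.wk A).proj ⟶ (Id A).proj ≫ 𝒟.q A A.proj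
  α_proj : ∀ {Γ : 𝒞} (A : 𝒟.Ty Γ), IsIdentity (α A ▷ A.proj)
  α_obj : ∀ {Γ X : 𝒞} (A : 𝒟.Ty Γ) {a b : X ⟶ A.tot} (θ : a ⟶ b), IsIdentity (θ ▷ A.proj) →
    ∃! u : X ⟶ (Id A).tot, Cell.mk (u ◁ α A) = Cell.mk θ
  α_hom : ∀ {Γ X : 𝒞} (A : 𝒟.Ty Γ) (x y : X ⟶ (Id A).tot)
    (σ : x ≫ (Id A).proj ≫ (𝒟.wk A).proj ⟶ y ≫ (Id A).proj ≫ (𝒟.wk A).proj)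
    (τ : x ≫ (Id A).proj ≫ 𝒟.q A A.proj ⟶ y ≫ (Id A).proj ≫ 𝒟.q A A.proj),
    IsIdentity (σ ▷ A.proj) → IsIdentity (τ ▷ A.proj) → σ ≫ y ◁ α A = x ◁ α A ≫ τ →
    ∃! ρ : x ⟶ y,
      ρ ▷ ((Id A).proj ≫ (𝒟.wk A).proj) = σ ∧ ρ ▷ ((Id A).proj ≫ 𝒟.q A A.proj) = τ
  α_sub : ∀ {Γ Ω : 𝒞} (A : 𝒟.Ty Γ) (f : Ω ⟶ Γ),
    Cell.mk (α (𝒟.sub A f) ▷ 𝒟.q A f) = Cell.mk (toIdForm.map A f ◁ α A)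

/-- Axiomatic dependent sums: a chosen equivalence over `Γ` between `Γ.A.B` and the total object
of the sum, stably under re-indexing. -/
structure AxiomaticSigma extends SigmaForm 𝒟.toDisplayMapCategory where
  p : ∀ {Γ : 𝒞} (A : 𝒟.Ty Γ) (B : 𝒟.Ty A.tot), B.tot ⟶ (Sig A B).tot
  p_proj : ∀ {Γ : 𝒞} (A : 𝒟.Ty Γ) (B : 𝒟.Ty A.tot), p A B ≫ (Sig A B).proj = B.proj ≫ A.proj
  π : ∀ {Γ : 𝒞} (A : 𝒟.Ty Γ) (B : 𝒟.Ty A.tot), (Sig A B).tot ⟶ B.tot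
  π_proj : ∀ {Γ : 𝒞} (A : 𝒟.Ty Γ) (B : 𝒟.Ty A.tot), π A B ≫ B.proj ≫ A.proj = (Sig A B).proj
  η : ∀ {Γ : 𝒞} (A : 𝒟.Ty Γ) (B : 𝒟.Ty A.tot), 𝟙 (Sig A B).tot ⟶ π A B ≫ p A B
  η_proj : ∀ {Γ : 𝒞} (A : 𝒟.Ty Γ) (B : 𝒟.Ty A.tot), IsIdentity (η A B ▷ (Sig A B).proj)
  β : ∀ {Γ : 𝒞} (A : 𝒟.Ty Γ) (B : 𝒟.Ty A.tot), p A B ≫ π A B ⟶ 𝟙 B.tot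
  β_proj : ∀ {Γ : 𝒞} (A : 𝒟.Ty Γ) (B : 𝒟.Ty A.tot), IsIdentity (β A B ▷ (B.proj ≫ A.proj))
  p_sub : ∀ {Γ Ω : 𝒞} (A : 𝒟.Ty Γ) (B : 𝒟.Ty A.tot) (f : Ω ⟶ Γ),
    p (𝒟.sub A f) (𝒟.sub B (𝒟.q A f)) ≫ toSigmaForm.map A B f = 𝒟.q B (𝒟.q A f) ≫ p A B
  π_sub : ∀ {Γ Ω : 𝒞} (A : 𝒟.Ty Γ) (B : 𝒟.Ty A.tot) (f : Ω ⟶ Γ),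
    π (𝒟.sub A f) (𝒟.sub B (𝒟.q A f)) ≫ 𝒟.q B (𝒟.q A f) = toSigmaForm.map A B f ≫ π A B
  η_sub : ∀ {Γ Ω : 𝒞} (A : 𝒟.Ty Γ) (B : 𝒟.Ty A.tot) (f : Ω ⟶ Γ),
    Cell.mk (η (𝒟.sub A f) (𝒟.sub B (𝒟.q A f)) ▷ toSigmaForm.map A B f) =
      Cell.mk (toSigmaForm.map A B f ◁ η A B)
  β_sub : ∀ {Γ Ω : 𝒞} (A : 𝒟.Ty Γ) (B : 𝒟.Ty A.tot) (f : Ω ⟶ Γ),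
    Cell.mk (β (𝒟.sub A f) (𝒟.sub B (𝒟.q A f)) ▷ 𝒟.q B (𝒟.q A f)) =
      Cell.mk (𝒟.q B (𝒟.q A f) ◁ β A B)

/-- Axiomatic dependent products and function extensionality: a family of functors `app` with
chosen pseudo-inverses `λ`, natural in `f : X ⟶ Γ` and stable under re-indexing, from the
category of 1-cells `f ⟶ P_Π` over `Γ` to the category of 1-cells `f• ⟶ P_B` over `Γ.A`. -/
structure AxiomaticPi extends PiForm 𝒟.toDisplayMapCategory where
  app : ∀ {Γ X : 𝒞} (A : 𝒟.Ty Γ) (B : 𝒟.Ty A.tot) (f : X ⟶ Γ),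
    SliceHom (Pi A B).proj f ⥤ SliceHom B.proj (𝒟.q A f)
  lam : ∀ {Γ X : 𝒞} (A : 𝒟.Ty Γ) (B : 𝒟.Ty A.tot) (f : X ⟶ Γ), PseudoInverse (app A B f)
  natural : ∀ {Γ X Y : 𝒞} (A : 𝒟.Ty Γ) (B : 𝒟.Ty A.tot) (f : X ⟶ Γ) (g : Y ⟶ X),
    Stable
      (SliceHom.rel (Pi A B).proj f (Pi A B).proj (g ≫ f) g (𝟙 _))
      (SliceHom.rel B.proj (𝒟.q A f) B.proj (𝒟.q A (g ≫ f))
        (castHom (𝒟.sub_comp A f g) ≫ 𝒟.q (𝒟.sub A f) g) (𝟙 _))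
      (lam A B f) (lam A B (g ≫ f))
  stable : ∀ {Γ Ω : 𝒞} (A : 𝒟.Ty Γ) (B : 𝒟.Ty A.tot) (f : Ω ⟶ Γ),
    Stable
      (SliceHom.rel (Pi A B).proj f (Pi (𝒟.sub A f) (𝒟.sub B (𝒟.q A f))).proj (𝟙 Ω)
        (𝟙 Ω) (toPiForm.map A B f))
      (SliceHom.rel B.proj (𝒟.q A f) (𝒟.sub B (𝒟.q A f)).proj (𝒟.q (𝒟.sub A f) (𝟙 Ω))
        (𝒟.q (𝒟.sub A f) (𝟙 Ω)) (𝒟.q B (𝒟.q A f)))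
      (lam A B f) (lam (𝒟.sub A f) (𝒟.sub B (𝒟.q A f)) (𝟙 Ω))

/-- The category of sections of `P_C`. -/
abbrev Sections {Γ : 𝒞} (C : 𝒟.Ty Γ) := SliceHom C.proj (𝟙 Γ)

/-- Axiomatic empty types: the functor from the sections of any type over `0` to the terminal
category has a chosen pseudo-inverse, stably under re-indexing. -/
structure AxiomaticZero extends ZeroForm 𝒟.toDisplayMapCategory where
  ind : ∀ {Γ : 𝒞} (C : 𝒟.Ty (ty Γ).tot), PseudoInverse (Functor.star.{0} (Sections 𝒟 C))
  ind_sub : ∀ {Γ Ω : 𝒞} (C : 𝒟.Ty (ty Γ).tot) (f : Ω ⟶ Γ),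
    Stable
      (SliceHom.rel C.proj (𝟙 _) (𝒟.sub C (toConstForm.map f)).proj (𝟙 _)
        (toConstForm.map f) (𝒟.q C (toConstForm.map f)))
      (fun _ _ _ _ _ _ => True)
      (ind C) (ind (𝒟.sub C (toConstForm.map f)))

/-- Axiomatic unit types: pre-composition with `⋆`, from the sections of a type `C` over `1` to
the 1-cells `⋆ ⟶ P_C` over `Γ.1`, has a chosen pseudo-inverse, stably under re-indexing. -/
structure AxiomaticOne extends OneForm 𝒟.toDisplayMapCategory where
  ind : ∀ {Γ : 𝒞} (C : 𝒟.Ty (ty Γ).tot),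
    PseudoInverse (SliceHom.pre C.proj (star Γ).hom (Category.comp_id _))
  ind_sub : ∀ {Γ Ω : 𝒞} (C : 𝒟.Ty (ty Γ).tot) (f : Ω ⟶ Γ),
    Stable
      (SliceHom.rel C.proj (𝟙 _) (𝒟.sub C (toConstForm.map f)).proj (𝟙 _)
        (toConstForm.map f) (𝒟.q C (toConstForm.map f)))
      (SliceHom.rel C.proj (star Γ).hom (𝒟.sub C (toConstForm.map f)).proj (star Ω).hom
        f (𝒟.q C (toConstForm.map f)))
      (ind C) (ind (𝒟.sub C (toConstForm.map f)))

/-- Axiomatic types `2`: pre-composition with `⊥` and `⊤`, from the sections of a type `C` over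
`2` to the pairs of 1-cells `⊥ ⟶ P_C`, `⊤ ⟶ P_C` over `Γ.2`, has a chosen pseudo-inverse, stably
under re-indexing. -/
structure AxiomaticTwo extends TwoForm 𝒟.toDisplayMapCategory where
  ind : ∀ {Γ : 𝒞} (C : 𝒟.Ty (ty Γ).tot),
    PseudoInverse
      ((SliceHom.pre C.proj (bot Γ).hom (Category.comp_id _)).prod'
        (SliceHom.pre C.proj (top Γ).hom (Category.comp_id _)))
  ind_sub : ∀ {Γ Ω : 𝒞} (C : 𝒟.Ty (ty Γ).tot) (f : Ω ⟶ Γ),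
    Stable
      (SliceHom.rel C.proj (𝟙 _) (𝒟.sub C (toConstForm.map f)).proj (𝟙 _)
        (toConstForm.map f) (𝒟.q C (toConstForm.map f)))
      ((SliceHom.rel C.proj (bot Γ).hom (𝒟.sub C (toConstForm.map f)).proj (bot Ω).hom
        f (𝒟.q C (toConstForm.map f))).prod
        (SliceHom.rel C.proj (top Γ).hom (𝒟.sub C (toConstForm.map f)).proj (top Ω).hom
          f (𝒟.q C (toConstForm.map f))))
      (ind C) (ind (𝒟.sub C (toConstForm.map f)))

/-- Axiomatic types of natural numbers: for each type `C` over `ℕ`, each 1-cell `c : 0 ⟶ P_C` and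
each 1-cell `d : s P_C ⟶ P_C` over `Γ.ℕ`, a chosen section `ind c d` of `P_C` and chosen 2-cells
`(ind c d) 0 ⟶ c` and `(ind c d) s ⟶ d (ind c d)` over `Γ.ℕ`, stably under re-indexing. -/
structure AxiomaticNat extends NatForm 𝒟.toDisplayMapCategory where
  ind : ∀ {Γ : 𝒞} {C : 𝒟.Ty (ty Γ).tot} (_ : SliceHom C.proj (zero Γ).hom)
    (_ : SliceHom C.proj (C.proj ≫ s Γ)), Sections 𝒟 C
  βzero : ∀ {Γ : 𝒞} {C : 𝒟.Ty (ty Γ).tot} (c : SliceHom C.proj (zero Γ).hom)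
    (d : SliceHom C.proj (C.proj ≫ s Γ)), (zero Γ).hom ≫ (ind c d).hom ⟶ c.hom
  βzero_proj : ∀ {Γ : 𝒞} {C : 𝒟.Ty (ty Γ).tot} (c : SliceHom C.proj (zero Γ).hom)
    (d : SliceHom C.proj (C.proj ≫ s Γ)), IsIdentity (βzero c d ▷ C.proj)
  βsucc : ∀ {Γ : 𝒞} {C : 𝒟.Ty (ty Γ).tot} (c : SliceHom C.proj (zero Γ).hom)
    (d : SliceHom C.proj (C.proj ≫ s Γ)), s Γ ≫ (ind c d).hom ⟶ (ind c d).hom ≫ d.hom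
  βsucc_proj : ∀ {Γ : 𝒞} {C : 𝒟.Ty (ty Γ).tot} (c : SliceHom C.proj (zero Γ).hom)
    (d : SliceHom C.proj (C.proj ≫ s Γ)), IsIdentity (βsucc c d ▷ C.proj)
  ind_sub : ∀ {Γ Ω : 𝒞} {C : 𝒟.Ty (ty Γ).tot} (f : Ω ⟶ Γ)
    (c : SliceHom C.proj (zero Γ).hom) (d : SliceHom C.proj (C.proj ≫ s Γ))
    (c' : SliceHom (𝒟.sub C (toConstForm.map f)).proj (zero Ω).hom)
    (d' : SliceHom (𝒟.sub C (toConstForm.map f)).proj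
      ((𝒟.sub C (toConstForm.map f)).proj ≫ s Ω)),
    c'.hom ≫ 𝒟.q C (toConstForm.map f) = f ≫ c.hom →
    d'.hom ≫ 𝒟.q C (toConstForm.map f) = 𝒟.q C (toConstForm.map f) ≫ d.hom →
    (ind c' d').hom ≫ 𝒟.q C (toConstForm.map f) = toConstForm.map f ≫ (ind c d).hom ∧
    Cell.mk (βzero c' d' ▷ 𝒟.q C (toConstForm.map f)) = Cell.mk (f ◁ βzero c d) ∧
    Cell.mk (βsucc c' d' ▷ 𝒟.q C (toConstForm.map f)) =
      Cell.mk (toConstForm.map f ◁ βsucc c d)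

/-- The stronger form of axiomatic natural numbers in which pre-composition with `0` and with
`s P_C`, from the sections of a type `C` over `ℕ` to the pairs of 1-cells `0 ⟶ P_C`,
`s P_C ⟶ P_C` over `Γ.ℕ`, has a chosen pseudo-inverse, stably under re-indexing. -/
structure BireflectiveNat extends NatForm 𝒟.toDisplayMapCategory where
  ind : ∀ {Γ : 𝒞} (C : 𝒟.Ty (ty Γ).tot),
    PseudoInverse
      ((SliceHom.pre C.proj (zero Γ).hom (Category.comp_id _)).prod'
        (SliceHom.pre C.proj (C.proj ≫ s Γ) (Category.comp_id _)))
  ind_sub : ∀ {Γ Ω : 𝒞} (C : 𝒟.Ty (ty Γ).tot) (f : Ω ⟶ Γ),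
    Stable
      (SliceHom.rel C.proj (𝟙 _) (𝒟.sub C (toConstForm.map f)).proj (𝟙 _)
        (toConstForm.map f) (𝒟.q C (toConstForm.map f)))
      ((SliceHom.rel C.proj (zero Γ).hom (𝒟.sub C (toConstForm.map f)).proj (zero Ω).hom
        f (𝒟.q C (toConstForm.map f))).prod
        (SliceHom.rel C.proj (C.proj ≫ s Γ) (𝒟.sub C (toConstForm.map f)).proj
          ((𝒟.sub C (toConstForm.map f)).proj ≫ s Ω)
          (𝒟.q C (toConstForm.map f)) (𝒟.q C (toConstForm.map f))))
      (ind C) (ind (𝒟.sub C (toConstForm.map f)))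

variable {𝒟} in
/-- The stronger form of axiomatic natural numbers gives axiomatic natural numbers. -/
def BireflectiveNat.toAxiomaticNat (N : BireflectiveNat 𝒟) : AxiomaticNat 𝒟 where
  toNatForm := N.toNatForm
  ind {_ C} c d := (N.ind C).inv.obj (c, d)
  βzero {_ C} c d := ((N.ind C).β.hom.app (c, d)).1.1
  βzero_proj {_ C} c d := ((N.ind C).β.hom.app (c, d)).1.2
  βsucc {Γ C} c d :=
    eqToHom (by
      change _ = ((N.ind C).inv.obj (c, d)).hom ≫ (C.proj ≫ N.s Γ) ≫ ((N.ind C).inv.obj (c, d)).hom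
      rw [Category.assoc, ← Category.assoc _ C.proj, ((N.ind C).inv.obj (c, d)).w,
        Category.id_comp]) ≫
    ((N.ind C).inv.obj (c, d)).hom ◁ ((N.ind C).β.hom.app (c, d)).2.1
  βsucc_proj {Γ C} c d := by
    rw [comp_whiskerRight, eqToHom_whiskerRight]
    exact isIdentity_comp (isIdentity_eqToHom _)
      (isIdentity_whiskerLeft_whiskerRight _ ((N.ind C).β.hom.app (c, d)).2.2)
  ind_sub {Γ Ω C} f c d c' d' hc hd := by
    have hS := N.ind_sub C f
    have h1 : Cell.mk ((𝟙 c'.hom) ▷ 𝒟.q C (N.toConstForm.map f)) = Cell.mk (f ◁ 𝟙 c.hom) := by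
      rw [id_whiskerRight, whiskerLeft_id]
      exact cell_id hc
    have h2 : Cell.mk ((𝟙 d'.hom) ▷ 𝒟.q C (N.toConstForm.map f)) =
        Cell.mk (𝒟.q C (N.toConstForm.map f) ◁ 𝟙 d.hom) := by
      rw [id_whiskerRight, whiskerLeft_id]
      exact cell_id hd
    have hβ := hS.β (c, d) (c', d') ⟨h1, h2⟩
    have hi := hS.inv (𝟙 (c, d)) (𝟙 (c', d')) ⟨h1, h2⟩
    have e := src_eq_of_cell hi
    refine ⟨e, hβ.1, ?_⟩
    rw [comp_whiskerRight, eqToHom_whiskerRight, cell_eqToHom_comp, cell_whisker_assoc]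
    refine (cell_whiskerLeft rfl hβ.2).trans ?_
    rw [← cell_comp_whiskerLeft]
    refine (cell_whiskerLeft e rfl).trans ?_
    rw [cell_comp_whiskerLeft]
    exact cell_whiskerLeft rfl (cell_eqToHom_comp _ _).symm

end TwoDimensional

end AxiomaticTypes

/-!
The choices of the intensional theory are the axiomatic ones, read off from 1-cells and from the
sources of lifted 2-cells. The assumptions make computation strict: `β` being an identity gives the
rules of `Π`, `0`, `1`, `2` and `ℕ` outright, while for `=` and `Σ` normality of the cleavage does.

*Identity types.* The arrow `r_A` corresponds to the identity 2-cell of `1_{Γ.A}`. By the universal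
property of the arrow object, `Γ.A.A▼.Id_A` contracts onto the image of `r_A`: there is a 2-cell
`AxiomaticId.contr : 1 ⇒ t r`, with `t` the target projection, whose restriction along `r_A` is an
identity (`AxiomaticId.wl_r_contr`). The eliminator `j_c` is the source of the lift of this 2-cell
to `C`; the lift of an identity being an identity, `j_c` restricts to `c` along `r_A`
(`AxiomaticId.r_elim`).

*Dependent sums.* The same argument applies to `Σ_A^B` and `p_A^B` once the 2-cell `η : 1 ⇒ p π` is
an identity after pre-composition with `p`. This is not assumed, but it holds for the composite of
`η` with the inverse of `η * (p π)` (`AxiomaticSigma.unit`, `AxiomaticSigma.wl_p_unit`).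

*Dependent products.* Every functor `app` is, by naturality, the pairing of generalized elements of
`Π_A^B` and `A` followed by one universal arrow (`AxiomaticPi.app_obj_hom`). Evaluation is stable
under re-indexing (`AxiomaticPi.eval_reind`) because a generalized element of `Π_A^B` is a section
after re-indexing to its domain.

*Function extensionality.* A term of an identity type is the same thing as a vertical 2-cell, and a
term `h` of `Hom(z, z')` gives a 2-cell between the values of `z` and `z'` (`homotopyCell`). The
functors `app` are fully faithful, having pseudo-inverses, and `funext h` is the preimage of this
2-cell. The point is that `happly` induces the action of `app` on 2-cells (`isApp_happly`). Both are
2-cells over `Γ.Π.Π▼.Id_Π.A` with the same boundary and they agree on the reflexivity terms, hence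
they are equal by the interchange law (`Cell.eq_of_wl_eq`): the contraction of `Id_Π` extends to
`Id_Π.A` because the chosen pullbacks are 2-pullbacks. Consequently `funext (happly p) = p`, while
`happly (funext h)` and `h` have the same values, so that the identity 2-cell on these has a
preimage under `app`, which is the required identity term.

*Stability.* The strict equalities between iterated re-indexings are handled by the relation `Reind`
and 2-cells are compared through `Cell`, which carries its boundary along. Whatever is obtained here
from a universal property or from full faithfulness is unique, and therefore stable; the lifts
(`liftCell_reind`, `liftCell_reind₃`) and the functors `app`, `λ` are stable by assumption.
-/

namespace AxiomaticTypes

/-! ### Re-indexing as a relation -/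

section Reindexing

variable {𝒞 : Type u} [Category.{v} 𝒞] {𝒟 : DisplayMapCategory 𝒞} {Γ Δ Θ : 𝒞}

/-- `Reind A f A' g` says that `A'` is the chosen re-indexing `A[f]` of `A` and that `g` is the
chosen arrow `f• : Δ.A[f] ⟶ Γ.A`. Keeping `A'` and `g` as indices absorbs the strict equalities
between iterated re-indexings. -/
inductive Reind (A : 𝒟.Ty Γ) (f : Δ ⟶ Γ) : ∀ A' : 𝒟.Ty Δ, (A'.tot ⟶ A.tot) → Prop
  | mk : Reind A f (𝒟.sub A f) (𝒟.q A f)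

namespace Reind

variable {A : 𝒟.Ty Γ} {f : Δ ⟶ Γ} {A' : 𝒟.Ty Δ} {g : A'.tot ⟶ A.tot}

theorem isPullback (h : Reind A f A' g) : IsPullback g A'.proj A.proj f := by
  cases h; exact 𝒟.isPullback A f

theorem w (h : Reind A f A' g) : g ≫ A.proj = A'.proj ≫ f := h.isPullback.w

theorem of_eq (e : A' = 𝒟.sub A f) (hg : g = castHom e ≫ 𝒟.q A f) : Reind A f A' g := by
  subst e
  simp only [castHom, eqToHom_refl, Category.id_comp] at hg
  subst hg
  exact .mk

theorem cast (e : 𝒟.sub A f = A') : Reind A f A' (castHom e.symm ≫ 𝒟.q A f) :=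
  of_eq e.symm rfl

theorem id (A : 𝒟.Ty Γ) : Reind A (𝟙 Γ) A (𝟙 A.tot) :=
  of_eq (𝒟.sub_id A).symm (by rw [𝒟.q_id]; simp [castHom])

theorem comp (h : Reind A f A' g) {f' : Θ ⟶ Δ} {A'' : 𝒟.Ty Θ} {g' : A''.tot ⟶ A'.tot}
    (h' : Reind A' f' A'' g') : Reind A (f' ≫ f) A'' (g' ≫ g) := by
  cases h; cases h'
  refine of_eq (𝒟.sub_comp A f f').symm ?_
  rw [𝒟.q_comp]
  simp [castHom]

theorem congr (h : Reind A f A' g) {f₁ : Δ ⟶ Γ} {g₁ : A'.tot ⟶ A.tot} (e : f = f₁) (e' : g = g₁) :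
    Reind A f₁ A' g₁ := by
  subst e; subst e'; exact h

theorem ty_unique (h : Reind A f A' g) {A₁ : 𝒟.Ty Δ} {g₁ : A₁.tot ⟶ A.tot}
    (h₁ : Reind A f A₁ g₁) : A' = A₁ := by
  cases h; cases h₁; rfl

theorem hom_unique (h : Reind A f A' g) {g₁ : A'.tot ⟶ A.tot} (h₁ : Reind A f A' g₁) :
    g = g₁ := by
  have key : ∀ {A₁ : 𝒟.Ty Δ} {g₁ : A₁.tot ⟶ A.tot}, Reind A f A₁ g₁ → HEq g₁ (𝒟.q A f) := by
    intro A₁ g₁ h₁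
    cases h₁; rfl
  exact eq_of_heq ((key h).trans (key h₁).symm)

theorem castHom_comp (h : Reind A f A' g) {A₁ : 𝒟.Ty Δ} {g₁ : A₁.tot ⟶ A.tot}
    (h₁ : Reind A f A₁ g₁) : castHom (h.ty_unique h₁) ≫ g₁ = g := by
  cases h; cases h₁; simp [castHom]

theorem cancel (h : Reind A f A' g) {f' : Θ ⟶ Δ} {A'' : 𝒟.Ty Θ} {g'' : A''.tot ⟶ A.tot}
    (h' : Reind A (f' ≫ f) A'' g'') : ∃ g', Reind A' f' A'' g' ∧ g' ≫ g = g'' := by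
  cases h; cases h'
  exact ⟨_, of_eq (𝒟.sub_comp A f f') rfl, by rw [𝒟.q_comp, castHom, Category.assoc]⟩

theorem cancel_left (h : Reind A f A' g) {f' : Θ ⟶ Δ} {A'' : 𝒟.Ty Θ} {g' : A''.tot ⟶ A'.tot}
    (h' : Reind A (f' ≫ f) A'' (g' ≫ g)) (hw : g' ≫ A'.proj = A''.proj ≫ f') :
    Reind A' f' A'' g' := by
  obtain ⟨k, hk, e⟩ := h.cancel h'
  refine hk.congr rfl (h.isPullback.hom_ext e ?_)
  rw [hk.w, hw]

/-- The section of `A' = A[f]` induced by an arrow into the total object of `A` over `f`. -/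
noncomputable def sec (h : Reind A f A' g) (x : Δ ⟶ A.tot) (hx : x ≫ A.proj = f) : Sec A' where
  hom := h.isPullback.lift x (𝟙 Δ) (by simp [hx])
  hom_proj := h.isPullback.lift_snd _ _ _

@[simp]
theorem sec_hom (h : Reind A f A' g) (x : Δ ⟶ A.tot) (hx : x ≫ A.proj = f) :
    (h.sec x hx).hom ≫ g = x :=
  h.isPullback.lift_fst _ _ _

theorem sec_ext (h : Reind A f A' g) {a b : Sec A'} (e : a.hom ≫ g = b.hom ≫ g) : a = b :=
  Sec.ext (h.isPullback.hom_ext e (by rw [a.hom_proj, b.hom_proj]))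

theorem sub_comp_right (A : 𝒟.Ty Γ) (f : Δ ⟶ Γ) (g : Θ ⟶ Δ) :
    Reind (𝒟.sub A f) g (𝒟.sub A (g ≫ f)) (castHom (𝒟.sub_comp A f g) ≫ 𝒟.q (𝒟.sub A f) g) :=
  of_eq (𝒟.sub_comp A f g) rfl

end Reind

theorem secOf_q (A : 𝒟.Ty Γ) (f : Δ ⟶ Γ) (x : Δ ⟶ A.tot) (h : x ≫ A.proj = f) :
    (𝒟.secOf A f x h).hom ≫ 𝒟.q A f = x :=
  (𝒟.isPullback A f).lift_fst _ _ _

theorem subSec_q {A : 𝒟.Ty Γ} (a : Sec A) (f : Δ ⟶ Γ) :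
    (𝒟.subSec a f).hom ≫ 𝒟.q A f = f ≫ a.hom :=
  secOf_q _ _ _ _

theorem Sec.same_rfl {A : 𝒟.Ty Γ} (a : Sec A) : a.Same a := rfl

theorem Sec.Same.symm {A B : 𝒟.Ty Γ} {a : Sec A} {b : Sec B} (h : a.Same b) : b.Same a :=
  Eq.symm h

theorem Sec.Same.eq {A : 𝒟.Ty Γ} {a b : Sec A} (h : a.Same b) : a = b := by
  simpa [Sec.Same] using h

theorem Sec.cast_same {A B : 𝒟.Ty Γ} (e : A = B) (a : Sec A) : (a.cast e).Same a := by
  subst e; rfl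

theorem Sec.cast_hom {A B : 𝒟.Ty Γ} (e : A = B) (a : Sec A) :
    (a.cast e).hom = a.hom ≫ castHom e := by
  subst e; simp [Sec.cast, castHom]

/-- Two terms of re-indexings of the same type, along equal arrows, are the same as soon as they
induce the same arrow into the total object of that type. -/
theorem Reind.same {A : 𝒟.Ty Γ} {f f₁ : Δ ⟶ Γ} {A' A₁ : 𝒟.Ty Δ} {g : A'.tot ⟶ A.tot}
    {g₁ : A₁.tot ⟶ A.tot} (h : Reind A f A' g) (h₁ : Reind A f₁ A₁ g₁) {a : Sec A'} {b : Sec A₁}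
    (e : a.hom ≫ g = b.hom ≫ g₁) : a.Same b := by
  have hf : f = f₁ := by
    have := congrArg (· ≫ A.proj) e
    simp only [Category.assoc, h.w, h₁.w] at this
    simpa only [← Category.assoc, a.hom_proj, b.hom_proj, Category.id_comp] using this
  subst hf
  cases h; cases h₁
  rw [Reind.sec_ext .mk e]
  exact Sec.same_rfl _

theorem Reind.same_subSec {A : 𝒟.Ty Γ} {f : Δ ⟶ Γ} {A' : 𝒟.Ty Δ} {g : A'.tot ⟶ A.tot}
    (h : Reind A f A' g) {a : Sec A} {b : Sec A'} (e : b.hom ≫ g = f ≫ a.hom) :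
    (𝒟.subSec a f).Same b :=
  Reind.same .mk h (by rw [subSec_q, e])

theorem Reind.hom_of_same {A : 𝒟.Ty Γ} {f : Δ ⟶ Γ} {A' : 𝒟.Ty Δ} {g : A'.tot ⟶ A.tot}
    (h : Reind A f A' g) {a : Sec A} {b : Sec A'} (e : b.Same (𝒟.subSec a f)) :
    b.hom ≫ g = f ≫ a.hom := by
  cases h
  rw [e.eq, subSec_q]

/-- A term of `C[r]` can be re-indexed along `k` to a term of `C[m][r']` when `r' ≫ m = k ≫ r`. -/
theorem exists_subSec_square {X Y W W' : 𝒞} (C : 𝒟.Ty W) {r : X ⟶ W} {m : W' ⟶ W} {r' : Y ⟶ W'}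
    {k : Y ⟶ X} (e : r' ≫ m = k ≫ r) (c : Sec (𝒟.sub C r)) :
    ∃ c₁ : Sec (𝒟.sub (𝒟.sub C m) r'), c₁.Same (𝒟.subSec c k) ∧
      c₁.hom ≫ 𝒟.q (𝒟.sub C m) r' ≫ 𝒟.q C m = k ≫ c.hom ≫ 𝒟.q C r := by
  have h₁ : Reind C (r' ≫ m) (𝒟.sub (𝒟.sub C m) r') (𝒟.q (𝒟.sub C m) r' ≫ 𝒟.q C m) :=
    Reind.comp .mk .mk
  have h₂ : Reind C (k ≫ r) (𝒟.sub (𝒟.sub C r) k) (𝒟.q (𝒟.sub C r) k ≫ 𝒟.q C r) :=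
    Reind.comp .mk .mk
  have hx : (k ≫ c.hom ≫ 𝒟.q C r) ≫ C.proj = r' ≫ m := by
    rw [Category.assoc, Category.assoc, (𝒟.isPullback C r).w, ← Category.assoc c.hom, c.hom_proj,
      Category.id_comp, e]
  refine ⟨h₁.sec _ hx, h₁.same h₂ ?_, h₁.sec_hom _ hx⟩
  rw [h₁.sec_hom, ← Category.assoc (𝒟.subSec c k).hom, subSec_q, Category.assoc]

section Forms

variable {A : 𝒟.Ty Γ} {f : Δ ⟶ Γ} {A' : 𝒟.Ty Δ} {g : A'.tot ⟶ A.tot}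

theorem wkMap_proj (A : 𝒟.Ty Γ) (f : Δ ⟶ Γ) :
    𝒟.wkMap A f ≫ (𝒟.wk A).proj = (𝒟.wk (𝒟.sub A f)).proj ≫ 𝒟.q A f :=
  (𝒟.isPullback A A.proj).lift_snd _ _ _

theorem wkMap_q (A : 𝒟.Ty Γ) (f : Δ ⟶ Γ) :
    𝒟.wkMap A f ≫ 𝒟.q A A.proj = 𝒟.q (𝒟.sub A f) (𝒟.sub A f).proj ≫ 𝒟.q A f :=
  (𝒟.isPullback A A.proj).lift_fst _ _ _

theorem reind_wkMap (A : 𝒟.Ty Γ) (f : Δ ⟶ Γ) :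
    Reind (𝒟.wk A) (𝒟.q A f) (𝒟.wk (𝒟.sub A f)) (𝒟.wkMap A f) := by
  have h : Reind A ((𝒟.sub A f).proj ≫ f) (𝒟.wk (𝒟.sub A f))
      (𝒟.q (𝒟.sub A f) (𝒟.sub A f).proj ≫ 𝒟.q A f) := Reind.comp .mk .mk
  refine Reind.cancel_left (A := A) (f := A.proj) .mk (h.congr ?_ ?_) ?_
  · exact (𝒟.isPullback A f).w.symm
  · exact (wkMap_q A f).symm
  · exact wkMap_proj A f

theorem IdForm.reind_map (I : IdForm 𝒟) (A : 𝒟.Ty Γ) (f : Δ ⟶ Γ) :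
    Reind (I.Id A) (𝒟.wkMap A f) (I.Id (𝒟.sub A f)) (I.map A f) :=
  Reind.cast (I.Id_sub A f)

theorem SigmaForm.reind_map (S : SigmaForm 𝒟) (A : 𝒟.Ty Γ) (B : 𝒟.Ty A.tot) (f : Δ ⟶ Γ) :
    Reind (S.Sig A B) f (S.Sig (𝒟.sub A f) (𝒟.sub B (𝒟.q A f))) (S.map A B f) :=
  Reind.cast (S.Sig_sub A B f)

theorem PiForm.reind_map (P : PiForm 𝒟) (A : 𝒟.Ty Γ) (B : 𝒟.Ty A.tot) (f : Δ ⟶ Γ) :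
    Reind (P.Pi A B) f (P.Pi (𝒟.sub A f) (𝒟.sub B (𝒟.q A f))) (P.map A B f) :=
  Reind.cast (P.Pi_sub A B f)

theorem ConstForm.reind_map (K : ConstForm 𝒟) (f : Δ ⟶ Γ) :
    Reind (K.ty Γ) f (K.ty Δ) (K.map f) :=
  Reind.cast (K.ty_sub f)

theorem Reind.pi (P : PiForm 𝒟) (h : Reind A f A' g) {B : 𝒟.Ty A.tot} {B' : 𝒟.Ty A'.tot}
    {g' : B'.tot ⟶ B.tot} (h' : Reind B g B' g') :
    ∃ n, Reind (P.Pi A B) f (P.Pi A' B') n := by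
  cases h; cases h'
  exact ⟨_, P.reind_map A B f⟩

theorem pair_proj {A : 𝒟.Ty Γ} (a b : Sec A) : 𝒟.pair a b ≫ (𝒟.wk A).proj = a.hom :=
  (𝒟.isPullback A A.proj).lift_snd _ _ _

theorem pair_q {A : 𝒟.Ty Γ} (a b : Sec A) : 𝒟.pair a b ≫ 𝒟.q A A.proj = b.hom :=
  (𝒟.isPullback A A.proj).lift_fst _ _ _

theorem diag_proj (A : 𝒟.Ty Γ) : 𝒟.diag A ≫ (𝒟.wk A).proj = 𝟙 _ :=
  (𝒟.isPullback A A.proj).lift_snd _ _ _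

theorem diag_q (A : 𝒟.Ty Γ) : 𝒟.diag A ≫ 𝒟.q A A.proj = 𝟙 _ :=
  (𝒟.isPullback A A.proj).lift_fst _ _ _

theorem wk_hom_ext {A : 𝒟.Ty Γ} {X : 𝒞} {x y : X ⟶ (𝒟.wk A).tot}
    (h : x ≫ (𝒟.wk A).proj = y ≫ (𝒟.wk A).proj)
    (h' : x ≫ 𝒟.q A A.proj = y ≫ 𝒟.q A A.proj) : x = y :=
  (𝒟.isPullback A A.proj).hom_ext h' h

end Forms

end Reindexing

open Bicategory

/-! ### Whiskering of 2-cells with boundary -/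

namespace Cell

section

variable {𝒞 : Type u} [Bicategory.{w, v} 𝒞] {W X Y Z : 𝒞}

/-- Pre-composition of a 2-cell with boundary with a 1-cell: `c * k` in functional order. -/
def wl (k : W ⟶ X) (c : Cell X Y) : Cell W Y := mk (k ◁ c.hom)

/-- Post-composition of a 2-cell with boundary with a 1-cell: `q * c` in functional order. -/
def wr (c : Cell X Y) (q : Y ⟶ Z) : Cell X Z := mk (c.hom ▷ q)

/-- The identity 2-cell of a 1-cell. -/
def one (f : X ⟶ Y) : Cell X Y := mk (𝟙 f)

/-- A 2-cell with boundary is an identity. -/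
def IsOne (c : Cell X Y) : Prop := ∃ f, c = one f

@[simp] theorem wl_src (k : W ⟶ X) (c : Cell X Y) : (wl k c).src = k ≫ c.src := rfl
@[simp] theorem wl_tgt (k : W ⟶ X) (c : Cell X Y) : (wl k c).tgt = k ≫ c.tgt := rfl
@[simp] theorem wr_src (c : Cell X Y) (q : Y ⟶ Z) : (wr c q).src = c.src ≫ q := rfl
@[simp] theorem wr_tgt (c : Cell X Y) (q : Y ⟶ Z) : (wr c q).tgt = c.tgt ≫ q := rfl
@[simp] theorem one_src (f : X ⟶ Y) : (one f).src = f := rfl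
@[simp] theorem one_tgt (f : X ⟶ Y) : (one f).tgt = f := rfl

theorem mk_wr {f g : X ⟶ Y} (η : f ⟶ g) (q : Y ⟶ Z) : mk (η ▷ q) = wr (mk η) q := rfl

@[simp] theorem wl_one (k : W ⟶ X) (f : X ⟶ Y) : wl k (one f) = one (k ≫ f) := by
  simp [wl, one]

@[simp] theorem wr_one (f : X ⟶ Y) (q : Y ⟶ Z) : wr (one f) q = one (f ≫ q) := by
  simp [wr, one]

theorem IsOne.eq_src {c : Cell X Y} (h : c.IsOne) : c = one c.src := by
  obtain ⟨f, rfl⟩ := h; rfl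

theorem IsOne.src_eq_tgt {c : Cell X Y} (h : c.IsOne) : c.src = c.tgt := by
  obtain ⟨f, rfl⟩ := h; rfl

theorem IsOne.wl {c : Cell X Y} (h : c.IsOne) (k : W ⟶ X) : (wl k c).IsOne := by
  obtain ⟨f, rfl⟩ := h; exact ⟨_, wl_one k f⟩

theorem IsOne.wr {c : Cell X Y} (h : c.IsOne) (q : Y ⟶ Z) : (wr c q).IsOne := by
  obtain ⟨f, rfl⟩ := h; exact ⟨_, wr_one f q⟩

theorem mk_injective {f g : X ⟶ Y} {η θ : f ⟶ g} (h : mk η = mk θ) : η = θ := by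
  simpa using h

/-- Every 2-cell with boundary can be given any boundary equal to its own. -/
theorem exists_hom (c : Cell X Y) {f g : X ⟶ Y} (hf : c.src = f) (hg : c.tgt = g) :
    ∃ η : f ⟶ g, mk η = c := by
  subst hf; subst hg; exact ⟨c.hom, rfl⟩

end

theorem isIdentity_iff {𝒞 : Type u} [Bicategory.{w, v} 𝒞] {X Y : 𝒞} {f g : X ⟶ Y} {η : f ⟶ g} :
    IsIdentity η ↔ (mk η).IsOne := by
  constructor
  · rintro ⟨rfl, rfl⟩
    exact ⟨f, rfl⟩
  · rintro ⟨k, h⟩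
    obtain rfl : f = k := congrArg Cell.src h
    obtain rfl : g = f := congrArg Cell.tgt h
    exact ⟨rfl, mk_injective h⟩

theorem _root_.AxiomaticTypes.IsIdentity.mk_eq {𝒞 : Type u} [Bicategory.{w, v} 𝒞] {X Y : 𝒞}
    {f g : X ⟶ Y} {η : f ⟶ g} (h : IsIdentity η) : mk η = one f :=
  (isIdentity_iff.1 h).eq_src

section

variable {𝒞 : Type u} [Bicategory.{w, v} 𝒞] [Bicategory.Strict 𝒞] {V W X Y Z : 𝒞}

@[simp] theorem wl_wl (l : V ⟶ W) (k : W ⟶ X) (c : Cell X Y) : wl l (wl k c) = wl (l ≫ k) c :=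
  (cell_comp_whiskerLeft l k c.hom).symm

theorem wr_wl (k : W ⟶ X) (c : Cell X Y) (q : Y ⟶ Z) : wr (wl k c) q = wl k (wr c q) :=
  cell_whisker_assoc k c.hom q

@[simp] theorem wl_id (c : Cell X Y) : wl (𝟙 X) c = c := by
  obtain ⟨η⟩ := c
  simp only [wl, id_whiskerLeft, Strict.leftUnitor_eqToIso, eqToIso.hom, eqToIso.inv]
  exact (cell_eqToHom_comp _ _).trans (cell_comp_eqToHom _ _)

@[simp] theorem wr_id (c : Cell X Y) : wr c (𝟙 Y) = c := by
  obtain ⟨η⟩ := c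
  simp only [wr, whiskerRight_id, Strict.rightUnitor_eqToIso, eqToIso.hom, eqToIso.inv]
  exact (cell_eqToHom_comp _ _).trans (cell_comp_eqToHom _ _)

@[simp] theorem wr_wr (c : Cell W X) (p : X ⟶ Y) (q : Y ⟶ Z) :
    wr (wr c p) q = wr c (p ≫ q) := by
  obtain ⟨η⟩ := c
  simp only [wr, whiskerRight_comp, Strict.associator_eqToIso, eqToIso.hom, eqToIso.inv]
  exact ((cell_eqToHom_comp _ _).trans (cell_comp_eqToHom _ _)).symm

/-- If `m` is isomorphic to the identity 1-cell then whiskering by `m` is faithful, by the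
interchange law. -/
theorem eq_of_wl_eq [IsLocallyGroupoid 𝒞] {m : X ⟶ X} (ρ : 𝟙 X ⟶ m) {c c' : Cell X Y}
    (hs : c.src = c'.src) (ht : c.tgt = c'.tgt) (h : wl m c = wl m c') : c = c' := by
  obtain ⟨η⟩ := c
  obtain ⟨η'⟩ := c'
  dsimp at hs ht
  subst hs; subst ht
  have h' : m ◁ η = m ◁ η' := mk_injective h
  have e₁ := whisker_exchange ρ η
  have e₂ := whisker_exchange ρ η'
  rw [h', ← e₂] at e₁
  have e₃ := (cancel_mono _).1 e₁
  rw [← wl_id (mk η), ← wl_id (mk η')]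
  exact congrArg mk e₃

end

end Cell

/-! ### Lifts along display maps and arrow objects -/

section Lifting

variable {𝒞 : Type u} [Bicategory.{w, v} 𝒞] [Bicategory.Strict 𝒞] [IsLocallyGroupoid 𝒞]
  (𝒟 : DisplayMap2Category 𝒞) {Γ Ω X Y : 𝒞}

/-- The chosen lift of a 2-cell with boundary `c : f ⟶ P_A g`. Its source is the 1-cell `t_g^c`. -/
noncomputable def liftCell (A : 𝒟.Ty Γ) (g : X ⟶ A.tot) (c : Cell X Γ) (h : c.tgt = g ≫ A.proj) :
    Cell X A.tot :=
  Cell.mk (𝒟.cleavage.τ A g (c.hom ≫ eqToHom h))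

variable {𝒟}

theorem mk_τ (A : 𝒟.Ty Γ) (g : X ⟶ A.tot) {f : X ⟶ Γ} (p : f ⟶ g ≫ A.proj) :
    Cell.mk (𝒟.cleavage.τ A g p) = liftCell 𝒟 A g (Cell.mk p) rfl := by
  rw [liftCell, eqToHom_refl]
  exact congrArg (fun p => Cell.mk (𝒟.cleavage.τ A g p)) (Category.comp_id p).symm

theorem liftCell_congr (A : 𝒟.Ty Γ) {g g' : X ⟶ A.tot} {c c' : Cell X Γ} (hg : g = g')
    (hc : c = c') (h : c.tgt = g ≫ A.proj) :
    liftCell 𝒟 A g c h = liftCell 𝒟 A g' c' (by rw [← hc, h, hg]) := by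
  subst hg; subst hc; rfl

theorem liftCell_wr (A : 𝒟.Ty Γ) (g : X ⟶ A.tot) (c : Cell X Γ) (h : c.tgt = g ≫ A.proj) :
    Cell.wr (liftCell 𝒟 A g c h) A.proj = c :=
  (𝒟.cleavage.τ_proj A g _).trans (cell_comp_eqToHom _ _)

theorem liftCell_src_proj (A : 𝒟.Ty Γ) (g : X ⟶ A.tot) (c : Cell X Γ)
    (h : c.tgt = g ≫ A.proj) : (liftCell 𝒟 A g c h).src ≫ A.proj = c.src :=
  congrArg Cell.src (liftCell_wr A g c h)

theorem wl_liftCell (A : 𝒟.Ty Γ) (g : X ⟶ A.tot) (c : Cell X Γ) (h : c.tgt = g ≫ A.proj)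
    (k : Y ⟶ X) :
    Cell.wl k (liftCell 𝒟 A g c h) =
      liftCell 𝒟 A (k ≫ g) (Cell.wl k c) (by rw [Cell.wl_tgt, h, Category.assoc]) := by
  obtain ⟨p⟩ := c
  dsimp at h
  subst h
  rw [← mk_τ]
  refine (𝒟.cleavage.τ_comp A g p k).symm.trans ?_
  rw [mk_τ]
  refine liftCell_congr A rfl ?_ rfl
  rw [Strict.associator_eqToIso]
  exact cell_comp_eqToHom (k ◁ p) (Category.assoc k g A.proj).symm

theorem liftCell_one (hn : 𝒟.Normal) (A : 𝒟.Ty Γ) (g : X ⟶ A.tot) :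
    liftCell 𝒟 A g (Cell.one (g ≫ A.proj)) rfl = Cell.one g :=
  (mk_τ A g _).symm.trans (hn A g)

/-- Stability of the chosen lifts for a display map over a type. -/
theorem liftCell_reind {A : 𝒟.Ty Γ} {f : Ω ⟶ Γ} {A' : 𝒟.Ty Ω} {g : A'.tot ⟶ A.tot}
    (hA : Reind A f A' g) {C : 𝒟.Ty A.tot} {C' : 𝒟.Ty A'.tot} {n : C'.tot ⟶ C.tot}
    (hC : Reind C g C' n) {X X' : 𝒞} (k : X' ⟶ X) (x : X ⟶ C.tot) (c : Cell X A.tot)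
    (h : c.tgt = x ≫ C.proj) (x' : X' ⟶ C'.tot) (c' : Cell X' A'.tot)
    (h' : c'.tgt = x' ≫ C'.proj) (hx : x' ≫ n = k ≫ x) (hc : (c.wr A.proj).IsOne)
    (hc' : (c'.wr A'.proj).IsOne) (e : c'.wr g = c.wl k) :
    (liftCell 𝒟 C' x' c' h').wr n = (liftCell 𝒟 C x c h).wl k := by
  cases hA; cases hC
  obtain ⟨p⟩ := c
  obtain ⟨p'⟩ := c'
  dsimp at h h'
  subst h; subst h'
  rw [← mk_τ, ← mk_τ]
  refine 𝒟.cleavage.τ_sub A (.nil _) f C k x p x' p' hx ?_ ?_ e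
  · refine Cell.isIdentity_iff.2 ?_
    change (Cell.wr (Cell.mk p) (𝟙 _ ≫ A.proj)).IsOne
    rwa [Category.id_comp]
  · refine Cell.isIdentity_iff.2 ?_
    change (Cell.wr (Cell.mk p') (𝟙 _ ≫ (𝒟.sub A f).proj)).IsOne
    rwa [Category.id_comp]

/-- Stability of the chosen lifts for a display map over a telescope of three types, such as
`Γ.A.A▼.Id_A`. -/
theorem liftCell_reind₃ {A : 𝒟.Ty Γ} {f : Ω ⟶ Γ} {A' : 𝒟.Ty Ω} {g : A'.tot ⟶ A.tot}
    (hA : Reind A f A' g) {B : 𝒟.Ty A.tot} {B' : 𝒟.Ty A'.tot} {g₂ : B'.tot ⟶ B.tot}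
    (hB : Reind B g B' g₂) {E : 𝒟.Ty B.tot} {E' : 𝒟.Ty B'.tot} {g₃ : E'.tot ⟶ E.tot}
    (hE : Reind E g₂ E' g₃) {C : 𝒟.Ty E.tot} {C' : 𝒟.Ty E'.tot} {n : C'.tot ⟶ C.tot}
    (hC : Reind C g₃ C' n) {X X' : 𝒞} (k : X' ⟶ X) (x : X ⟶ C.tot) (c : Cell X E.tot)
    (h : c.tgt = x ≫ C.proj) (x' : X' ⟶ C'.tot) (c' : Cell X' E'.tot)
    (h' : c'.tgt = x' ≫ C'.proj) (hx : x' ≫ n = k ≫ x)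
    (hc : (c.wr ((E.proj ≫ B.proj) ≫ A.proj)).IsOne)
    (hc' : (c'.wr ((E'.proj ≫ B'.proj) ≫ A'.proj)).IsOne) (e : c'.wr g₃ = c.wl k) :
    (liftCell 𝒟 C' x' c' h').wr n = (liftCell 𝒟 C x c h).wl k := by
  cases hA; cases hB; cases hE; cases hC
  obtain ⟨p⟩ := c
  obtain ⟨p'⟩ := c'
  dsimp at h h'
  subst h; subst h'
  rw [← mk_τ, ← mk_τ]
  refine 𝒟.cleavage.τ_sub A (.cons B (.cons E (.nil _))) f C k x p x' p' hx ?_ ?_ e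
  · refine Cell.isIdentity_iff.2 ?_
    change (Cell.wr (Cell.mk p) (((𝟙 _ ≫ E.proj) ≫ B.proj) ≫ A.proj)).IsOne
    rwa [Category.id_comp]
  · refine Cell.isIdentity_iff.2 ?_
    change (Cell.wr (Cell.mk p') (((𝟙 _ ≫ (𝒟.sub E _).proj) ≫ (𝒟.sub B _).proj) ≫
      (𝒟.sub A f).proj)).IsOne
    rwa [Category.id_comp]

/-- Two-dimensional existence part of the universal property of the chosen pullbacks. -/
theorem exists_pullback_cell (A : 𝒟.Ty Γ) (f : Ω ⟶ Γ) {x y : X ⟶ (𝒟.sub A f).tot}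
    (σ : Cell X Ω) (τ : Cell X A.tot) (hσ : σ.src = x ≫ (𝒟.sub A f).proj)
    (hσ' : σ.tgt = y ≫ (𝒟.sub A f).proj) (hτ : τ.src = x ≫ 𝒟.q A f) (hτ' : τ.tgt = y ≫ 𝒟.q A f)
    (e : σ.wr f = τ.wr A.proj) : Nonempty (x ⟶ y) := by
  obtain ⟨σ, rfl⟩ := Cell.exists_hom σ hσ hσ'
  obtain ⟨τ, rfl⟩ := Cell.exists_hom τ hτ hτ'
  obtain ⟨ρ, -, -⟩ := 𝒟.two_pullback A f x y σ τ e
  exact ⟨ρ⟩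

end Lifting

section Identity

variable {𝒞 : Type u} [Bicategory.{w, v} 𝒞] [Bicategory.Strict 𝒞] [IsLocallyGroupoid 𝒞]
  {𝒟 : DisplayMap2Category 𝒞} {Γ Ω X Y : 𝒞}

namespace AxiomaticId

variable (I : AxiomaticId 𝒟)

/-- The source projection `Γ.A.A▼.Id_A ⟶ Γ.A` of the arrow object. -/
abbrev s (A : 𝒟.Ty Γ) : (I.Id A).tot ⟶ A.tot := (I.Id A).proj ≫ (𝒟.wk A).proj

/-- The target projection `Γ.A.A▼.Id_A ⟶ Γ.A` of the arrow object. -/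
abbrev t (A : 𝒟.Ty Γ) : (I.Id A).tot ⟶ A.tot := (I.Id A).proj ≫ 𝒟.q A A.proj

/-- The 2-cell `α_A` with its boundary. -/
abbrev αc (A : 𝒟.Ty Γ) : Cell (I.Id A).tot A.tot := Cell.mk (I.α A)

theorem s_proj_eq_t_proj (A : 𝒟.Ty Γ) : I.s A ≫ A.proj = I.t A ≫ A.proj := by
  rw [Category.assoc, Category.assoc, (𝒟.isPullback A A.proj).w]

theorem αc_isOne (A : 𝒟.Ty Γ) : ((I.αc A).wr A.proj).IsOne :=
  Cell.isIdentity_iff.1 (I.α_proj A)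

theorem hom_ext {A : 𝒟.Ty Γ} {x y : X ⟶ (I.Id A).tot}
    (h : (I.αc A).wl x = (I.αc A).wl y) : x = y :=
  (I.α_obj A (x ◁ I.α A) (isIdentity_whiskerLeft_whiskerRight x (I.α_proj A))).unique rfl h.symm

theorem exists_arrow (A : 𝒟.Ty Γ) (c : Cell X A.tot) (h : (c.wr A.proj).IsOne) :
    ∃ x : X ⟶ (I.Id A).tot, (I.αc A).wl x = c :=
  (I.α_obj A c.hom (Cell.isIdentity_iff.2 h)).exists

theorem αc_reind (A : 𝒟.Ty Γ) (f : Ω ⟶ Γ) :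
    (I.αc (𝒟.sub A f)).wr (𝒟.q A f) = (I.αc A).wl (I.map A f) :=
  I.α_sub A f

theorem cell_ext {A : 𝒟.Ty Γ} {c c' : Cell X (I.Id A).tot} (hs : c.src = c'.src)
    (ht : c.tgt = c'.tgt) (h₁ : c.wr (I.s A) = c'.wr (I.s A)) (h₂ : c.wr (I.t A) = c'.wr (I.t A))
    (h₃ : (c.wr (I.s A ≫ A.proj)).IsOne) : c = c' := by
  obtain ⟨η⟩ := c
  obtain ⟨η'⟩ := c'
  dsimp at hs ht
  subst hs; subst ht
  have e₁ : IsIdentity ((η ▷ I.s A) ▷ A.proj) := by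
    refine Cell.isIdentity_iff.2 ?_
    rw [Cell.mk_wr, Cell.mk_wr, Cell.wr_wr]
    exact h₃
  have e₂ : IsIdentity ((η ▷ I.t A) ▷ A.proj) := by
    refine Cell.isIdentity_iff.2 ?_
    rw [Cell.mk_wr, Cell.mk_wr, Cell.wr_wr, ← s_proj_eq_t_proj]
    exact h₃
  have := (I.α_hom A _ _ (η ▷ I.s A) (η ▷ I.t A) e₁ e₂ (whisker_exchange η (I.α A)).symm).unique
    ⟨rfl, rfl⟩ ⟨(Cell.mk_injective h₁).symm, (Cell.mk_injective h₂).symm⟩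
  rw [this]

/-- There is a 2-cell from an arrow `x` to the identity arrow on its target. -/
theorem exists_contraction {A : 𝒟.Ty Γ} {x y : X ⟶ (I.Id A).tot}
    (hy : (I.αc A).wl y = Cell.one (x ≫ I.t A)) :
    ∃ c : Cell X (I.Id A).tot, c.src = x ∧ c.tgt = y ∧ c.wr (I.s A) = (I.αc A).wl x ∧
      c.wr (I.t A) = Cell.one (x ≫ I.t A) := by
  have hs : x ≫ I.t A = y ≫ I.s A := (congrArg Cell.src hy).symm
  have ht : x ≫ I.t A = y ≫ I.t A := (congrArg Cell.tgt hy).symm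
  obtain ⟨hst, hy'⟩ := Cell.isIdentity_iff.2 ⟨_, hy⟩
  have e₁ : IsIdentity ((x ◁ I.α A ≫ eqToHom hs) ▷ A.proj) := by
    rw [comp_whiskerRight, eqToHom_whiskerRight]
    exact isIdentity_comp (isIdentity_whiskerLeft_whiskerRight x (I.α_proj A))
      (isIdentity_eqToHom _)
  have e₂ : IsIdentity (eqToHom ht ▷ A.proj) := by
    rw [eqToHom_whiskerRight]
    exact isIdentity_eqToHom _
  obtain ⟨ρ, ⟨h₁, h₂⟩, -⟩ := I.α_hom A x y (x ◁ I.α A ≫ eqToHom hs) (eqToHom ht) e₁ e₂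
    (by rw [hy', Category.assoc, eqToHom_trans])
  refine ⟨Cell.mk ρ, rfl, rfl, ?_, ?_⟩
  · exact (congrArg Cell.mk h₁).trans (cell_comp_eqToHom _ _)
  · exact (congrArg Cell.mk h₂).trans (isIdentity_eqToHom ht).mk_eq

end AxiomaticId

end Identity

/-! ### Identity types -/

noncomputable section IdentityRules

variable {𝒞 : Type u} [Bicategory.{w, v} 𝒞] [Bicategory.Strict 𝒞] [IsLocallyGroupoid 𝒞]
  {𝒟 : DisplayMap2Category 𝒞} {Γ Ω X Y : 𝒞}

namespace AxiomaticId

variable (I : AxiomaticId 𝒟)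

/-- The arrow `r_A : Γ.A ⟶ Γ.A.A▼.Id_A` corresponding to the identity 2-cell. -/
def r (A : 𝒟.Ty Γ) : A.tot ⟶ (I.Id A).tot :=
  (I.exists_arrow A (Cell.one (𝟙 A.tot)) ⟨_, Cell.wr_one _ _⟩).choose

theorem wl_r (A : 𝒟.Ty Γ) : (I.αc A).wl (I.r A) = Cell.one (𝟙 A.tot) :=
  (I.exists_arrow A (Cell.one (𝟙 A.tot)) ⟨_, Cell.wr_one _ _⟩).choose_spec

theorem r_s (A : 𝒟.Ty Γ) : I.r A ≫ I.s A = 𝟙 A.tot := congrArg Cell.src (I.wl_r A)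

theorem r_t (A : 𝒟.Ty Γ) : I.r A ≫ I.t A = 𝟙 A.tot := congrArg Cell.tgt (I.wl_r A)

theorem r_proj (A : 𝒟.Ty Γ) : I.r A ≫ (I.Id A).proj = 𝒟.diag A :=
  wk_hom_ext (by rw [Category.assoc, I.r_s, diag_proj]) (by rw [Category.assoc, I.r_t, diag_q])

theorem r_map (A : 𝒟.Ty Γ) (f : Ω ⟶ Γ) :
    I.r (𝒟.sub A f) ≫ I.map A f = 𝒟.q A f ≫ I.r A := by
  refine I.hom_ext ?_
  rw [← Cell.wl_wl, ← I.αc_reind, ← Cell.wr_wl, wl_r, ← Cell.wl_wl, wl_r, Cell.wr_one,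
    Cell.wl_one, Category.id_comp, Category.comp_id]

/-- Introduction for identity types: reflexivity is the term corresponding to `r_A`. -/
def idIntro : IdIntro I.toIdForm where
  refl A := 𝒟.secOf (I.Id A) (𝒟.diag A) (I.r A) (I.r_proj A)
  refl_sub A f := by
    refine Reind.same (Reind.comp .mk .mk) (Reind.comp (I.reind_map A f) .mk) ?_
    rw [← Category.assoc, subSec_q, Category.assoc, secOf_q, ← Category.assoc, secOf_q,
      I.r_map]

theorem idIntro_r (A : 𝒟.Ty Γ) : I.idIntro.r A = I.r A :=
  secOf_q _ _ _ (I.r_proj A)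

theorem map_s (A : 𝒟.Ty Γ) (f : Ω ⟶ Γ) :
    I.map A f ≫ I.s A = I.s (𝒟.sub A f) ≫ 𝒟.q A f :=
  congrArg Cell.src (I.αc_reind A f).symm

theorem map_t (A : 𝒟.Ty Γ) (f : Ω ⟶ Γ) :
    I.map A f ≫ I.t A = I.t (𝒟.sub A f) ≫ 𝒟.q A f :=
  congrArg Cell.tgt (I.αc_reind A f).symm

theorem exists_contr (A : 𝒟.Ty Γ) :
    ∃ c : Cell (I.Id A).tot (I.Id A).tot, c.src = 𝟙 _ ∧ c.tgt = I.t A ≫ I.r A ∧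
      c.wr (I.s A) = I.αc A ∧ c.wr (I.t A) = Cell.one (I.t A) := by
  have := I.exists_contraction (x := 𝟙 (I.Id A).tot) (y := I.t A ≫ I.r A)
    (by rw [← Cell.wl_wl, wl_r, Cell.wl_one, Category.id_comp, Category.comp_id])
  simpa only [Cell.wl_id, Category.id_comp] using this

/-- The contraction of the arrow object onto the identity arrows: the 2-cell from an arrow to the
identity of its target whose components are the arrow itself and an identity. -/
def contr (A : 𝒟.Ty Γ) : Cell (I.Id A).tot (I.Id A).tot := (I.exists_contr A).choose

theorem contr_src (A : 𝒟.Ty Γ) : (I.contr A).src = 𝟙 _ := (I.exists_contr A).choose_spec.1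

theorem contr_tgt (A : 𝒟.Ty Γ) : (I.contr A).tgt = I.t A ≫ I.r A :=
  (I.exists_contr A).choose_spec.2.1

theorem contr_s (A : 𝒟.Ty Γ) : (I.contr A).wr (I.s A) = I.αc A :=
  (I.exists_contr A).choose_spec.2.2.1

theorem contr_t (A : 𝒟.Ty Γ) : (I.contr A).wr (I.t A) = Cell.one (I.t A) :=
  (I.exists_contr A).choose_spec.2.2.2

theorem contr_isOne (A : 𝒟.Ty Γ) : ((I.contr A).wr (I.s A ≫ A.proj)).IsOne := by
  rw [← Cell.wr_wr, contr_s]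
  exact I.αc_isOne A

theorem wl_r_contr (A : 𝒟.Ty Γ) : (I.contr A).wl (I.r A) = Cell.one (I.r A) := by
  refine I.cell_ext ?_ ?_ ?_ ?_ ?_
  · rw [Cell.wl_src, contr_src, Category.comp_id, Cell.one_src]
  · rw [Cell.wl_tgt, contr_tgt, ← Category.assoc, r_t, Category.id_comp, Cell.one_tgt]
  · rw [Cell.wr_wl, contr_s, wl_r, Cell.wr_one, r_s]
  · rw [Cell.wr_wl, contr_t, Cell.wl_one, Cell.wr_one]
  · rw [Cell.wr_wl]
    exact (I.contr_isOne A).wl _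

theorem contr_map (A : 𝒟.Ty Γ) (f : Ω ⟶ Γ) :
    (I.contr (𝒟.sub A f)).wr (I.map A f) = (I.contr A).wl (I.map A f) := by
  refine I.cell_ext ?_ ?_ ?_ ?_ ?_
  · rw [Cell.wl_src, Cell.wr_src, contr_src, contr_src, Category.comp_id, Category.id_comp]
  · rw [Cell.wl_tgt, Cell.wr_tgt, contr_tgt, contr_tgt, Category.assoc, r_map,
      ← Category.assoc, ← map_t, Category.assoc]
  · rw [Cell.wr_wr, map_s, ← Cell.wr_wr, contr_s, Cell.wr_wl, contr_s, αc_reind]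
  · rw [Cell.wr_wr, map_t, ← Cell.wr_wr, contr_t, Cell.wr_wl, contr_t, Cell.wl_one,
      Cell.wr_one, map_t]
  · rw [Cell.wr_wr, ← Category.assoc, map_s, Category.assoc, (𝒟.isPullback A f).w,
      ← Category.assoc, ← Cell.wr_wr]
    exact (I.contr_isOne _).wr f

theorem arr_proj {W : 𝒞} {C : 𝒟.Ty W} {r : X ⟶ W} (c : Sec (𝒟.sub C r)) :
    (c.hom ≫ 𝒟.q C r) ≫ C.proj = r := by
  rw [Category.assoc, (𝒟.isPullback C r).w, ← Category.assoc, c.hom_proj, Category.id_comp]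

theorem contr_tgt_eq {A : 𝒟.Ty Γ} {C : 𝒟.Ty (I.Id A).tot} (x : A.tot ⟶ C.tot)
    (hx : x ≫ C.proj = I.r A) : (I.contr A).tgt = (I.t A ≫ x) ≫ C.proj := by
  rw [Category.assoc, hx, contr_tgt]

/-- Elimination: the source of the lift of the contraction. -/
def elim {A : 𝒟.Ty Γ} {C : 𝒟.Ty (I.Id A).tot} (x : A.tot ⟶ C.tot)
    (hx : x ≫ C.proj = I.r A) : Sec C where
  hom := (liftCell 𝒟 C (I.t A ≫ x) (I.contr A) (I.contr_tgt_eq x hx)).src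
  hom_proj := by rw [liftCell_src_proj, contr_src]

theorem r_elim (hn : 𝒟.Normal) {A : 𝒟.Ty Γ} {C : 𝒟.Ty (I.Id A).tot} (x : A.tot ⟶ C.tot)
    (hx : x ≫ C.proj = I.r A) : I.r A ≫ (I.elim x hx).hom = x := by
  have e : I.r A ≫ I.t A ≫ x = x := by rw [← Category.assoc, r_t, Category.id_comp]
  refine (congrArg Cell.src (wl_liftCell C (I.t A ≫ x) (I.contr A) (I.contr_tgt_eq x hx)
    (I.r A))).trans ?_
  rw [liftCell_congr C e (c' := Cell.one (x ≫ C.proj)) (by rw [wl_r_contr, hx]), liftCell_one hn,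
    Cell.one_src]

theorem elim_map {A : 𝒟.Ty Γ} {C : 𝒟.Ty (I.Id A).tot} (x : A.tot ⟶ C.tot)
    (hx : x ≫ C.proj = I.r A) (f : Ω ⟶ Γ) {C' : 𝒟.Ty (I.Id (𝒟.sub A f)).tot} {n : C'.tot ⟶ C.tot}
    (hC : Reind C (I.map A f) C' n) (x' : (𝒟.sub A f).tot ⟶ C'.tot)
    (hx' : x' ≫ C'.proj = I.r (𝒟.sub A f)) (e : x' ≫ n = 𝒟.q A f ≫ x) :
    (I.elim x' hx').hom ≫ n = I.map A f ≫ (I.elim x hx).hom := by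
  refine congrArg Cell.src (liftCell_reind₃ (A := A) (f := f) .mk (reind_wkMap A f)
    (I.reind_map A f) hC (I.map A f) (I.t A ≫ x) (I.contr A) (I.contr_tgt_eq x hx)
    (I.t _ ≫ x') (I.contr _) (I.contr_tgt_eq x' hx') ?_ (I.contr_isOne A) (I.contr_isOne _)
    (I.contr_map A f))
  rw [Category.assoc, e, ← Category.assoc, ← map_t, Category.assoc]

/-- Intensional identity types from arrow objects, when the display maps are normal. -/
def idRules (hn : 𝒟.Normal) : IdRules I.toIdForm where
  toIdIntro := I.idIntro
  j C c := I.elim (c.hom ≫ 𝒟.q C _) ((arr_proj c).trans (I.idIntro_r _))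
  comp C c := by
    refine Reind.sec_ext .mk ?_
    rw [subSec_q]
    exact (congrArg (· ≫ _) (I.idIntro_r _)).trans (I.r_elim hn _ _)
  j_sub {Γ Ω A} C c f := by
    have e : I.idIntro.r (𝒟.sub A f) ≫ I.map A f = 𝒟.q A f ≫ I.idIntro.r A := by
      rw [idIntro_r, idIntro_r, r_map]
    obtain ⟨c₁, h₁, h₂⟩ := exists_subSec_square C e c
    refine ⟨c₁, h₁, Reind.sec_ext .mk ?_⟩
    rw [subSec_q]
    exact (I.elim_map _ _ f .mk _ _ (by rw [Category.assoc, h₂])).symm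

end AxiomaticId

end IdentityRules

/-! ### Vertical composition of 2-cells with boundary -/

noncomputable section Composition

namespace Cell

variable {𝒞 : Type u} [Bicategory.{w, v} 𝒞] {W X Y Z : 𝒞}

/-- Vertical composition of 2-cells with boundary. -/
def comp (c d : Cell X Y) (h : c.tgt = d.src) : Cell X Y := mk (c.hom ≫ eqToHom h ≫ d.hom)

theorem comp_congr {c c' d d' : Cell X Y} (hc : c = c') (hd : d = d') (h : c.tgt = d.src) :
    comp c d h = comp c' d' (by rw [← hc, ← hd, h]) := by
  subst hc; subst hd; rfl

theorem wl_comp (k : W ⟶ X) (c d : Cell X Y) (h : c.tgt = d.src) :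
    wl k (comp c d h) = comp (wl k c) (wl k d) (congrArg (k ≫ ·) h) := by
  obtain ⟨η⟩ := c
  obtain ⟨θ⟩ := d
  dsimp at h
  subst h
  simp [wl, comp]

theorem wr_comp (c d : Cell X Y) (h : c.tgt = d.src) (q : Y ⟶ Z) :
    wr (comp c d h) q = comp (wr c q) (wr d q) (congrArg (· ≫ q) h) := by
  obtain ⟨η⟩ := c
  obtain ⟨θ⟩ := d
  dsimp at h
  subst h
  simp [wr, comp]

theorem IsOne.comp {c d : Cell X Y} (hc : c.IsOne) (hd : d.IsOne) (h : c.tgt = d.src) :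
    (comp c d h).IsOne := by
  obtain ⟨f, rfl⟩ := hc
  obtain ⟨g, rfl⟩ := hd
  obtain rfl : f = g := h
  exact ⟨f, by simp [Cell.comp, one]⟩

variable [IsLocallyGroupoid 𝒞]

/-- The inverse of a 2-cell with boundary. -/
def inv (c : Cell X Y) : Cell X Y := mk (CategoryTheory.inv c.hom)

theorem comp_inv {c d : Cell X Y} (e : d = inv c) :
    comp c d (congrArg Cell.src e).symm = one c.src := by
  subst e
  simp [comp, inv, one]

theorem wl_inv (k : W ⟶ X) (c : Cell X Y) : wl k (inv c) = inv (wl k c) := by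
  simp [wl, inv]

theorem wr_inv (c : Cell X Y) (q : Y ⟶ Z) : wr (inv c) q = inv (wr c q) := by
  simp [wr, inv]

theorem IsOne.inv {c : Cell X Y} (h : c.IsOne) : (inv c).IsOne := by
  obtain ⟨f, rfl⟩ := h
  exact ⟨f, by simp [Cell.inv, one]⟩

end Cell

end Composition

section Slices

variable {𝒞 : Type u} [Bicategory.{w, v} 𝒞] [Bicategory.Strict 𝒞]
  {X E Γ X' E' Γ' : 𝒞} {P : E ⟶ Γ} {f : X ⟶ Γ} {P' : E' ⟶ Γ'} {f' : X' ⟶ Γ'}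
  {k : X' ⟶ X} {q : E' ⟶ E}

theorem rel_id {a : SliceHom P f} {a' : SliceHom P' f'} (h : a'.hom ≫ q = k ≫ a.hom) :
    SliceHom.rel P f P' f' k q (𝟙 a) (𝟙 a') := by
  change Cell.wr (Cell.one a'.hom) q = Cell.wl k (Cell.one a.hom)
  rw [Cell.wr_one, Cell.wl_one, h]

theorem hom_eq_of_rel {a b : SliceHom P f} {a' b' : SliceHom P' f'} {θ : a ⟶ b} {θ' : a' ⟶ b'}
    (h : SliceHom.rel P f P' f' k q θ θ') : a'.hom ≫ q = k ≫ a.hom :=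
  src_eq_of_cell h

end Slices

/-! ### Dependent sums -/

noncomputable section SigmaTypes

variable {𝒞 : Type u} [Bicategory.{w, v} 𝒞] [Bicategory.Strict 𝒞] [IsLocallyGroupoid 𝒞]
  {𝒟 : DisplayMap2Category 𝒞} {Γ Ω X Y : 𝒞}

namespace AxiomaticSigma

variable (S : AxiomaticSigma 𝒟)

/-- Introduction for dependent sums, by the 1-cell `p`. -/
def sigmaIntro : SigmaIntro S.toSigmaForm where
  pair A B := 𝒟.secOf (S.Sig A B) (B.proj ≫ A.proj) (S.p A B) (S.p_proj A B)
  pair_sub A B f := by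
    refine Reind.same (Reind.comp .mk .mk) (Reind.comp (S.reind_map A B f) .mk) ?_
    rw [← Category.assoc, subSec_q, Category.assoc, secOf_q, ← Category.assoc, secOf_q, S.p_sub]

theorem sigmaIntro_p (A : 𝒟.Ty Γ) (B : 𝒟.Ty A.tot) : S.sigmaIntro.p A B = S.p A B :=
  secOf_q _ _ _ (S.p_proj A B)

/-- The 2-cell `η` with its boundary. -/
abbrev ηc (A : 𝒟.Ty Γ) (B : 𝒟.Ty A.tot) : Cell (S.Sig A B).tot (S.Sig A B).tot :=
  Cell.mk (S.η A B)

variable {S}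

theorem p_π (hβ : ∀ {Γ : 𝒞} (A : 𝒟.Ty Γ) (B : 𝒟.Ty A.tot), IsIdentity (S.β A B))
    (A : 𝒟.Ty Γ) (B : 𝒟.Ty A.tot) : S.p A B ≫ S.π A B = 𝟙 _ := (hβ A B).1

variable (hβ : ∀ {Γ : 𝒞} (A : 𝒟.Ty Γ) (B : 𝒟.Ty A.tot), IsIdentity (S.β A B))

/-- The unit `η`, corrected so as to become an identity after pre-composition with `p`: the
composite of `η` with the inverse of `η * (p π)`. -/
def unit (A : 𝒟.Ty Γ) (B : 𝒟.Ty A.tot) : Cell (S.Sig A B).tot (S.Sig A B).tot :=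
  Cell.comp (S.ηc A B) (Cell.inv (Cell.wl (S.π A B ≫ S.p A B) (S.ηc A B))) (by
    change S.π A B ≫ S.p A B = (S.π A B ≫ S.p A B) ≫ S.π A B ≫ S.p A B
    rw [Category.assoc, ← Category.assoc (S.p A B), p_π hβ, Category.id_comp])

theorem unit_src (A : 𝒟.Ty Γ) (B : 𝒟.Ty A.tot) : (unit hβ A B).src = 𝟙 _ := rfl

theorem unit_tgt (A : 𝒟.Ty Γ) (B : 𝒟.Ty A.tot) : (unit hβ A B).tgt = S.π A B ≫ S.p A B :=
  Category.comp_id _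

theorem unit_isOne (A : 𝒟.Ty Γ) (B : 𝒟.Ty A.tot) :
    ((unit hβ A B).wr (S.Sig A B).proj).IsOne := by
  have h : ((S.ηc A B).wr (S.Sig A B).proj).IsOne := Cell.isIdentity_iff.1 (S.η_proj A B)
  rw [unit, Cell.wr_comp]
  refine h.comp ?_ _
  rw [Cell.wr_inv, Cell.wr_wl]
  exact (h.wl _).inv

theorem wl_p_unit (A : 𝒟.Ty Γ) (B : 𝒟.Ty A.tot) :
    (unit hβ A B).wl (S.p A B) = Cell.one (S.p A B) := by
  rw [unit, Cell.wl_comp, Cell.comp_inv]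
  · exact congrArg Cell.one (Category.comp_id _)
  · rw [Cell.wl_inv, Cell.wl_wl, ← Category.assoc, p_π hβ, Category.id_comp]

theorem unit_map (A : 𝒟.Ty Γ) (B : 𝒟.Ty A.tot) (f : Ω ⟶ Γ) :
    (unit hβ (𝒟.sub A f) (𝒟.sub B (𝒟.q A f))).wr (S.map A B f) =
      (unit hβ A B).wl (S.map A B f) := by
  have h : (S.ηc (𝒟.sub A f) (𝒟.sub B (𝒟.q A f))).wr (S.map A B f) =
    (S.ηc A B).wl (S.map A B f) := S.η_sub A B f
  rw [unit, unit, Cell.wr_comp, Cell.wl_comp]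
  refine Cell.comp_congr h ?_ _
  rw [Cell.wr_inv, Cell.wl_inv, Cell.wr_wl, h, Cell.wl_wl, Cell.wl_wl, Category.assoc, S.p_sub,
    ← Category.assoc, S.π_sub, Category.assoc]

theorem unit_tgt_eq {A : 𝒟.Ty Γ} {B : 𝒟.Ty A.tot} {C : 𝒟.Ty (S.Sig A B).tot}
    (x : B.tot ⟶ C.tot) (hx : x ≫ C.proj = S.p A B) :
    (unit hβ A B).tgt = (S.π A B ≫ x) ≫ C.proj := by
  rw [Category.assoc, hx, unit_tgt]

/-- Elimination: the source of the lift of the corrected unit. -/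
def elim {A : 𝒟.Ty Γ} {B : 𝒟.Ty A.tot} {C : 𝒟.Ty (S.Sig A B).tot} (x : B.tot ⟶ C.tot)
    (hx : x ≫ C.proj = S.p A B) : Sec C where
  hom := (liftCell 𝒟 C (S.π A B ≫ x) (unit hβ A B) (unit_tgt_eq hβ x hx)).src
  hom_proj := by rw [liftCell_src_proj, unit_src]

theorem p_elim (hn : 𝒟.Normal) {A : 𝒟.Ty Γ} {B : 𝒟.Ty A.tot} {C : 𝒟.Ty (S.Sig A B).tot}
    (x : B.tot ⟶ C.tot) (hx : x ≫ C.proj = S.p A B) :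
    S.p A B ≫ (elim hβ x hx).hom = x := by
  have e : S.p A B ≫ S.π A B ≫ x = x := by rw [← Category.assoc, p_π hβ, Category.id_comp]
  refine (congrArg Cell.src (wl_liftCell C (S.π A B ≫ x) (unit hβ A B) (unit_tgt_eq hβ x hx)
    (S.p A B))).trans ?_
  rw [liftCell_congr C e (c' := Cell.one (x ≫ C.proj)) (by rw [wl_p_unit, hx]), liftCell_one hn,
    Cell.one_src]

theorem elim_map {A : 𝒟.Ty Γ} {B : 𝒟.Ty A.tot} {C : 𝒟.Ty (S.Sig A B).tot} (x : B.tot ⟶ C.tot)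
    (hx : x ≫ C.proj = S.p A B) (f : Ω ⟶ Γ)
    {C' : 𝒟.Ty (S.Sig (𝒟.sub A f) (𝒟.sub B (𝒟.q A f))).tot} {n : C'.tot ⟶ C.tot}
    (hC : Reind C (S.map A B f) C' n) (x' : (𝒟.sub B (𝒟.q A f)).tot ⟶ C'.tot)
    (hx' : x' ≫ C'.proj = S.p (𝒟.sub A f) (𝒟.sub B (𝒟.q A f)))
    (e : x' ≫ n = 𝒟.q B (𝒟.q A f) ≫ x) :
    (elim hβ x' hx').hom ≫ n = S.map A B f ≫ (elim hβ x hx).hom := by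
  refine congrArg Cell.src (liftCell_reind (S.reind_map A B f) hC (S.map A B f) (S.π A B ≫ x)
    (unit hβ A B) (unit_tgt_eq hβ x hx) (S.π _ _ ≫ x') (unit hβ _ _) (unit_tgt_eq hβ x' hx') ?_
    (unit_isOne hβ A B) (unit_isOne hβ _ _) (unit_map hβ A B f))
  rw [Category.assoc, e, ← Category.assoc, S.π_sub, Category.assoc]

/-- Intensional dependent sums, when the display maps are normal and `β` is an identity. -/
def sigmaRules (hn : 𝒟.Normal) : SigmaRules S.toSigmaForm where
  toSigmaIntro := S.sigmaIntro
  split C c := elim hβ (c.hom ≫ 𝒟.q C _) ((AxiomaticId.arr_proj c).trans (S.sigmaIntro_p _ _))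
  comp C c := by
    refine Reind.sec_ext .mk ?_
    rw [subSec_q]
    exact (congrArg (· ≫ _) (S.sigmaIntro_p _ _)).trans (p_elim hβ hn _ _)
  split_sub {Γ Ω A B} C c f := by
    have e : S.sigmaIntro.p (𝒟.sub A f) (𝒟.sub B (𝒟.q A f)) ≫ S.map A B f =
        𝒟.q B (𝒟.q A f) ≫ S.sigmaIntro.p A B := by
      rw [sigmaIntro_p, sigmaIntro_p, S.p_sub]
    obtain ⟨c₁, h₁, h₂⟩ := exists_subSec_square C e c
    refine ⟨c₁, h₁, Reind.sec_ext .mk ?_⟩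
    rw [subSec_q]
    exact (elim_map hβ _ _ f .mk _ _ (by rw [Category.assoc, h₂])).symm

end AxiomaticSigma

end SigmaTypes

/-! ### The types `0`, `1`, `2` and `ℕ` -/

noncomputable section Constants

variable {𝒞 : Type u} [Bicategory.{w, v} 𝒞] [Bicategory.Strict 𝒞] [IsLocallyGroupoid 𝒞]
  {𝒟 : DisplayMap2Category 𝒞} {Γ Ω X Y : 𝒞}

/-- The 1-cell over `r` corresponding to a term of `C[r]`. -/
abbrev Sec.arr {C : 𝒟.Ty Γ} {r : X ⟶ Γ} (c : Sec (𝒟.sub C r)) : SliceHom C.proj r :=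
  ⟨c.hom ≫ 𝒟.q C r, AxiomaticId.arr_proj c⟩

/-- The section underlying an object of the category of sections. -/
abbrev SliceHom.toSec {C : 𝒟.Ty Γ} (a : Sections 𝒟 C) : Sec C := ⟨a.hom, a.w⟩

/-- The empty type. -/
def AxiomaticZero.zeroRules (Z : AxiomaticZero 𝒟) : ZeroRules Z.toZeroForm where
  ind C := ((Z.ind C).inv.obj ⟨⟨⟩⟩).toSec
  ind_sub C f := by
    refine Reind.sec_ext .mk ?_
    rw [subSec_q]
    exact (hom_eq_of_rel ((Z.ind_sub C f).inv (𝟙 ⟨⟨⟩⟩) (𝟙 ⟨⟨⟩⟩) trivial)).symm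

/-- The intensional unit type, when `β` is an identity. -/
def AxiomaticOne.oneRules (O : AxiomaticOne 𝒟)
    (hβ : ∀ {Γ : 𝒞} (C : 𝒟.Ty (O.ty Γ).tot) (c : SliceHom C.proj (O.star Γ).hom),
      IsIdentity ((O.ind C).β.hom.app c).1) : OneRules O.toOneForm where
  ind C c := ((O.ind C).inv.obj c.arr).toSec
  comp C c := by
    refine Reind.sec_ext .mk ?_
    rw [subSec_q]
    exact (hβ C c.arr).1
  ind_sub {Γ Ω} C c f := by
    have e : (O.star Ω).hom ≫ O.map f = f ≫ (O.star Γ).hom :=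
      Reind.hom_of_same (O.reind_map f) (O.star_sub f).symm
    obtain ⟨c₁, h₁, h₂⟩ := exists_subSec_square C e c
    refine ⟨c₁, h₁, Reind.sec_ext .mk ?_⟩
    rw [subSec_q]
    refine (hom_eq_of_rel ((O.ind_sub C f).inv (𝟙 c.arr) (𝟙 c₁.arr) (rel_id ?_))).symm
    rw [Category.assoc, h₂]

/-- The intensional type `2`, when the two components of `β` are identities. -/
def AxiomaticTwo.twoRules (T : AxiomaticTwo 𝒟)
    (hβ : ∀ {Γ : 𝒞} (C : 𝒟.Ty (T.ty Γ).tot) (c : SliceHom C.proj (T.bot Γ).hom)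
      (d : SliceHom C.proj (T.top Γ).hom),
      IsIdentity ((T.ind C).β.hom.app (c, d)).1.1 ∧
        IsIdentity ((T.ind C).β.hom.app (c, d)).2.1) : TwoRules T.toTwoForm where
  ind C c d := ((T.ind C).inv.obj (c.arr, d.arr)).toSec
  comp_bot C c d := by
    refine Reind.sec_ext .mk ?_
    rw [subSec_q]
    exact (hβ C c.arr d.arr).1.1
  comp_top C c d := by
    refine Reind.sec_ext .mk ?_
    rw [subSec_q]
    exact (hβ C c.arr d.arr).2.1
  ind_sub {Γ Ω} C c d f := by
    have e : (T.bot Ω).hom ≫ T.map f = f ≫ (T.bot Γ).hom :=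
      Reind.hom_of_same (T.reind_map f) (T.bot_sub f).symm
    have e' : (T.top Ω).hom ≫ T.map f = f ≫ (T.top Γ).hom :=
      Reind.hom_of_same (T.reind_map f) (T.top_sub f).symm
    obtain ⟨c₁, h₁, h₂⟩ := exists_subSec_square C e c
    obtain ⟨d₁, h₁', h₂'⟩ := exists_subSec_square C e' d
    refine ⟨c₁, d₁, h₁, h₁', Reind.sec_ext .mk ?_⟩
    rw [subSec_q]
    refine (hom_eq_of_rel ((T.ind_sub C f).inv (𝟙 (c.arr, d.arr)) (𝟙 (c₁.arr, d₁.arr))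
      ⟨rel_id ?_, rel_id ?_⟩)).symm
    · rw [Category.assoc, h₂]
    · rw [Category.assoc, h₂']

/-- The intensional type of natural numbers, when the 2-cells `β` are identities. -/
def AxiomaticNat.natRules (N : AxiomaticNat 𝒟)
    (hβ : ∀ {Γ : 𝒞} (C : 𝒟.Ty (N.ty Γ).tot) (c : SliceHom C.proj (N.zero Γ).hom)
      (d : SliceHom C.proj (C.proj ≫ N.s Γ)),
      IsIdentity (N.βzero c d) ∧ IsIdentity (N.βsucc c d)) : NatRules N.toNatForm where
  ind C c d := (N.ind c.arr d.arr).toSec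
  comp_zero C c d := by
    refine Reind.sec_ext .mk ?_
    rw [subSec_q]
    exact (hβ C c.arr d.arr).1.1
  comp_succ C c d := by
    refine Reind.same .mk (Reind.comp .mk .mk) ?_
    rw [subSec_q, ← Category.assoc (𝒟.subSec d _).hom, subSec_q, Category.assoc]
    exact (hβ C c.arr d.arr).2.1
  ind_sub {Γ Ω} C c d f := by
    have e : (N.zero Ω).hom ≫ N.map f = f ≫ (N.zero Γ).hom :=
      Reind.hom_of_same (N.reind_map f) (N.zero_sub f).symm
    have e' : ((𝒟.sub C (N.map f)).proj ≫ N.s Ω) ≫ N.map f =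
        𝒟.q C (N.map f) ≫ C.proj ≫ N.s Γ := by
      rw [Category.assoc, N.s_sub, ← Category.assoc, ← (𝒟.isPullback C (N.map f)).w,
        Category.assoc]
    obtain ⟨c₁, h₁, h₂⟩ := exists_subSec_square C e c
    obtain ⟨d₁, h₁', h₂'⟩ := exists_subSec_square C e' d
    refine ⟨c₁, d₁, h₁, h₁', Reind.sec_ext .mk ?_⟩
    rw [subSec_q]
    refine (N.ind_sub f c.arr d.arr c₁.arr d₁.arr ?_ ?_).1.symm
    · rw [Category.assoc, h₂]
    · rw [Category.assoc, h₂']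

end Constants

/-! ### Evaluation and abstraction for dependent products -/

noncomputable section PiTypes

/-- A functor with a pseudo-inverse is fully faithful. -/
def PseudoInverse.fullyFaithful {𝒜 ℬ : Type*} [Category 𝒜] [Category ℬ] {F : 𝒜 ⥤ ℬ}
    (G : PseudoInverse F) : F.FullyFaithful :=
  (CategoryTheory.Equivalence.mk F G.inv G.η G.β).fullyFaithfulFunctor

variable {𝒞 : Type u} [Bicategory.{w, v} 𝒞] [Bicategory.Strict 𝒞] [IsLocallyGroupoid 𝒞]
  {𝒟 : DisplayMap2Category 𝒞} {Γ Ω X Y : 𝒞}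

theorem q_id_inv (A : 𝒟.Ty Γ) : ∃ i : A.tot ⟶ (𝒟.sub A (𝟙 Γ)).tot,
    i ≫ 𝒟.q A (𝟙 Γ) = 𝟙 _ ∧ 𝒟.q A (𝟙 Γ) ≫ i = 𝟙 _ := by
  rw [𝒟.q_id]
  exact ⟨eqToHom (congrArg Disp.tot (𝒟.sub_id A)).symm, by simp, by simp⟩

theorem q_id_cancel {A : 𝒟.Ty Γ} {x y : A.tot ⟶ X} (h : 𝒟.q A (𝟙 Γ) ≫ x = 𝒟.q A (𝟙 Γ) ≫ y) :
    x = y := by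
  obtain ⟨i, hi, -⟩ := q_id_inv A
  have := congrArg (i ≫ ·) h
  simpa only [← Category.assoc, hi, Category.id_comp] using this

theorem q_id_proj (A : 𝒟.Ty Γ) : 𝒟.q A (𝟙 Γ) ≫ A.proj = (𝒟.sub A (𝟙 Γ)).proj := by
  rw [(𝒟.isPullback A (𝟙 Γ)).w, Category.comp_id]

namespace AxiomaticPi

variable (P : AxiomaticPi 𝒟)

section

variable (A : 𝒟.Ty Γ) (B : 𝒟.Ty A.tot)

/-- The universal evaluation `Γ.Π.A[P_Π] ⟶ Γ.A.B`. -/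
def ev₀ : (𝒟.sub A (P.Pi A B).proj).tot ⟶ B.tot :=
  ((P.app A B (P.Pi A B).proj).obj ⟨𝟙 _, Category.id_comp _⟩).hom

theorem ev₀_proj : P.ev₀ A B ≫ B.proj = 𝒟.q A (P.Pi A B).proj :=
  ((P.app A B (P.Pi A B).proj).obj ⟨𝟙 _, Category.id_comp _⟩).w

end

section

variable {A : 𝒟.Ty Γ} {B : 𝒟.Ty A.tot}

/-- The application of a generalized element `y` of `Π_A^B` to a generalized element `x` of `A`. -/
def eval (x : Y ⟶ A.tot) (y : Y ⟶ (P.Pi A B).tot) (h : x ≫ A.proj = y ≫ (P.Pi A B).proj) :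
    Y ⟶ B.tot :=
  (𝒟.isPullback A (P.Pi A B).proj).lift x y h ≫ P.ev₀ A B

theorem eval_proj (x : Y ⟶ A.tot) (y : Y ⟶ (P.Pi A B).tot)
    (h : x ≫ A.proj = y ≫ (P.Pi A B).proj) : P.eval x y h ≫ B.proj = x := by
  rw [eval, Category.assoc, ev₀_proj]
  exact (𝒟.isPullback A (P.Pi A B).proj).lift_fst _ _ _

theorem comp_eval (k : X ⟶ Y) (x : Y ⟶ A.tot) (y : Y ⟶ (P.Pi A B).tot)
    (h : x ≫ A.proj = y ≫ (P.Pi A B).proj) :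
    k ≫ P.eval x y h = P.eval (k ≫ x) (k ≫ y) (by rw [Category.assoc, h, Category.assoc]) := by
  rw [eval, eval, ← Category.assoc]
  congr 1
  refine (𝒟.isPullback A (P.Pi A B).proj).hom_ext ?_ ?_
  · rw [Category.assoc]
    exact (congrArg (k ≫ ·) ((𝒟.isPullback A _).lift_fst x y h)).trans
      ((𝒟.isPullback A _).lift_fst _ _ _).symm
  · rw [Category.assoc]
    exact (congrArg (k ≫ ·) ((𝒟.isPullback A _).lift_snd x y h)).trans
      ((𝒟.isPullback A _).lift_snd _ _ _).symm

theorem eval_congr {x x' : Y ⟶ A.tot} {y y' : Y ⟶ (P.Pi A B).tot} (hx : x = x') (hy : y = y')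
    (h : x ≫ A.proj = y ≫ (P.Pi A B).proj) :
    P.eval x y h = P.eval x' y' (by rw [← hx, ← hy, h]) := by
  subst hx; subst hy; rfl

theorem ev₀_eq : P.ev₀ A B =
    P.eval (𝒟.q A (P.Pi A B).proj) (𝒟.sub A (P.Pi A B).proj).proj (𝒟.isPullback A _).w := by
  rw [eval]
  have : (𝒟.isPullback A (P.Pi A B).proj).lift (𝒟.q A (P.Pi A B).proj)
      (𝒟.sub A (P.Pi A B).proj).proj (𝒟.isPullback A _).w = 𝟙 _ :=
    (𝒟.isPullback A (P.Pi A B).proj).hom_ext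
      (((𝒟.isPullback A _).lift_fst _ _ _).trans (Category.id_comp _).symm)
      (((𝒟.isPullback A _).lift_snd _ _ _).trans (Category.id_comp _).symm)
  rw [this, Category.id_comp]

theorem sub_map_eq {f : X ⟶ Γ} {g : Y ⟶ X} {L : (𝒟.sub A (g ≫ f)).tot ⟶ (𝒟.sub A f).tot}
    (h : L ≫ 𝒟.q A f = 𝒟.q A (g ≫ f)) (h' : L ≫ (𝒟.sub A f).proj = (𝒟.sub A (g ≫ f)).proj ≫ g) :
    castHom (𝒟.sub_comp A f g) ≫ 𝒟.q (𝒟.sub A f) g = L := by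
  refine (𝒟.isPullback A f).hom_ext ?_ ?_
  · rw [h, 𝒟.q_comp, Category.assoc]
    rfl
  · rw [h', (Reind.sub_comp_right A f g).w]

/-- The functors `app` evaluate a generalized element at the generic element of `A`. -/
theorem app_obj_hom {f : X ⟶ Γ} (a : SliceHom (P.Pi A B).proj f) :
    ((P.app A B f).obj a).hom = P.eval (𝒟.q A f) ((𝒟.sub A f).proj ≫ a.hom)
      (by rw [Category.assoc, a.w, (𝒟.isPullback A f).w]) := by
  obtain ⟨y, rfl⟩ := a
  have h := hom_eq_of_rel ((P.natural A B (P.Pi A B).proj y).map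
    (𝟙 ⟨𝟙 _, Category.id_comp _⟩) (𝟙 ⟨y, rfl⟩) (rel_id rfl))
  rw [Category.comp_id] at h
  rw [h, eval, ev₀]
  congr 1
  exact sub_map_eq ((𝒟.isPullback A _).lift_fst _ _ _) ((𝒟.isPullback A _).lift_snd _ _ _)

/-- Evaluation at sections is stable under re-indexing. -/
theorem eval_sec_reind {k : X ⟶ Γ} {A₁ : 𝒟.Ty X} {a : A₁.tot ⟶ A.tot} (hA : Reind A k A₁ a)
    {B₁ : 𝒟.Ty A₁.tot} {b : B₁.tot ⟶ B.tot} (hB : Reind B a B₁ b)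
    {n : (P.Pi A₁ B₁).tot ⟶ (P.Pi A B).tot} (hP : Reind (P.Pi A B) k (P.Pi A₁ B₁) n)
    (u : Sec (P.Pi A₁ B₁))
    (h₁ : 𝟙 _ ≫ A₁.proj = (A₁.proj ≫ u.hom) ≫ (P.Pi A₁ B₁).proj)
    (h₂ : a ≫ A.proj = (A₁.proj ≫ u.hom ≫ n) ≫ (P.Pi A B).proj) :
    P.eval (𝟙 A₁.tot) (A₁.proj ≫ u.hom) h₁ ≫ b = P.eval a (A₁.proj ≫ u.hom ≫ n) h₂ := by
  cases hA; cases hB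
  obtain rfl := hP.hom_unique (P.reind_map A B k)
  have hw : (u.hom ≫ P.map A B k) ≫ (P.Pi A B).proj = k := by
    rw [Category.assoc, hP.w, ← Category.assoc, u.hom_proj, Category.id_comp]
  have h := hom_eq_of_rel ((P.stable A B k).map (𝟙 ⟨u.hom ≫ P.map A B k, hw⟩)
    (𝟙 ⟨u.hom, u.hom_proj⟩) (rel_id (Category.id_comp _).symm))
  rw [app_obj_hom, app_obj_hom] at h
  refine q_id_cancel (Eq.trans ?_ h)
  rw [← Category.assoc, comp_eval]
  congr 1
  refine P.eval_congr (Category.comp_id _) ?_ _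
  rw [← Category.assoc, q_id_proj]

/-- Evaluation is stable under re-indexing: the case of arbitrary generalized elements reduces to
that of sections by re-indexing to their domain. -/
theorem eval_reind {f : Ω ⟶ Γ} {A' : 𝒟.Ty Ω} {a : A'.tot ⟶ A.tot} (hA : Reind A f A' a)
    {B' : 𝒟.Ty A'.tot} {b : B'.tot ⟶ B.tot} (hB : Reind B a B' b)
    {n : (P.Pi A' B').tot ⟶ (P.Pi A B).tot} (hP : Reind (P.Pi A B) f (P.Pi A' B') n)
    (x : Y ⟶ A'.tot) (y : Y ⟶ (P.Pi A' B').tot)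
    (h : x ≫ A'.proj = y ≫ (P.Pi A' B').proj) :
    P.eval x y h ≫ b = P.eval (x ≫ a) (y ≫ n)
      (by rw [Category.assoc, Category.assoc, hA.w, hP.w, ← Category.assoc, h,
        Category.assoc]) := by
  let k := y ≫ (P.Pi A' B').proj
  let u : Sec (P.Pi (𝒟.sub A' k) (𝒟.sub B' (𝒟.q A' k))) := (P.reind_map A' B' k).sec y rfl
  have hu : u.hom ≫ P.map A' B' k = y := Reind.sec_hom _ _ _
  have hA₁ : Reind A (k ≫ f) (𝒟.sub A' k) (𝒟.q A' k ≫ a) := hA.comp .mk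
  have hP₁ := hP.comp (P.reind_map A' B' k)
  let x₁ : Y ⟶ (𝒟.sub A' k).tot := (𝒟.isPullback A' k).lift x (𝟙 Y) (by simp [k, h])
  have hx₁ : x₁ ≫ 𝒟.q A' k = x := (𝒟.isPullback A' k).lift_fst _ _ _
  have hx₁' : x₁ ≫ (𝒟.sub A' k).proj = 𝟙 Y := (𝒟.isPullback A' k).lift_snd _ _ _
  have h₁ : 𝟙 _ ≫ (𝒟.sub A' k).proj = ((𝒟.sub A' k).proj ≫ u.hom) ≫ (P.Pi _ _).proj := by
    rw [Category.assoc, u.hom_proj, Category.id_comp, Category.comp_id]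
  have h₂ : 𝒟.q A' k ≫ A'.proj =
      ((𝒟.sub A' k).proj ≫ u.hom ≫ P.map A' B' k) ≫ (P.Pi A' B').proj := by
    rw [hu, (𝒟.isPullback A' k).w, Category.assoc]
  have h₃ : (𝒟.q A' k ≫ a) ≫ A.proj =
      ((𝒟.sub A' k).proj ≫ u.hom ≫ P.map A' B' k ≫ n) ≫ (P.Pi A B).proj := by
    simp only [Category.assoc, hP.w, hA.w]
    rw [← Category.assoc, h₂]
    simp only [Category.assoc]
  have e₁ := P.eval_sec_reind hA₁ (hB.comp .mk) hP₁ u h₁ h₃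
  have e₂ := P.eval_sec_reind .mk .mk (P.reind_map A' B' k) u h₁ h₂
  have e₃ : P.eval x y h = x₁ ≫ P.eval _ _ h₂ := by
    rw [comp_eval]
    refine P.eval_congr hx₁.symm ?_ _
    rw [hu, ← Category.assoc, hx₁', Category.id_comp]
  rw [e₃, ← e₂, Category.assoc, Category.assoc, e₁, comp_eval]
  refine P.eval_congr ?_ ?_ _
  · rw [← Category.assoc, hx₁]
  · rw [← Category.assoc u.hom, hu, ← Category.assoc, hx₁', Category.id_comp]

/-- Naturality of the pseudo-inverses. -/
theorem lam_natural {f : X ⟶ Γ} {k : Y ⟶ Γ} {g : Y ⟶ X} (h : g ≫ f = k)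
    (b : SliceHom B.proj (𝒟.q A f)) (b' : SliceHom B.proj (𝒟.q A k))
    {L : (𝒟.sub A k).tot ⟶ (𝒟.sub A f).tot} (h₁ : L ≫ 𝒟.q A f = 𝒟.q A k)
    (h₂ : L ≫ (𝒟.sub A f).proj = (𝒟.sub A k).proj ≫ g) (hb : b'.hom = L ≫ b.hom) :
    ((P.lam A B k).inv.obj b').hom = g ≫ ((P.lam A B f).inv.obj b).hom := by
  subst h
  refine (Category.comp_id _).symm.trans (hom_eq_of_rel ((P.natural A B f g).inv (𝟙 b) (𝟙 b')
    (rel_id ?_)))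
  rw [sub_map_eq h₁ h₂, Category.comp_id, hb]

/-- The object of `(𝒞/Γ.A)(1•, P_B)` given by a term of `B`. -/
abbrev body (v : Sec B) : SliceHom B.proj (𝒟.q A (𝟙 Γ)) :=
  ⟨𝒟.q A (𝟙 Γ) ≫ v.hom, by rw [Category.assoc, v.hom_proj, Category.comp_id]⟩

/-- Abstraction of a term. -/
def abst (v : Sec B) : Sec (P.Pi A B) := ((P.lam A B (𝟙 Γ)).inv.obj (body v)).toSec

theorem abst_reind {f : Ω ⟶ Γ} {A' : 𝒟.Ty Ω} {a : A'.tot ⟶ A.tot} (hA : Reind A f A' a)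
    {B' : 𝒟.Ty A'.tot} {b : B'.tot ⟶ B.tot} (hB : Reind B a B' b)
    {n : (P.Pi A' B').tot ⟶ (P.Pi A B).tot} (hP : Reind (P.Pi A B) f (P.Pi A' B') n)
    (v : Sec B) (v' : Sec B') (hv : v'.hom ≫ b = a ≫ v.hom) :
    (P.abst v').hom ≫ n = f ≫ (P.abst v).hom := by
  cases hA; cases hB
  obtain rfl := hP.hom_unique (P.reind_map A B f)
  let b₁ : SliceHom B.proj (𝒟.q A f) := ⟨𝒟.q A f ≫ v.hom, by
    rw [Category.assoc, v.hom_proj, Category.comp_id]⟩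
  have e₁ : ((P.lam A B f).inv.obj b₁).hom = f ≫ (P.abst v).hom := by
    have hL : 𝒟.q A f ≫ A.proj = ((𝒟.sub A f).proj ≫ f) ≫ 𝟙 Γ := by
      rw [(𝒟.isPullback A f).w, Category.comp_id]
    have hL₁ := (𝒟.isPullback A (𝟙 Γ)).lift_fst (𝒟.q A f) ((𝒟.sub A f).proj ≫ f) hL
    refine P.lam_natural (Category.comp_id f) (body v) b₁ hL₁
      ((𝒟.isPullback A (𝟙 Γ)).lift_snd _ _ hL) ?_
    rw [← Category.assoc, hL₁]
  have e₂ := hom_eq_of_rel ((P.stable A B f).inv (𝟙 b₁) (𝟙 (body v'))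
    (rel_id (by rw [Category.assoc, hv])))
  rw [Category.id_comp, e₁] at e₂
  exact e₂

theorem eval_abst (hβ : ∀ {Γ X : 𝒞} (A : 𝒟.Ty Γ) (B : 𝒟.Ty A.tot) (f : X ⟶ Γ)
      (b : SliceHom B.proj (𝒟.q A f)), IsIdentity ((P.lam A B f).β.hom.app b).1)
    (v : Sec B) (h : 𝟙 _ ≫ A.proj = (A.proj ≫ (P.abst v).hom) ≫ (P.Pi A B).proj) :
    P.eval (𝟙 A.tot) (A.proj ≫ (P.abst v).hom) h = v.hom := by
  have e := (hβ A B (𝟙 Γ) (body v)).1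
  change ((P.app A B (𝟙 Γ)).obj ((P.lam A B (𝟙 Γ)).inv.obj (body v))).hom = _ at e
  rw [app_obj_hom] at e
  refine q_id_cancel (Eq.trans ?_ e)
  rw [comp_eval]
  refine P.eval_congr (Category.comp_id _) ?_ _
  rw [← Category.assoc, q_id_proj]
  rfl

end

/-- Evaluation for dependent products. -/
def piEval : PiEval P.toPiForm where
  ev A B := 𝒟.secOf B (𝒟.q A (P.Pi A B).proj) (P.ev₀ A B) (P.ev₀_proj A B)
  ev_sub A B f := by
    refine Reind.same (Reind.comp .mk .mk)
      (Reind.comp (Reind.mk (A := B) (f := 𝒟.q A f)) .mk) ?_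
    rw [← Category.assoc, subSec_q, Category.assoc, secOf_q, ← Category.assoc, secOf_q]
    have h := P.eval_reind (.mk (A := A) (f := f)) (.mk (A := B)) (P.reind_map A B f)
      (𝒟.q (𝒟.sub A f) (P.Pi (𝒟.sub A f) (𝒟.sub B (𝒟.q A f))).proj)
      (𝒟.sub (𝒟.sub A f) (P.Pi (𝒟.sub A f) (𝒟.sub B (𝒟.q A f))).proj).proj
      (𝒟.isPullback _ _).w
    rw [← ev₀_eq] at h
    exact h.symm

theorem piEval_ev_q (A : 𝒟.Ty Γ) (B : 𝒟.Ty A.tot) :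
    (P.piEval.ev A B).hom ≫ 𝒟.q B (𝒟.q A (P.Pi A B).proj) = P.ev₀ A B :=
  secOf_q _ _ _ (P.ev₀_proj A B)

theorem secBullet_ev₀ {A : 𝒟.Ty Γ} {B : 𝒟.Ty A.tot} (z : Sec (P.Pi A B)) :
    P.secBullet z ≫ P.ev₀ A B = P.eval (𝟙 A.tot) (A.proj ≫ z.hom) (by
      rw [Category.assoc, z.hom_proj, Category.id_comp, Category.comp_id]) := rfl

/-- Intensional dependent products, when `β` is an identity. -/
def piRules (hβ : ∀ {Γ X : 𝒞} (A : 𝒟.Ty Γ) (B : 𝒟.Ty A.tot) (f : X ⟶ Γ)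
      (b : SliceHom B.proj (𝒟.q A f)), IsIdentity ((P.lam A B f).β.hom.app b).1) :
    PiRules P.toPiForm where
  toPiEval := P.piEval
  lam v := P.abst v
  comp {Γ A B} v := by
    refine Reind.same (Reind.comp .mk .mk) (Reind.id B) ?_
    rw [← Category.assoc, subSec_q, Category.assoc, piEval_ev_q, secBullet_ev₀, P.eval_abst hβ,
      Category.comp_id]
  lam_sub {Γ Ω A B} v f :=
    (P.reind_map A B f).same_subSec (P.abst_reind .mk .mk (P.reind_map A B f) v _ (subSec_q _ _))

end AxiomaticPi

end PiTypes

/-! ### The action of `app` on 2-cells, and identity terms as 2-cells -/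

section AppCells

variable {𝒞 : Type u} [Bicategory.{w, v} 𝒞] [Bicategory.Strict 𝒞] [IsLocallyGroupoid 𝒞]
  {𝒟 : DisplayMap2Category 𝒞} {Γ Ω X Y : 𝒞}

namespace AxiomaticPi

variable (P : AxiomaticPi 𝒟)

/-- `IsApp A B f c d` says that the 2-cell `d` is the image of the 2-cell `c` under the functor
`app` at `f`. -/
inductive IsApp (A : 𝒟.Ty Γ) (B : 𝒟.Ty A.tot) (f : X ⟶ Γ) :
    Cell X (P.Pi A B).tot → Cell (𝒟.sub A f).tot B.tot → Prop
  | mk {a b : SliceHom (P.Pi A B).proj f} (θ : a ⟶ b) :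
      IsApp A B f (Cell.mk θ.1) (Cell.mk ((P.app A B f).map θ).1)

variable {P} {A : 𝒟.Ty Γ} {B : 𝒟.Ty A.tot} {f : X ⟶ Γ}

theorem IsApp.exists_right {c : Cell X (P.Pi A B).tot} (hc : (c.wr (P.Pi A B).proj).IsOne)
    (hf : c.src ≫ (P.Pi A B).proj = f) : ∃ d, P.IsApp A B f c d := by
  have hf' : c.tgt ≫ (P.Pi A B).proj = f := by rw [← hf]; exact hc.src_eq_tgt.symm
  exact ⟨_, .mk (a := ⟨c.src, hf⟩) (b := ⟨c.tgt, hf'⟩) ⟨c.hom, Cell.isIdentity_iff.2 hc⟩⟩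

theorem IsApp.exists_left {a b : SliceHom (P.Pi A B).proj f} {d : Cell (𝒟.sub A f).tot B.tot}
    (hd : (d.wr B.proj).IsOne) (hs : d.src = ((P.app A B f).obj a).hom)
    (ht : d.tgt = ((P.app A B f).obj b).hom) :
    ∃ c, P.IsApp A B f c d ∧ c.src = a.hom ∧ c.tgt = b.hom ∧
      (c.wr (P.Pi A B).proj).IsOne := by
  obtain ⟨φ, rfl⟩ := d.exists_hom hs ht
  let ψ : (P.app A B f).obj a ⟶ (P.app A B f).obj b := ⟨φ, Cell.isIdentity_iff.2 hd⟩
  let θ := (P.lam A B f).fullyFaithful.preimage ψ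
  refine ⟨Cell.mk θ.1, ?_, rfl, rfl, Cell.isIdentity_iff.1 θ.2⟩
  have h : (P.app A B f).map θ = ψ := Functor.FullyFaithful.map_preimage _ _
  have := IsApp.mk (P := P) θ
  rw [h] at this
  exact this

theorem IsApp.exists_eq {c : Cell X (P.Pi A B).tot} {d : Cell (𝒟.sub A f).tot B.tot}
    (h : P.IsApp A B f c d) : ∃ (hs : c.src ≫ (P.Pi A B).proj = f)
      (ht : c.tgt ≫ (P.Pi A B).proj = f) (hi : IsIdentity (c.hom ▷ (P.Pi A B).proj)),
      d = Cell.mk ((P.app A B f).map (X := ⟨c.src, hs⟩) (Y := ⟨c.tgt, ht⟩) ⟨c.hom, hi⟩).1 := by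
  cases h with
  | @mk a b θ => exact ⟨a.w, b.w, θ.2, rfl⟩

theorem IsApp.src_eq {c : Cell X (P.Pi A B).tot} {d : Cell (𝒟.sub A f).tot B.tot}
    (h : P.IsApp A B f c d)
    (e : 𝒟.q A f ≫ A.proj = ((𝒟.sub A f).proj ≫ c.src) ≫ (P.Pi A B).proj) :
    d.src = P.eval (𝒟.q A f) ((𝒟.sub A f).proj ≫ c.src) e := by
  obtain ⟨_, _, _, rfl⟩ := h.exists_eq
  exact P.app_obj_hom _

theorem IsApp.tgt_eq {c : Cell X (P.Pi A B).tot} {d : Cell (𝒟.sub A f).tot B.tot}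
    (h : P.IsApp A B f c d)
    (e : 𝒟.q A f ≫ A.proj = ((𝒟.sub A f).proj ≫ c.tgt) ≫ (P.Pi A B).proj) :
    d.tgt = P.eval (𝒟.q A f) ((𝒟.sub A f).proj ≫ c.tgt) e := by
  obtain ⟨_, _, _, rfl⟩ := h.exists_eq
  exact P.app_obj_hom _

theorem IsApp.right_unique {c : Cell X (P.Pi A B).tot} {d d' : Cell (𝒟.sub A f).tot B.tot}
    (h : P.IsApp A B f c d) (h' : P.IsApp A B f c d') : d = d' := by
  obtain ⟨_, _, _, rfl⟩ := h.exists_eq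
  obtain ⟨_, _, _, rfl⟩ := h'.exists_eq
  rfl

theorem IsApp.left_unique {c c' : Cell X (P.Pi A B).tot} {d : Cell (𝒟.sub A f).tot B.tot}
    (h : P.IsApp A B f c d) (h' : P.IsApp A B f c' d) (hs : c.src = c'.src)
    (ht : c.tgt = c'.tgt) : c = c' := by
  obtain ⟨η⟩ := c
  obtain ⟨η'⟩ := c'
  dsimp at hs ht
  subst hs; subst ht
  obtain ⟨_, _, _, e⟩ := h.exists_eq
  obtain ⟨_, _, _, e'⟩ := h'.exists_eq
  have e₁ := (P.lam A B f).fullyFaithful.map_injective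
    (Subtype.ext (Cell.mk_injective (e.symm.trans e')))
  exact congrArg Cell.mk (congrArg Subtype.val e₁)

theorem isApp_one (y : X ⟶ (P.Pi A B).tot) (hy : y ≫ (P.Pi A B).proj = f) :
    P.IsApp A B f (Cell.one y) (Cell.one (P.eval (𝒟.q A f) ((𝒟.sub A f).proj ≫ y)
      (by rw [Category.assoc, hy, (𝒟.isPullback A f).w]))) := by
  have h := IsApp.mk (P := P) (𝟙 (⟨y, hy⟩ : SliceHom (P.Pi A B).proj f))
  rw [(P.app A B f).map_id] at h
  have e := congrArg Cell.one (P.app_obj_hom (⟨y, hy⟩ : SliceHom (P.Pi A B).proj f))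
  rw [← e]
  exact h

theorem IsApp.wl {c : Cell X (P.Pi A B).tot} {d : Cell (𝒟.sub A f).tot B.tot}
    (h : P.IsApp A B f c d) {g : Y ⟶ X} {k : Y ⟶ Γ} (hk : g ≫ f = k)
    {L : (𝒟.sub A k).tot ⟶ (𝒟.sub A f).tot} (h₁ : L ≫ 𝒟.q A f = 𝒟.q A k)
    (h₂ : L ≫ (𝒟.sub A f).proj = (𝒟.sub A k).proj ≫ g) :
    P.IsApp A B k (c.wl g) (d.wl L) := by
  subst hk
  cases h with
  | @mk a b θ =>
    let θ' := (SliceHom.pre (P.Pi A B).proj g (rfl : g ≫ f = g ≫ f)).map θ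
    have e := (P.natural A B f g).map θ θ' (Cell.wr_id (Cell.mk θ'.1))
    have e' : Cell.wl L (Cell.mk ((P.app A B f).map θ).1) =
        Cell.mk ((P.app A B (g ≫ f)).map θ').1 := by
      rw [← sub_map_eq h₁ h₂]
      exact e.symm.trans (Cell.wr_id (Cell.mk ((P.app A B (g ≫ f)).map θ').1))
    rw [e']
    exact .mk θ'

/-- `IsAppSec A B c d` says that the 2-cell `d` between sections of `P_B` is the image under `app`
of the 2-cell `c` between sections of `P_Π`. -/
def IsAppSec (P : AxiomaticPi 𝒟) (A : 𝒟.Ty Γ) (B : 𝒟.Ty A.tot) (c : Cell Γ (P.Pi A B).tot)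
    (d : Cell A.tot B.tot) : Prop :=
  P.IsApp A B (𝟙 Γ) c (d.wl (𝒟.q A (𝟙 Γ)))

theorem wl_q_id_injective {c d : Cell A.tot Y}
    (h : c.wl (𝒟.q A (𝟙 Γ)) = d.wl (𝒟.q A (𝟙 Γ))) : c = d := by
  obtain ⟨i, hi, -⟩ := q_id_inv A
  have := congrArg (Cell.wl i) h
  rwa [Cell.wl_wl, Cell.wl_wl, hi, Cell.wl_id, Cell.wl_id] at this

theorem IsAppSec.right_unique {c : Cell Γ (P.Pi A B).tot} {d d' : Cell A.tot B.tot}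
    (h : P.IsAppSec A B c d) (h' : P.IsAppSec A B c d') : d = d' :=
  wl_q_id_injective (IsApp.right_unique h h')

/-- The 1-cell `Γ.A ⟶ Γ.A.B` obtained by evaluating a section of `P_Π` at the generic element. -/
noncomputable def evalSec (P : AxiomaticPi 𝒟) {A : 𝒟.Ty Γ} {B : 𝒟.Ty A.tot}
    (z : Sec (P.Pi A B)) : A.tot ⟶ B.tot :=
  P.eval (𝟙 A.tot) (A.proj ≫ z.hom) (by
    rw [Category.assoc, z.hom_proj, Category.id_comp, Category.comp_id])

theorem evalSec_proj (z : Sec (P.Pi A B)) : P.evalSec z ≫ B.proj = 𝟙 _ :=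
  P.eval_proj _ _ _

theorem evalSec_reind {f : Ω ⟶ Γ} {A' : 𝒟.Ty Ω} {a : A'.tot ⟶ A.tot} (hA : Reind A f A' a)
    {B' : 𝒟.Ty A'.tot} {b : B'.tot ⟶ B.tot} (hB : Reind B a B' b)
    {n : (P.Pi A' B').tot ⟶ (P.Pi A B).tot} (hP : Reind (P.Pi A B) f (P.Pi A' B') n)
    {z : Sec (P.Pi A B)} {z' : Sec (P.Pi A' B')} (hz : z'.hom ≫ n = f ≫ z.hom) :
    P.evalSec z' ≫ b = a ≫ P.evalSec z := by
  rw [evalSec, evalSec, P.eval_reind hA hB hP, comp_eval]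
  refine P.eval_congr ?_ ?_ _
  · rw [Category.id_comp, Category.comp_id]
  · rw [Category.assoc, hz, ← Category.assoc, ← Category.assoc, hA.w]

theorem app_obj_sec (z : Sec (P.Pi A B)) :
    ((P.app A B (𝟙 Γ)).obj ⟨z.hom, z.hom_proj⟩).hom = 𝒟.q A (𝟙 Γ) ≫ P.evalSec z := by
  rw [app_obj_hom, evalSec, comp_eval]
  refine P.eval_congr (Category.comp_id _).symm ?_ _
  rw [← Category.assoc, q_id_proj]

/-- `app` is fully faithful on sections. -/
theorem IsAppSec.exists_left {z z' : Sec (P.Pi A B)} {d : Cell A.tot B.tot}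
    (hd : (d.wr B.proj).IsOne) (hs : d.src = P.evalSec z) (ht : d.tgt = P.evalSec z') :
    ∃ c, P.IsAppSec A B c d ∧ c.src = z.hom ∧ c.tgt = z'.hom ∧
      (c.wr (P.Pi A B).proj).IsOne :=
  IsApp.exists_left (a := ⟨z.hom, z.hom_proj⟩) (b := ⟨z'.hom, z'.hom_proj⟩)
    (by rw [Cell.wr_wl]; exact hd.wl _) (by rw [Cell.wl_src, hs, app_obj_sec])
    (by rw [Cell.wl_tgt, ht, app_obj_sec])

theorem IsAppSec.wl {c : Cell Γ (P.Pi A B).tot} {d : Cell A.tot B.tot}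
    (h : P.IsAppSec A B c d) (f : Ω ⟶ Γ) : P.IsApp A B f (c.wl f) (d.wl (𝒟.q A f)) := by
  have hL : 𝒟.q A f ≫ A.proj = ((𝒟.sub A f).proj ≫ f) ≫ 𝟙 Γ := by
    rw [(𝒟.isPullback A f).w, Category.comp_id]
  have hL₁ := (𝒟.isPullback A (𝟙 Γ)).lift_fst (𝒟.q A f) ((𝒟.sub A f).proj ≫ f) hL
  have := IsApp.wl h (Category.comp_id f) hL₁ ((𝒟.isPullback A (𝟙 Γ)).lift_snd _ _ hL)
  rwa [Cell.wl_wl, hL₁] at this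

theorem IsAppSec.wr {f : Ω ⟶ Γ} {B' : 𝒟.Ty (𝒟.sub A f).tot} {b : B'.tot ⟶ B.tot}
    (hB : Reind B (𝒟.q A f) B' b)
    {n : (P.Pi (𝒟.sub A f) B').tot ⟶ (P.Pi A B).tot}
    (hP : Reind (P.Pi A B) f (P.Pi (𝒟.sub A f) B') n) {c : Cell Ω (P.Pi (𝒟.sub A f) B').tot}
    {d : Cell (𝒟.sub A f).tot B'.tot} (h : P.IsAppSec (𝒟.sub A f) B' c d) :
    P.IsApp A B f (c.wr n) (d.wr b) := by
  cases hB
  obtain rfl := hP.hom_unique (P.reind_map A B f)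
  obtain ⟨hs, ht, hi, e⟩ := h.exists_eq
  have hc := Cell.isIdentity_iff.1 hi
  have hi' : ((c.wr (P.map A B f)).wr (P.Pi A B).proj).IsOne := by
    rw [Cell.wr_wr, hP.w, ← Cell.wr_wr]
    exact Cell.IsOne.wr hc f
  have hs' : (c.src ≫ P.map A B f) ≫ (P.Pi A B).proj = f := by
    rw [Category.assoc, hP.w, ← Category.assoc, hs, Category.id_comp]
  have ht' : (c.tgt ≫ P.map A B f) ≫ (P.Pi A B).proj = f := by
    rw [Category.assoc, hP.w, ← Category.assoc, ht, Category.id_comp]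
  let θ : (⟨_, hs'⟩ : SliceHom (P.Pi A B).proj f) ⟶ ⟨_, ht'⟩ :=
    ⟨(c.wr (P.map A B f)).hom, Cell.isIdentity_iff.2 hi'⟩
  let θ' : (⟨c.src, hs⟩ : SliceHom (P.Pi (𝒟.sub A f) (𝒟.sub B (𝒟.q A f))).proj (𝟙 Ω)) ⟶
    ⟨c.tgt, ht⟩ := ⟨c.hom, hi⟩
  have e₁ := (P.stable A B f).map θ θ' (Cell.wl_id _).symm
  have e₂ : d.wr (𝒟.q B (𝒟.q A f)) = Cell.mk ((P.app A B f).map θ).1 := by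
    refine wl_q_id_injective (A := 𝒟.sub A f) ?_
    rw [← Cell.wr_wl, e]
    exact e₁
  rw [e₂]
  exact .mk θ

end AxiomaticPi

namespace AxiomaticId

variable (I : AxiomaticId 𝒟)

/-- `M` is the canonical arrow `Ω.A'.A'▼.Id ⟶ Γ.A.A▼.Id` covering a re-indexing `A' = A[f]`. The
fields record its compatibility with the data of the identity types. -/
structure IsIdMap {A : 𝒟.Ty Γ} {f : Ω ⟶ Γ} {A' : 𝒟.Ty Ω} {g : A'.tot ⟶ A.tot}
    (hA : Reind A f A' g) (M : (I.Id A').tot ⟶ (I.Id A).tot) : Prop where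
  reind : ∃ g₂, Reind (𝒟.wk A) g (𝒟.wk A') g₂ ∧ g₂ ≫ 𝒟.q A A.proj = 𝒟.q A' A'.proj ≫ g ∧
    Reind (I.Id A) g₂ (I.Id A') M
  α : (I.αc A').wr g = (I.αc A).wl M
  r : I.r A' ≫ M = g ≫ I.r A
  elim : ∀ {C : 𝒟.Ty (I.Id A).tot} (x : A.tot ⟶ C.tot) (hx : x ≫ C.proj = I.r A)
    {C' : 𝒟.Ty (I.Id A').tot} {n : C'.tot ⟶ C.tot}
    (_ : Reind C M C' n) (x' : A'.tot ⟶ C'.tot) (hx' : x' ≫ C'.proj = I.r A')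
    (_ : x' ≫ n = g ≫ x), (I.elim x' hx').hom ≫ n = M ≫ (I.elim x hx).hom

theorem isIdMap_map (A : 𝒟.Ty Γ) (f : Ω ⟶ Γ) : I.IsIdMap (.mk (A := A) (f := f)) (I.map A f) where
  reind := ⟨_, reind_wkMap A f, wkMap_q A f, I.reind_map A f⟩
  α := I.αc_reind A f
  r := I.r_map A f
  elim x hx _ _ hC x' hx' e := I.elim_map x hx f hC x' hx' e

theorem exists_isIdMap {A : 𝒟.Ty Γ} {f : Ω ⟶ Γ} {A' : 𝒟.Ty Ω} {g : A'.tot ⟶ A.tot}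
    (hA : Reind A f A' g) : ∃ M, I.IsIdMap hA M := by
  cases hA
  exact ⟨_, I.isIdMap_map A f⟩

/-- The 1-cell into the arrow object corresponding to an identity term. -/
noncomputable abbrev arr {T : 𝒟.Ty Γ} {m : X ⟶ (𝒟.wk T).tot} (p : Sec (𝒟.sub (I.Id T) m)) :
    X ⟶ (I.Id T).tot :=
  p.hom ≫ 𝒟.q (I.Id T) m

/-- The 2-cell corresponding to an identity term. -/
noncomputable abbrev cell {T : 𝒟.Ty Γ} {m : X ⟶ (𝒟.wk T).tot} (p : Sec (𝒟.sub (I.Id T) m)) :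
    Cell X T.tot :=
  (I.αc T).wl (I.arr p)

variable {I}

theorem arr_s {T : 𝒟.Ty Γ} {m : X ⟶ (𝒟.wk T).tot} (p : Sec (𝒟.sub (I.Id T) m)) :
    I.arr p ≫ I.s T = m ≫ (𝒟.wk T).proj := by
  rw [← Category.assoc, arr_proj]

theorem arr_t {T : 𝒟.Ty Γ} {m : X ⟶ (𝒟.wk T).tot} (p : Sec (𝒟.sub (I.Id T) m)) :
    I.arr p ≫ I.t T = m ≫ 𝒟.q T T.proj := by
  rw [← Category.assoc, arr_proj]

theorem cell_injective {T : 𝒟.Ty Γ} {m : X ⟶ (𝒟.wk T).tot} {p p' : Sec (𝒟.sub (I.Id T) m)}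
    (h : I.cell p = I.cell p') : p = p' :=
  Reind.sec_ext .mk (I.hom_ext h)

theorem exists_cell_eq {T : 𝒟.Ty Γ} {z z' : Sec T} {c : Cell Γ T.tot} (hs : c.src = z.hom)
    (ht : c.tgt = z'.hom) (hc : (c.wr T.proj).IsOne) :
    ∃ p : Sec (𝒟.sub (I.Id T) (𝒟.pair z z')), I.cell p = c := by
  obtain ⟨x, rfl⟩ := I.exists_arrow T c hc
  refine ⟨𝒟.secOf _ _ x (wk_hom_ext ?_ ?_), ?_⟩
  · rw [pair_proj, Category.assoc]
    exact hs
  · rw [pair_q, Category.assoc]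
    exact ht
  · rw [cell, arr, secOf_q]

theorem same_of_cell {T : 𝒟.Ty Γ} {f : Ω ⟶ Γ} {T' : 𝒟.Ty Ω} {g : T'.tot ⟶ T.tot}
    (hT : Reind T f T' g) {m : Γ ⟶ (𝒟.wk T).tot} {m' : Ω ⟶ (𝒟.wk T').tot}
    {p : Sec (𝒟.sub (I.Id T) m)} {p' : Sec (𝒟.sub (I.Id T') m')}
    (h : (I.cell p').wr g = (I.cell p).wl f) : (𝒟.subSec p f).Same p' := by
  obtain ⟨M, hM⟩ := I.exists_isIdMap hT
  obtain ⟨g₂, -, -, h₂⟩ := hM.reind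
  refine Reind.same (Reind.comp .mk .mk) (h₂.comp .mk) ?_
  have e : f ≫ I.arr p = I.arr p' ≫ M := by
    refine I.hom_ext ?_
    rw [← Cell.wl_wl, ← Cell.wl_wl (I.arr p'), ← hM.α, ← Cell.wr_wl]
    exact h.symm
  rw [← Category.assoc, subSec_q, Category.assoc, e, Category.assoc]

theorem exists_reind_term {T : 𝒟.Ty Γ} {f : Ω ⟶ Γ} {T' : 𝒟.Ty Ω} {g : T'.tot ⟶ T.tot}
    (hT : Reind T f T' g) {z z' : Sec T} {y y' : Sec T'} (hy : y.hom ≫ g = f ≫ z.hom)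
    (hy' : y'.hom ≫ g = f ≫ z'.hom) (p : Sec (𝒟.sub (I.Id T) (𝒟.pair z z'))) :
    ∃ (n : (𝒟.sub (I.Id T') (𝒟.pair y y')).tot ⟶ (𝒟.sub (I.Id T) (𝒟.pair z z')).tot)
      (p' : Sec (𝒟.sub (I.Id T') (𝒟.pair y y'))),
      Reind (𝒟.sub (I.Id T) (𝒟.pair z z')) f (𝒟.sub (I.Id T') (𝒟.pair y y')) n ∧
      p'.hom ≫ n = f ≫ p.hom := by
  obtain ⟨M, hM⟩ := I.exists_isIdMap hT
  obtain ⟨g₂, h₁, h₃, h₂⟩ := hM.reind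
  have e : 𝒟.pair y y' ≫ g₂ = f ≫ 𝒟.pair z z' := by
    refine wk_hom_ext ?_ ?_
    · rw [Category.assoc, h₁.w, ← Category.assoc, pair_proj, Category.assoc, pair_proj, hy]
    · rw [Category.assoc, h₃, ← Category.assoc, pair_q, Category.assoc, pair_q, hy']
  have hr : Reind (I.Id T) (f ≫ 𝒟.pair z z') (𝒟.sub (I.Id T') (𝒟.pair y y'))
    (𝒟.q (I.Id T') (𝒟.pair y y') ≫ M) := (h₂.comp .mk).congr e rfl
  obtain ⟨n, hn, -⟩ := Reind.cancel .mk hr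
  exact ⟨n, hn.sec (f ≫ p.hom) (by rw [Category.assoc, p.hom_proj, Category.comp_id]), hn,
    hn.sec_hom _ _⟩

end AxiomaticId

end AppCells

/-! ### Types of pointwise identities -/

section Homotopies

variable {𝒞 : Type u} [Bicategory.{w, v} 𝒞] [Bicategory.Strict 𝒞] [IsLocallyGroupoid 𝒞]
  {𝒟 : DisplayMap2Category 𝒞} {Γ Ω X Y : 𝒞}

variable {I : AxiomaticId 𝒟} {P : AxiomaticPi 𝒟}

/-- The type of pointwise identities between two generalized elements `y`, `y'` of `Π_A^B` over
`f` is `Π_{A₁}^{B₁}`, a homotopy type, with `A₁ = A[f]` and `B₁` the re-indexing of `Id_B` along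
`(y x); (y' x)`. This predicate records `A₁`, `B₁` and the canonical arrows `a : A₁ ⟶ A` and
`κ : B₁ ⟶ Id_B`. -/
structure IsHomotopyTy (I : AxiomaticId 𝒟) (P : AxiomaticPi 𝒟) {A : 𝒟.Ty Γ} {B : 𝒟.Ty A.tot}
    (y y' : X ⟶ (P.Pi A B).tot) (A₁ : 𝒟.Ty X) (B₁ : 𝒟.Ty A₁.tot) (a : A₁.tot ⟶ A.tot)
    (κ : B₁.tot ⟶ (I.Id B).tot) : Prop where
  left : Reind A (y ≫ (P.Pi A B).proj) A₁ a
  right : ∃ m, Reind (I.Id B) m B₁ κ ∧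
    (∀ h, m ≫ (𝒟.wk B).proj = P.eval a (A₁.proj ≫ y) h) ∧
    (∀ h, m ≫ 𝒟.q B B.proj = P.eval a (A₁.proj ≫ y') h)
  proj_eq : y ≫ (P.Pi A B).proj = y' ≫ (P.Pi A B).proj

namespace IsHomotopyTy

variable {A : 𝒟.Ty Γ} {B : 𝒟.Ty A.tot} {y y' : X ⟶ (P.Pi A B).tot} {A₁ : 𝒟.Ty X}
  {B₁ : 𝒟.Ty A₁.tot} {a : A₁.tot ⟶ A.tot} {κ : B₁.tot ⟶ (I.Id B).tot}

theorem w_left (H : IsHomotopyTy I P y y' A₁ B₁ a κ) :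
    a ≫ A.proj = (A₁.proj ≫ y) ≫ (P.Pi A B).proj := by
  rw [H.left.w, Category.assoc]

theorem w_right (H : IsHomotopyTy I P y y' A₁ B₁ a κ) :
    a ≫ A.proj = (A₁.proj ≫ y') ≫ (P.Pi A B).proj := by
  rw [H.left.w, Category.assoc, H.proj_eq]

theorem comp_eval_proj {k : Y ⟶ X} {A₂ : 𝒟.Ty Y} {a' : A₂.tot ⟶ A₁.tot}
    (ha' : Reind A₁ k A₂ a') (h : a ≫ A.proj = (A₁.proj ≫ y) ≫ (P.Pi A B).proj)
    (h' : (a' ≫ a) ≫ A.proj = (A₂.proj ≫ k ≫ y) ≫ (P.Pi A B).proj) :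
    P.eval (a' ≫ a) (A₂.proj ≫ k ≫ y) h' = a' ≫ P.eval a (A₁.proj ≫ y) h := by
  rw [AxiomaticPi.comp_eval]
  refine P.eval_congr rfl ?_ _
  rw [← Category.assoc, ← Category.assoc, ha'.w]

/-- Homotopy types are stable under re-indexing. -/
theorem exists_reind (H : IsHomotopyTy I P y y' A₁ B₁ a κ) {k : Y ⟶ X} {A₂ : 𝒟.Ty Y}
    {B₂ : 𝒟.Ty A₂.tot} {a₂ : A₂.tot ⟶ A.tot} {κ₂ : B₂.tot ⟶ (I.Id B).tot}
    {z z' : Y ⟶ (P.Pi A B).tot} (H₂ : IsHomotopyTy I P z z' A₂ B₂ a₂ κ₂) (hz : k ≫ y = z)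
    (hz' : k ≫ y' = z') :
    ∃ a' b' n, Reind A₁ k A₂ a' ∧ Reind B₁ a' B₂ b' ∧ Reind (P.Pi A₁ B₁) k (P.Pi A₂ B₂) n ∧
      a' ≫ a = a₂ ∧ b' ≫ κ = κ₂ := by
  subst hz; subst hz'
  obtain ⟨m, hm, hs, ht⟩ := H.right
  obtain ⟨m₂, hm₂, hs₂, ht₂⟩ := H₂.right
  obtain ⟨a', ha', rfl⟩ := H.left.cancel (H₂.left.congr (Category.assoc _ _ _) rfl)
  have e : m₂ = a' ≫ m := by
    refine wk_hom_ext ?_ ?_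
    · rw [Category.assoc, hs H.w_left, hs₂ H₂.w_left, comp_eval_proj ha' H.w_left]
    · rw [Category.assoc, ht H.w_right, ht₂ H₂.w_right, comp_eval_proj ha' H.w_right]
  obtain ⟨b', hb', rfl⟩ := hm.cancel (hm₂.congr e rfl)
  obtain ⟨n, hn⟩ := ha'.pi P.toPiForm hb'
  exact ⟨a', b', n, ha', hb', hn, rfl, rfl⟩

/-- Homotopy types for re-indexed dependent products are homotopy types for the original ones. -/
theorem base_change {A' : 𝒟.Ty Ω} {f : Ω ⟶ Γ} {g : A'.tot ⟶ A.tot} (hA : Reind A f A' g)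
    {B' : 𝒟.Ty A'.tot} {g' : B'.tot ⟶ B.tot} (hB : Reind B g B' g')
    {n : (P.Pi A' B').tot ⟶ (P.Pi A B).tot} (hP : Reind (P.Pi A B) f (P.Pi A' B') n)
    {M : (I.Id B').tot ⟶ (I.Id B).tot} (hM : I.IsIdMap hB M)
    {z z' : Y ⟶ (P.Pi A' B').tot} {A₂ : 𝒟.Ty Y} {B₂ : 𝒟.Ty A₂.tot} {a₂ : A₂.tot ⟶ A'.tot}
    {κ₂ : B₂.tot ⟶ (I.Id B').tot} (H : IsHomotopyTy I P z z' A₂ B₂ a₂ κ₂) :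
    IsHomotopyTy I P (z ≫ n) (z' ≫ n) A₂ B₂ (a₂ ≫ g) (κ₂ ≫ M) where
  left := (hA.comp H.left).congr (by rw [Category.assoc, Category.assoc, hP.w]) rfl
  right := by
    obtain ⟨m, hm, hs, ht⟩ := H.right
    obtain ⟨g₂, h₁, h₂, h₃⟩ := hM.reind
    refine ⟨m ≫ g₂, h₃.comp hm, fun h => ?_, fun h => ?_⟩
    · rw [Category.assoc, h₁.w, ← Category.assoc, hs H.w_left, P.eval_reind hA hB hP]
      exact P.eval_congr rfl (Category.assoc _ _ _) _
    · rw [Category.assoc, h₂, ← Category.assoc, ht H.w_right, P.eval_reind hA hB hP]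
      exact P.eval_congr rfl (Category.assoc _ _ _) _
  proj_eq := by rw [Category.assoc, Category.assoc, hP.w, ← Category.assoc, H.proj_eq,
    Category.assoc]

/-- The homotopy type written with terms `b`, `b'` of the re-indexing of `B`. -/
theorem of_terms {f : X ⟶ Γ} (h : y ≫ (P.Pi A B).proj = f) (h' : y' ≫ (P.Pi A B).proj = f)
    (b b' : Sec (𝒟.sub B (𝒟.q A f)))
    (hb : ∀ e, b.hom ≫ 𝒟.q B (𝒟.q A f) = P.eval (𝒟.q A f) ((𝒟.sub A f).proj ≫ y) e)
    (hb' : ∀ e, b'.hom ≫ 𝒟.q B (𝒟.q A f) = P.eval (𝒟.q A f) ((𝒟.sub A f).proj ≫ y') e) :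
    IsHomotopyTy I P y y' (𝒟.sub A f) (𝒟.sub (I.Id (𝒟.sub B (𝒟.q A f))) (𝒟.pair b b'))
      (𝒟.q A f) (𝒟.q (I.Id (𝒟.sub B (𝒟.q A f))) (𝒟.pair b b') ≫ I.map B (𝒟.q A f)) where
  left := Reind.mk.congr h.symm rfl
  right := by
    refine ⟨𝒟.pair b b' ≫ 𝒟.wkMap B (𝒟.q A f), (I.reind_map B (𝒟.q A f)).comp .mk,
      fun e => ?_, fun e => ?_⟩
    · rw [Category.assoc, wkMap_proj, ← Category.assoc, pair_proj, hb]
    · rw [Category.assoc, wkMap_q, ← Category.assoc, pair_q, hb']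
  proj_eq := h.trans h'.symm

end IsHomotopyTy

variable {A : 𝒟.Ty Γ} {B : 𝒟.Ty A.tot}

theorem app_hom (z : Sec (P.Pi A B)) : (P.piEval.app z).hom = P.evalSec z := by
  have h : Reind B (𝟙 _) (𝒟.sub (𝒟.sub B (𝒟.q A (P.Pi A B).proj)) (P.secBullet z))
      (𝒟.q (𝒟.sub B (𝒟.q A (P.Pi A B).proj)) (P.secBullet z) ≫ 𝒟.q B (𝒟.q A (P.Pi A B).proj)) :=
    (Reind.comp .mk .mk).congr (P.secBullet_q z) rfl
  have e := h.castHom_comp (Reind.id B)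
  rw [PiEval.app, Sec.cast_hom]
  rw [Category.comp_id] at e
  rw [e, ← Category.assoc, subSec_q, Category.assoc, P.piEval_ev_q, P.secBullet_ev₀]
  rfl

theorem evAt_q {f : X ⟶ Γ} (y : X ⟶ (P.Pi A B).tot) (h : y ≫ (P.Pi A B).proj = f)
    (e : 𝒟.q A f ≫ A.proj = ((𝒟.sub A f).proj ≫ y) ≫ (P.Pi A B).proj) :
    (P.piEval.evAt y f h).hom ≫ 𝒟.q B (𝒟.q A f) =
      P.eval (𝒟.q A f) ((𝒟.sub A f).proj ≫ y) e := by
  have h₁ : Reind B (𝒟.q A f) (𝒟.sub (𝒟.sub B (𝒟.q A (P.Pi A B).proj)) (P.bullet y f h))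
      (𝒟.q (𝒟.sub B (𝒟.q A (P.Pi A B).proj)) (P.bullet y f h) ≫
        𝒟.q B (𝒟.q A (P.Pi A B).proj)) :=
    (Reind.comp .mk .mk).congr (P.bullet_q y f h) rfl
  rw [PiEval.evAt, Sec.cast_hom, Category.assoc, h₁.castHom_comp .mk, ← Category.assoc, subSec_q,
    Category.assoc, P.piEval_ev_q]
  rfl

/-- The type of pointwise identities between two sections of `P_Π` is a homotopy type. -/
theorem isHomotopyTy_homotopy (z z' : Sec (P.Pi A B)) :
    IsHomotopyTy I P z.hom z'.hom A
      (𝒟.sub (I.Id B) (𝒟.pair (P.piEval.app z) (P.piEval.app z'))) (𝟙 _)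
      (𝒟.q (I.Id B) (𝒟.pair (P.piEval.app z) (P.piEval.app z'))) where
  left := (Reind.id A).congr z.hom_proj.symm rfl
  right := by
    refine ⟨_, .mk, fun h => ?_, fun h => ?_⟩
    · rw [pair_proj, app_hom]; rfl
    · rw [pair_q, app_hom]; rfl
  proj_eq := by rw [z.hom_proj, z'.hom_proj]

/-- The 2-cell corresponding to a term of a homotopy type. -/
noncomputable def homotopyCell {A₁ : 𝒟.Ty X} {B₁ : 𝒟.Ty A₁.tot} (κ : B₁.tot ⟶ (I.Id B).tot)
    (h : Sec (P.Pi A₁ B₁)) : Cell A₁.tot B.tot :=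
  (I.αc B).wl (P.evalSec h ≫ κ)

theorem homotopyCell_src {y y' : X ⟶ (P.Pi A B).tot} {A₁ : 𝒟.Ty X} {B₁ : 𝒟.Ty A₁.tot}
    {a : A₁.tot ⟶ A.tot} {κ : B₁.tot ⟶ (I.Id B).tot} (H : IsHomotopyTy I P y y' A₁ B₁ a κ)
    (h : Sec (P.Pi A₁ B₁)) :
    (homotopyCell κ h).src = P.eval a (A₁.proj ≫ y) H.w_left := by
  obtain ⟨m, hm, hs, -⟩ := H.right
  change (P.evalSec h ≫ κ) ≫ (I.Id B).proj ≫ (𝒟.wk B).proj = _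
  rw [← hs, Category.assoc, ← Category.assoc κ, hm.w, Category.assoc B₁.proj, ← Category.assoc,
    AxiomaticPi.evalSec_proj, Category.id_comp]

theorem homotopyCell_tgt {y y' : X ⟶ (P.Pi A B).tot} {A₁ : 𝒟.Ty X} {B₁ : 𝒟.Ty A₁.tot}
    {a : A₁.tot ⟶ A.tot} {κ : B₁.tot ⟶ (I.Id B).tot} (H : IsHomotopyTy I P y y' A₁ B₁ a κ)
    (h : Sec (P.Pi A₁ B₁)) :
    (homotopyCell κ h).tgt = P.eval a (A₁.proj ≫ y') H.w_right := by
  obtain ⟨m, hm, -, ht⟩ := H.right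
  change (P.evalSec h ≫ κ) ≫ (I.Id B).proj ≫ 𝒟.q B B.proj = _
  rw [← ht, Category.assoc, ← Category.assoc κ, hm.w, Category.assoc B₁.proj, ← Category.assoc,
    AxiomaticPi.evalSec_proj, Category.id_comp]

theorem homotopyCell_isOne {A₁ : 𝒟.Ty X} {B₁ : 𝒟.Ty A₁.tot} (κ : B₁.tot ⟶ (I.Id B).tot)
    (h : Sec (P.Pi A₁ B₁)) : ((homotopyCell κ h).wr B.proj).IsOne := by
  rw [homotopyCell, Cell.wr_wl]
  exact (I.αc_isOne B).wl _

theorem homotopyCell_reind {A₁ : 𝒟.Ty X} {B₁ : 𝒟.Ty A₁.tot} {κ : B₁.tot ⟶ (I.Id B).tot}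
    {h : Sec (P.Pi A₁ B₁)} {k : Y ⟶ X} {A₂ : 𝒟.Ty Y} {B₂ : 𝒟.Ty A₂.tot} {a' : A₂.tot ⟶ A₁.tot}
    {b' : B₂.tot ⟶ B₁.tot} {n : (P.Pi A₂ B₂).tot ⟶ (P.Pi A₁ B₁).tot} (ha : Reind A₁ k A₂ a')
    (hb : Reind B₁ a' B₂ b') (hn : Reind (P.Pi A₁ B₁) k (P.Pi A₂ B₂) n) {h₂ : Sec (P.Pi A₂ B₂)}
    (e : h₂.hom ≫ n = k ≫ h.hom) :
    homotopyCell (b' ≫ κ) h₂ = (homotopyCell κ h).wl a' := by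
  rw [homotopyCell, homotopyCell, Cell.wl_wl, ← Category.assoc,
    AxiomaticPi.evalSec_reind ha hb hn e, Category.assoc]

end Homotopies

/-! ### The term `happly` -/

noncomputable section Happly

variable {𝒞 : Type u} [Bicategory.{w, v} 𝒞] [Bicategory.Strict 𝒞] [IsLocallyGroupoid 𝒞]
  {𝒟 : DisplayMap2Category 𝒞} {Γ Ω X Y : 𝒞}

theorem Reind.hom_eq_of_same {A : 𝒟.Ty Γ} {f : Ω ⟶ Γ} {A₁ A₂ : 𝒟.Ty Ω} {g₁ : A₁.tot ⟶ A.tot}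
    {g₂ : A₂.tot ⟶ A.tot} (h₁ : Reind A f A₁ g₁) (h₂ : Reind A f A₂ g₂) {a : Sec A₁} {b : Sec A₂}
    (h : a.Same b) : a.hom ≫ g₁ = b.hom ≫ g₂ := by
  cases h₁; cases h₂
  rw [h.eq]

theorem AxiomaticId.elim_congr {I : AxiomaticId 𝒟} {A : 𝒟.Ty Γ} {C : 𝒟.Ty (I.Id A).tot}
    {x x' : A.tot ⟶ C.tot} (e : x = x') (hx : x ≫ C.proj = I.r A) :
    I.elim x hx = I.elim x' (by rw [← e, hx]) := by
  subst e; rfl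

variable (I : AxiomaticId 𝒟) (P : AxiomaticPi 𝒟) (A : 𝒟.Ty Γ) (B : 𝒟.Ty A.tot)

/-- The domain of the universal homotopy type, that is, of the type of pointwise identities between
the endpoints of the generic term of `Id_Π`. -/
abbrev genDom : 𝒟.Ty (I.Id (P.Pi A B)).tot :=
  𝒟.sub A (I.s (P.Pi A B) ≫ (P.Pi A B).proj)

/-- The codomain of the universal homotopy type. -/
abbrev genCod : 𝒟.Ty (genDom I P A B).tot :=
  𝒟.sub (I.Id (𝒟.sub B (𝒟.q A (I.s (P.Pi A B) ≫ (P.Pi A B).proj))))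
    (𝒟.pair (P.piEval.evAt (I.s (P.Pi A B)) _ rfl)
      (P.piEval.evAt (I.t (P.Pi A B)) _ (I.s_proj_eq_t_proj _).symm))

/-- The canonical arrow from the codomain of the universal homotopy type to the identity type
of `B`. -/
abbrev genArr : (genCod I P A B).tot ⟶ (I.Id B).tot :=
  𝒟.q (I.Id (𝒟.sub B (𝒟.q A (I.s (P.Pi A B) ≫ (P.Pi A B).proj)))) _ ≫
    I.map B (𝒟.q A (I.s (P.Pi A B) ≫ (P.Pi A B).proj))

theorem isHomotopyTy_gen :
    IsHomotopyTy I P (I.s (P.Pi A B)) (I.t (P.Pi A B)) (genDom I P A B) (genCod I P A B)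
      (𝒟.q A _) (genArr I P A B) :=
  .of_terms rfl (I.s_proj_eq_t_proj _).symm _ _ (fun e => evAt_q _ _ e) (fun e => evAt_q _ _ e)

/-- The type of pointwise identities between the generic function and itself, in the context of
a generic function and its argument. -/
abbrev reflCod : 𝒟.Ty (𝒟.sub A (P.Pi A B).proj).tot :=
  𝒟.sub (I.Id (𝒟.sub B (𝒟.q A (P.Pi A B).proj)))
    (𝒟.pair (P.piEval.ev A B) (P.piEval.ev A B))

/-- The canonical arrow from `reflCod` to the identity type of `B`. -/
abbrev reflArr : (reflCod I P A B).tot ⟶ (I.Id B).tot :=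
  𝒟.q (I.Id (𝒟.sub B (𝒟.q A (P.Pi A B).proj))) _ ≫ I.map B (𝒟.q A (P.Pi A B).proj)

/-- The term `λ x, r(ev(z, x))`. -/
abbrev reflHomotopy : Sec (P.Pi (𝒟.sub A (P.Pi A B).proj) (reflCod I P A B)) :=
  P.abst (I.idIntro.reflAt (P.piEval.ev A B))

theorem isHomotopyTy_refl :
    IsHomotopyTy I P (𝟙 (P.Pi A B).tot) (𝟙 _) (𝒟.sub A (P.Pi A B).proj) (reflCod I P A B)
      (𝒟.q A _) (reflArr I P A B) := by
  refine .of_terms (Category.id_comp _) (Category.id_comp _) _ _ (fun e => ?_) (fun e => ?_) <;>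
  · rw [P.piEval_ev_q, P.ev₀_eq]
    exact P.eval_congr rfl (Category.comp_id _).symm _

/-- The 2-cell of the reflexivity term of `ev` is an identity. -/
theorem reflCell : (I.αc B).wl ((I.idIntro.reflAt (P.piEval.ev A B)).hom ≫ reflArr I P A B) =
    Cell.one (P.ev₀ A B) := by
  have e : (I.idIntro.reflAt (P.piEval.ev A B)).hom ≫ 𝒟.q (I.Id _) _ =
      (P.piEval.ev A B).hom ≫ I.r _ := by
    rw [IdIntro.reflAt, secOf_q, I.idIntro_r]
  rw [← Category.assoc, e, ← Cell.wl_wl, ← I.αc_reind, ← Cell.wr_wl, ← Cell.wl_wl, I.wl_r,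
    Cell.wl_one, Cell.wr_one, Category.comp_id, P.piEval_ev_q]

theorem exists_reflMap : ∃ ν, Reind (P.Pi (genDom I P A B) (genCod I P A B)) (I.r (P.Pi A B))
    (P.Pi (𝒟.sub A (P.Pi A B).proj) (reflCod I P A B)) ν := by
  obtain ⟨_, _, ν, _, _, hν, _, _⟩ := (isHomotopyTy_gen I P A B).exists_reind
    (isHomotopyTy_refl I P A B) (I.r_s _) (I.r_t _)
  exact ⟨ν, hν⟩

/-- The canonical arrow exhibiting the type of `reflHomotopy` as a re-indexing of the universal
homotopy type. -/
def reflMap : (P.Pi (𝒟.sub A (P.Pi A B).proj) (reflCod I P A B)).tot ⟶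
    (P.Pi (genDom I P A B) (genCod I P A B)).tot :=
  (exists_reflMap I P A B).choose

theorem reind_reflMap : Reind (P.Pi (genDom I P A B) (genCod I P A B)) (I.r (P.Pi A B))
    (P.Pi (𝒟.sub A (P.Pi A B).proj) (reflCod I P A B)) (reflMap I P A B) :=
  (exists_reflMap I P A B).choose_spec

theorem reflHomotopy_reflMap_proj : ((reflHomotopy I P A B).hom ≫ reflMap I P A B) ≫
    (P.Pi (genDom I P A B) (genCod I P A B)).proj = I.r (P.Pi A B) := by
  rw [Category.assoc, (reind_reflMap I P A B).w, ← Category.assoc, Sec.hom_proj,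
    Category.id_comp]

/-- The term `happly` of the universal homotopy type, defined by elimination from
`reflHomotopy`. -/
def happly : Sec (P.Pi (genDom I P A B) (genCod I P A B)) :=
  I.elim ((reflHomotopy I P A B).hom ≫ reflMap I P A B) (reflHomotopy_reflMap_proj I P A B)

theorem r_happly (hn : 𝒟.Normal) :
    I.r (P.Pi A B) ≫ (happly I P A B).hom = (reflHomotopy I P A B).hom ≫ reflMap I P A B :=
  I.r_elim hn _ _

theorem happly_spec (hn : 𝒟.Normal) : ∃ c : Sec (𝒟.sub (P.piEval.genHomotopy I.toIdForm A B)
      ((I.idRules hn).r (P.Pi A B))),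
    c.Same (P.abst (I.idIntro.reflAt (P.piEval.ev A B))) ∧
      happly I P A B = (I.idRules hn).j (P.piEval.genHomotopy I.toIdForm A B) c := by
  have h := (reind_reflMap I P A B).congr (I.idIntro_r _).symm rfl
  refine ⟨(reflHomotopy I P A B).cast (h.ty_unique .mk), Sec.cast_same _ _, ?_⟩
  exact AxiomaticId.elim_congr (Reind.hom_eq_of_same h .mk (Sec.cast_same _ _).symm) _

/-- The 2-cell of `happly` is the image of the universal 2-cell `α` between functions under the
functor `app`: two 2-cells over `Id_Π.A` with the same boundary are equal as soon as they agree on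
the reflexivity terms, because `Id_Π.A` retracts onto these up to an invertible 2-cell. -/
theorem isApp_happly (hn : 𝒟.Normal)
    (hβ : ∀ {Γ X : 𝒞} (A : 𝒟.Ty Γ) (B : 𝒟.Ty A.tot) (f : X ⟶ Γ)
      (b : SliceHom B.proj (𝒟.q A f)), IsIdentity ((P.lam A B f).β.hom.app b).1) :
    P.IsApp A B (I.s (P.Pi A B) ≫ (P.Pi A B).proj) (I.αc (P.Pi A B))
      (homotopyCell (genArr I P A B) (happly I P A B)) := by
  obtain ⟨φ, hφ⟩ := AxiomaticPi.IsApp.exists_right (P := P) (I.αc_isOne (P.Pi A B))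
    (f := I.s (P.Pi A B) ≫ (P.Pi A B).proj) rfl
  suffices e : φ = homotopyCell (genArr I P A B) (happly I P A B) by rwa [← e]
  obtain ⟨a', b', ν, ha', hb', hν, ea, eb⟩ := (isHomotopyTy_gen I P A B).exists_reind
    (isHomotopyTy_refl I P A B) (I.r_s _) (I.r_t _)
  obtain rfl := hν.hom_unique (reind_reflMap I P A B)
  -- both 2-cells become identities on the reflexivity terms
  have e₁ : φ.wl a' = Cell.one (P.ev₀ A B) := by
    have h₁ := hφ.wl (g := I.r (P.Pi A B)) (k := (P.Pi A B).proj)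
      (by rw [← Category.assoc, I.r_s, Category.id_comp]) ea ha'.w
    rw [I.wl_r] at h₁
    rw [h₁.right_unique (AxiomaticPi.isApp_one (𝟙 _) (Category.id_comp _)), P.ev₀_eq]
    exact congrArg Cell.one (P.eval_congr rfl (Category.comp_id _) _)
  have e₂ : (homotopyCell (genArr I P A B) (happly I P A B)).wl a' = Cell.one (P.ev₀ A B) := by
    rw [← homotopyCell_reind ha' hb' hν (h₂ := reflHomotopy I P A B)
      (r_happly I P A B hn).symm, eb, homotopyCell]
    have := P.eval_abst hβ (I.idIntro.reflAt (P.piEval.ev A B))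
      (by rw [Category.assoc, Sec.hom_proj, Category.id_comp, Category.comp_id])
    rw [AxiomaticPi.evalSec, this, reflCell]
  -- the contraction of `Id_Π` onto the reflexivity terms, extended to `Id_Π.A`
  have hT : 𝒟.q A (I.s (P.Pi A B) ≫ (P.Pi A B).proj) ≫ A.proj =
      ((genDom I P A B).proj ≫ I.t (P.Pi A B)) ≫ (P.Pi A B).proj :=
    (isHomotopyTy_gen I P A B).w_right
  let tA := (𝒟.isPullback A (P.Pi A B).proj).lift _ _ hT
  have htA : tA ≫ 𝒟.q A _ = _ := (𝒟.isPullback A (P.Pi A B).proj).lift_fst _ _ hT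
  have htA' : tA ≫ (𝒟.sub A _).proj = _ := (𝒟.isPullback A (P.Pi A B).proj).lift_snd _ _ hT
  obtain ⟨ρ⟩ := exists_pullback_cell A (I.s (P.Pi A B) ≫ (P.Pi A B).proj) (x := 𝟙 _)
    (y := tA ≫ a') ((I.contr (P.Pi A B)).wl (genDom I P A B).proj) (Cell.one (𝒟.q A _))
    (by rw [Cell.wl_src, I.contr_src, Category.comp_id, Category.id_comp])
    (by
      rw [Cell.wl_tgt, I.contr_tgt, Category.assoc tA, ha'.w, ← Category.assoc tA, htA']
      exact (Category.assoc _ _ _).symm)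
    (Category.id_comp _).symm
    (htA.symm.trans ((congrArg (tA ≫ ·) ea.symm).trans (Category.assoc _ _ _).symm))
    (by
      rw [Cell.wr_wl, (I.contr_isOne _).eq_src, Cell.wl_one, Cell.wr_one, Cell.wr_src,
        I.contr_src, Category.id_comp, (𝒟.isPullback A _).w])
  refine Cell.eq_of_wl_eq ρ ?_ ?_ ?_
  · rw [homotopyCell_src (isHomotopyTy_gen I P A B)]
    exact hφ.src_eq (isHomotopyTy_gen I P A B).w_left
  · rw [homotopyCell_tgt (isHomotopyTy_gen I P A B)]
    exact hφ.tgt_eq (isHomotopyTy_gen I P A B).w_right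
  · rw [← Cell.wl_wl, ← Cell.wl_wl, e₁, e₂]

end Happly

/-! ### Function extensionality -/

noncomputable section Funext

variable {𝒞 : Type u} [Bicategory.{w, v} 𝒞] [Bicategory.Strict 𝒞] [IsLocallyGroupoid 𝒞]
  {𝒟 : DisplayMap2Category 𝒞} {Γ Ω X Y : 𝒞} {I : AxiomaticId 𝒟} {P : AxiomaticPi 𝒟}

section Stability

variable {A : 𝒟.Ty Γ} {B : 𝒟.Ty A.tot} {f : Ω ⟶ Γ} {A' : 𝒟.Ty Ω} {g : A'.tot ⟶ A.tot}
  {B' : 𝒟.Ty A'.tot} {g' : B'.tot ⟶ B.tot} {n : (P.Pi A' B').tot ⟶ (P.Pi A B).tot}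

/-- The term `λ x, r(ev(z, x))` is stable under re-indexing. -/
theorem reflHomotopy_reind (hA : Reind A f A' g) (hB : Reind B g B' g')
    (hP : Reind (P.Pi A B) f (P.Pi A' B') n) :
    ∃ n₂, Reind (P.Pi (𝒟.sub A (P.Pi A B).proj) (reflCod I P A B)) n
        (P.Pi (𝒟.sub A' (P.Pi A' B').proj) (reflCod I P A' B')) n₂ ∧
      (reflHomotopy I P A' B').hom ≫ n₂ = n ≫ (reflHomotopy I P A B).hom := by
  obtain ⟨M, hM⟩ := I.exists_isIdMap hB
  obtain ⟨a₂, b₂, n₂, ha, hb, hn, ea, eb⟩ := (isHomotopyTy_refl I P A B).exists_reind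
    ((isHomotopyTy_refl I P A' B').base_change hA hB hP hM) (k := n)
    ((Category.comp_id _).trans (Category.id_comp _).symm)
    ((Category.comp_id _).trans (Category.id_comp _).symm)
  refine ⟨n₂, hn, P.abst_reind ha hb hn _ _ ?_⟩
  obtain ⟨m, hm, -, -⟩ := (isHomotopyTy_refl I P A B).right
  refine hm.isPullback.hom_ext ?_ ?_
  · refine I.hom_ext ?_
    rw [Category.assoc, eb, ← Category.assoc, ← Cell.wl_wl, ← hM.α, ← Cell.wr_wl, reflCell,
      Category.assoc, ← Cell.wl_wl, reflCell, Cell.wl_one, Cell.wr_one, P.ev₀_eq, P.ev₀_eq,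
      P.eval_reind hA hB hP, P.comp_eval]
    exact congrArg Cell.one (P.eval_congr ea.symm ha.w.symm _)
  · rw [Category.assoc, Category.assoc, hb.w, ← Category.assoc, Sec.hom_proj, Sec.hom_proj,
      Category.id_comp, Category.comp_id]

/-- The term `happly` is stable under re-indexing. -/
theorem happly_reind (hA : Reind A f A' g) (hB : Reind B g B' g')
    (hP : Reind (P.Pi A B) f (P.Pi A' B') n)
    {M : (I.Id (P.Pi A' B')).tot ⟶ (I.Id (P.Pi A B)).tot} (hM : I.IsIdMap hP M) :
    ∃ N, Reind (P.Pi (genDom I P A B) (genCod I P A B)) M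
        (P.Pi (genDom I P A' B') (genCod I P A' B')) N ∧
      (happly I P A' B').hom ≫ N = M ≫ (happly I P A B).hom := by
  obtain ⟨Mb, hMb⟩ := I.exists_isIdMap hB
  obtain ⟨-, -, N, -, -, hN, -, -⟩ := (isHomotopyTy_gen I P A B).exists_reind
    ((isHomotopyTy_gen I P A' B').base_change hA hB hP hMb) (k := M)
    (congrArg Cell.src hM.α).symm (congrArg Cell.tgt hM.α).symm
  obtain ⟨n₂, hn₂, e⟩ := reflHomotopy_reind (I := I) hA hB hP
  refine ⟨N, hN, hM.elim _ _ hN _ _ ?_⟩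
  have e' : reflMap I P A' B' ≫ N = n₂ ≫ reflMap I P A B :=
    (hN.comp (reind_reflMap I P A' B')).hom_unique
      (((reind_reflMap I P A B).comp hn₂).congr hM.r.symm rfl)
  rw [Category.assoc, e', ← Category.assoc, e, Category.assoc]

end Stability

variable {A : 𝒟.Ty Γ} {B : 𝒟.Ty A.tot} {z z' : Sec (P.Pi A B)}

/-- The codomain of the type of pointwise identities between `z` and `z'`. -/
abbrev homotopyCod (I : AxiomaticId 𝒟) (z z' : Sec (P.Pi A B)) : 𝒟.Ty A.tot :=
  𝒟.sub (I.Id B) (𝒟.pair (P.piEval.app z) (P.piEval.app z'))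

/-- The canonical arrow from `homotopyCod` to the identity type of `B`. -/
abbrev homotopyArr (I : AxiomaticId 𝒟) (z z' : Sec (P.Pi A B)) :
    (homotopyCod I z z').tot ⟶ (I.Id B).tot :=
  𝒟.q (I.Id B) (𝒟.pair (P.piEval.app z) (P.piEval.app z'))

theorem exists_happlyAt (p : Sec (𝒟.sub (I.Id (P.Pi A B)) (𝒟.pair z z'))) :
    ∃ a' b' n, Reind (genDom I P A B) (I.arr p) A a' ∧
      Reind (genCod I P A B) a' (homotopyCod I z z') b' ∧
      Reind (P.Pi (genDom I P A B) (genCod I P A B)) (I.arr p) (P.Pi A (homotopyCod I z z')) n ∧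
      a' ≫ 𝒟.q A _ = 𝟙 _ ∧ b' ≫ genArr I P A B = homotopyArr I z z' :=
  (isHomotopyTy_gen I P A B).exists_reind (isHomotopyTy_homotopy z z')
    (by rw [AxiomaticId.arr_s, pair_proj]) (by rw [AxiomaticId.arr_t, pair_q])

theorem sub_arr_gen (p : Sec (𝒟.sub (I.Id (P.Pi A B)) (𝒟.pair z z'))) :
    𝒟.sub (P.Pi (genDom I P A B) (genCod I P A B)) (I.arr p) = P.Pi A (homotopyCod I z z') := by
  obtain ⟨_, _, _, _, _, h, _, _⟩ := exists_happlyAt p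
  exact Reind.mk.ty_unique h

/-- The instance `happly[p]`. -/
def happlyAt (p : Sec (𝒟.sub (I.Id (P.Pi A B)) (𝒟.pair z z'))) :
    Sec (P.Pi A (homotopyCod I z z')) :=
  (𝒟.subSec (happly I P A B) (I.arr p)).cast (sub_arr_gen p)

theorem happlyAt_hom (p : Sec (𝒟.sub (I.Id (P.Pi A B)) (𝒟.pair z z')))
    {n : (P.Pi A (homotopyCod I z z')).tot ⟶ (P.Pi (genDom I P A B) (genCod I P A B)).tot}
    (h : Reind (P.Pi (genDom I P A B) (genCod I P A B)) (I.arr p)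
      (P.Pi A (homotopyCod I z z')) n) :
    (happlyAt p).hom ≫ n = I.arr p ≫ (happly I P A B).hom :=
  h.hom_of_same (Sec.cast_same _ _)

/-- The 2-cell of `happly[p]` is the image under `app` of the 2-cell of `p`. -/
theorem isAppSec_happlyAt (hn : 𝒟.Normal)
    (hβ : ∀ {Γ X : 𝒞} (A : 𝒟.Ty Γ) (B : 𝒟.Ty A.tot) (f : X ⟶ Γ)
      (b : SliceHom B.proj (𝒟.q A f)), IsIdentity ((P.lam A B f).β.hom.app b).1)
    (p : Sec (𝒟.sub (I.Id (P.Pi A B)) (𝒟.pair z z'))) :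
    P.IsAppSec A B (I.cell p) (homotopyCell (homotopyArr I z z') (happlyAt p)) := by
  obtain ⟨a', b', n, ha, hb, h, ea, eb⟩ := exists_happlyAt p
  have hs : I.arr p ≫ I.s (P.Pi A B) ≫ (P.Pi A B).proj = 𝟙 Γ := by
    rw [← Category.assoc, AxiomaticId.arr_s, pair_proj, z.hom_proj]
  have e := (isApp_happly I P A B hn hβ).wl hs (L := 𝒟.q A (𝟙 Γ) ≫ a')
    ((Category.assoc _ _ _).trans ((congrArg _ ea).trans (Category.comp_id _)))
    (by rw [Category.assoc, ha.w, ← Category.assoc, q_id_proj])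
  rw [← eb, homotopyCell_reind ha hb h (happlyAt_hom p h), AxiomaticPi.IsAppSec, Cell.wl_wl]
  exact e

theorem exists_funext (h : Sec (P.Pi A (homotopyCod I z z'))) :
    ∃ p : Sec (𝒟.sub (I.Id (P.Pi A B)) (𝒟.pair z z')),
      P.IsAppSec A B (I.cell p) (homotopyCell (homotopyArr I z z') h) := by
  obtain ⟨c, hc, hs, ht, h₁⟩ := AxiomaticPi.IsAppSec.exists_left (z := z) (z' := z')
    (homotopyCell_isOne (homotopyArr I z z') h)
    (homotopyCell_src (isHomotopyTy_homotopy z z') h)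
    (homotopyCell_tgt (isHomotopyTy_homotopy z z') h)
  obtain ⟨p, rfl⟩ := AxiomaticId.exists_cell_eq (I := I) hs ht h₁
  exact ⟨p, hc⟩

/-- Function extensionality: the identity term whose 2-cell is the preimage under `app` of the
2-cell of a pointwise identity. -/
def funextTerm (h : Sec (P.Pi A (homotopyCod I z z'))) :
    Sec (𝒟.sub (I.Id (P.Pi A B)) (𝒟.pair z z')) :=
  (exists_funext h).choose

theorem isAppSec_funextTerm (h : Sec (P.Pi A (homotopyCod I z z'))) :
    P.IsAppSec A B (I.cell (funextTerm h)) (homotopyCell (homotopyArr I z z') h) :=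
  (exists_funext h).choose_spec

theorem cell_src (p : Sec (𝒟.sub (I.Id (P.Pi A B)) (𝒟.pair z z'))) : (I.cell p).src = z.hom :=
  (AxiomaticId.arr_s p).trans (pair_proj _ _)

theorem cell_tgt (p : Sec (𝒟.sub (I.Id (P.Pi A B)) (𝒟.pair z z'))) : (I.cell p).tgt = z'.hom :=
  (AxiomaticId.arr_t p).trans (pair_q _ _)

/-- Full faithfulness of `app` makes `happly` and `funext` strictly inverse to each other on this
side, so that the identity terms required here are reflexivities. -/
theorem funextTerm_happlyAt (hn : 𝒟.Normal)
    (hβ : ∀ {Γ X : 𝒞} (A : 𝒟.Ty Γ) (B : 𝒟.Ty A.tot) (f : X ⟶ Γ)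
      (b : SliceHom B.proj (𝒟.q A f)), IsIdentity ((P.lam A B f).β.hom.app b).1)
    (p : Sec (𝒟.sub (I.Id (P.Pi A B)) (𝒟.pair z z'))) : funextTerm (happlyAt p) = p :=
  AxiomaticId.cell_injective ((isAppSec_funextTerm _).left_unique (isAppSec_happlyAt hn hβ p)
    ((cell_src _).trans (cell_src _).symm) ((cell_tgt _).trans (cell_tgt _).symm))

/-- On the other side `happly[funext h]` and `h` have the same values; being terms of a dependent
product, they need not be equal. -/
theorem evalSec_happlyAt_funextTerm (hn : 𝒟.Normal)
    (hβ : ∀ {Γ X : 𝒞} (A : 𝒟.Ty Γ) (B : 𝒟.Ty A.tot) (f : X ⟶ Γ)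
      (b : SliceHom B.proj (𝒟.q A f)), IsIdentity ((P.lam A B f).β.hom.app b).1)
    (h : Sec (P.Pi A (homotopyCod I z z'))) :
    P.evalSec (happlyAt (funextTerm h)) = P.evalSec h := by
  have e := (isAppSec_happlyAt hn hβ (funextTerm h)).right_unique (isAppSec_funextTerm h)
  refine (𝒟.isPullback (I.Id B) _).hom_ext (I.hom_ext e) ?_
  rw [AxiomaticPi.evalSec_proj, AxiomaticPi.evalSec_proj]

theorem exists_beta (hn : 𝒟.Normal)
    (hβ : ∀ {Γ X : 𝒞} (A : 𝒟.Ty Γ) (B : 𝒟.Ty A.tot) (f : X ⟶ Γ)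
      (b : SliceHom B.proj (𝒟.q A f)), IsIdentity ((P.lam A B f).β.hom.app b).1)
    (h : Sec (P.Pi A (homotopyCod I z z'))) :
    ∃ b : Sec (𝒟.sub (I.Id (P.Pi A (homotopyCod I z z')))
        (𝒟.pair (happlyAt (funextTerm h)) h)),
      P.IsAppSec A (homotopyCod I z z') (I.cell b) (Cell.one (P.evalSec h)) := by
  obtain ⟨c, hc, hs, ht, h₁⟩ := AxiomaticPi.IsAppSec.exists_left
    (z := happlyAt (funextTerm h)) (z' := h) ⟨_, Cell.wr_one (P.evalSec h) _⟩
    (evalSec_happlyAt_funextTerm hn hβ h).symm rfl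
  obtain ⟨p, rfl⟩ := AxiomaticId.exists_cell_eq (I := I) hs ht h₁
  exact ⟨p, hc⟩

/-- The identity term between `happly[funext h]` and `h`; it comes from an identity 2-cell between
their images under `app`. -/
def betaTerm (hn : 𝒟.Normal)
    (hβ : ∀ {Γ X : 𝒞} (A : 𝒟.Ty Γ) (B : 𝒟.Ty A.tot) (f : X ⟶ Γ)
      (b : SliceHom B.proj (𝒟.q A f)), IsIdentity ((P.lam A B f).β.hom.app b).1)
    (h : Sec (P.Pi A (homotopyCod I z z'))) :
    Sec (𝒟.sub (I.Id (P.Pi A (homotopyCod I z z'))) (𝒟.pair (happlyAt (funextTerm h)) h)) :=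
  (exists_beta hn hβ h).choose

theorem isAppSec_betaTerm (hn : 𝒟.Normal)
    (hβ : ∀ {Γ X : 𝒞} (A : 𝒟.Ty Γ) (B : 𝒟.Ty A.tot) (f : X ⟶ Γ)
      (b : SliceHom B.proj (𝒟.q A f)), IsIdentity ((P.lam A B f).β.hom.app b).1)
    (h : Sec (P.Pi A (homotopyCod I z z'))) :
    P.IsAppSec A (homotopyCod I z z') (I.cell (betaTerm hn hβ h)) (Cell.one (P.evalSec h)) :=
  (exists_beta hn hβ h).choose_spec

theorem exists_eta (hn : 𝒟.Normal)
    (hβ : ∀ {Γ X : 𝒞} (A : 𝒟.Ty Γ) (B : 𝒟.Ty A.tot) (f : X ⟶ Γ)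
      (b : SliceHom B.proj (𝒟.q A f)), IsIdentity ((P.lam A B f).β.hom.app b).1)
    (p : Sec (𝒟.sub (I.Id (P.Pi A B)) (𝒟.pair z z'))) :
    ∃ e : Sec (𝒟.sub (I.Id (𝒟.sub (I.Id (P.Pi A B)) (𝒟.pair z z')))
        (𝒟.pair p (funextTerm (happlyAt p)))),
      I.cell e = Cell.one p.hom :=
  AxiomaticId.exists_cell_eq rfl (by rw [funextTerm_happlyAt hn hβ]; rfl) ⟨_, Cell.wr_one _ _⟩

section Stability

variable {f : Ω ⟶ Γ} {y y' : Sec (P.Pi (𝒟.sub A f) (𝒟.sub B (𝒟.q A f)))}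

/-- The type of pointwise identities is stable under re-indexing. -/
theorem homotopy_reind
    (hy : y.hom ≫ P.map A B f = f ≫ z.hom) (hy' : y'.hom ≫ P.map A B f = f ≫ z'.hom) : ∃ b' n,
    Reind (homotopyCod I z z') (𝒟.q A f) (homotopyCod I y y') b' ∧
    Reind (P.Pi A (homotopyCod I z z')) f (P.Pi (𝒟.sub A f) (homotopyCod I y y')) n ∧
    b' ≫ homotopyArr I z z' = homotopyArr I y y' ≫ I.map B (𝒟.q A f) := by
  obtain ⟨a', b', n, ha, hb, hn, ea, eb⟩ := (isHomotopyTy_homotopy (I := I) z z').exists_reind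
    ((isHomotopyTy_homotopy y y').base_change .mk .mk (P.reind_map A B f)
      (I.isIdMap_map B (𝒟.q A f))) hy.symm hy'.symm
  obtain rfl : a' = 𝒟.q A f := by simpa using ea
  exact ⟨b', n, hb, hn, eb⟩

theorem happlyAt_reind
    (p : Sec (𝒟.sub (I.Id (P.Pi A B)) (𝒟.pair z z')))
    (p' : Sec (𝒟.sub (I.Id (P.Pi (𝒟.sub A f) (𝒟.sub B (𝒟.q A f)))) (𝒟.pair y y')))
    {n : (P.Pi (𝒟.sub A f) (homotopyCod I y y')).tot ⟶ (P.Pi A (homotopyCod I z z')).tot}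
    (hn : Reind (P.Pi A (homotopyCod I z z')) f (P.Pi (𝒟.sub A f) (homotopyCod I y y')) n)
    (hp : (I.cell p').wr (P.map A B f) = (I.cell p).wl f) :
    (happlyAt p').hom ≫ n = f ≫ (happlyAt p).hom := by
  obtain ⟨M, hM⟩ := I.exists_isIdMap (P.reind_map A B f)
  obtain ⟨N, hN, eN⟩ := happly_reind .mk .mk (P.reind_map A B f) hM
  obtain ⟨-, -, k, -, -, hk, -, -⟩ := exists_happlyAt p
  obtain ⟨-, -, k', -, -, hk', -, -⟩ := exists_happlyAt p'
  have e : I.arr p' ≫ M = f ≫ I.arr p := by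
    refine I.hom_ext ?_
    rw [← Cell.wl_wl, ← Cell.wl_wl f, ← hM.α, ← Cell.wr_wl]
    exact hp
  have e' : n ≫ k = k' ≫ N := (hk.comp hn).hom_unique ((hN.comp hk').congr e rfl)
  refine hk.isPullback.hom_ext ?_ ?_
  · rw [Category.assoc, e', ← Category.assoc, happlyAt_hom p' hk', Category.assoc, eN,
      Category.assoc f, happlyAt_hom p hk]
    exact (Category.assoc _ _ _).symm.trans ((congrArg (· ≫ _) e).trans (Category.assoc _ _ _))
  · rw [Category.assoc, hn.w, ← Category.assoc, Sec.hom_proj, Category.assoc, Sec.hom_proj,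
      Category.id_comp, Category.comp_id]

theorem funextTerm_reind
    (hy : y.hom ≫ P.map A B f = f ≫ z.hom) (hy' : y'.hom ≫ P.map A B f = f ≫ z'.hom)
    {h : Sec (P.Pi A (homotopyCod I z z'))}
    {h₁ : Sec (P.Pi (𝒟.sub A f) (homotopyCod I y y'))}
    {n : (P.Pi (𝒟.sub A f) (homotopyCod I y y')).tot ⟶ (P.Pi A (homotopyCod I z z')).tot}
    {b' : (homotopyCod I y y').tot ⟶ (homotopyCod I z z').tot}
    (hb : Reind (homotopyCod I z z') (𝒟.q A f) (homotopyCod I y y') b')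
    (hn : Reind (P.Pi A (homotopyCod I z z')) f (P.Pi (𝒟.sub A f) (homotopyCod I y y')) n)
    (eb : b' ≫ homotopyArr I z z' = homotopyArr I y y' ≫ I.map B (𝒟.q A f))
    (e : h₁.hom ≫ n = f ≫ h.hom) :
    (I.cell (funextTerm h₁)).wr (P.map A B f) = (I.cell (funextTerm h)).wl f := by
  have e₁ := (isAppSec_funextTerm h₁).wr .mk (P.reind_map A B f)
  have e₂ := (isAppSec_funextTerm h).wl f
  have e₃ : (homotopyCell (homotopyArr I y y') h₁).wr (𝒟.q B (𝒟.q A f)) =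
      (homotopyCell (homotopyArr I z z') h).wl (𝒟.q A f) := by
    rw [← homotopyCell_reind .mk hb hn e, eb, homotopyCell, homotopyCell, Cell.wr_wl,
      I.αc_reind, Cell.wl_wl, Category.assoc]
  rw [e₃] at e₁
  refine e₁.left_unique e₂ ?_ ?_
  · exact (congrArg (· ≫ P.map A B f) (cell_src _)).trans
      (hy.trans (congrArg (f ≫ ·) (cell_src _)).symm)
  · exact (congrArg (· ≫ P.map A B f) (cell_tgt _)).trans
      (hy'.trans (congrArg (f ≫ ·) (cell_tgt _)).symm)

theorem betaTerm_reind
    (hy : y.hom ≫ P.map A B f = f ≫ z.hom) (hy' : y'.hom ≫ P.map A B f = f ≫ z'.hom)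
    (hn : 𝒟.Normal)
    (hβ : ∀ {Γ X : 𝒞} (A : 𝒟.Ty Γ) (B : 𝒟.Ty A.tot) (f : X ⟶ Γ)
      (b : SliceHom B.proj (𝒟.q A f)), IsIdentity ((P.lam A B f).β.hom.app b).1)
    {h : Sec (P.Pi A (homotopyCod I z z'))}
    {h₁ : Sec (P.Pi (𝒟.sub A f) (homotopyCod I y y'))}
    {n : (P.Pi (𝒟.sub A f) (homotopyCod I y y')).tot ⟶ (P.Pi A (homotopyCod I z z')).tot}
    {b' : (homotopyCod I y y').tot ⟶ (homotopyCod I z z').tot}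
    (hb : Reind (homotopyCod I z z') (𝒟.q A f) (homotopyCod I y y') b')
    (hP : Reind (P.Pi A (homotopyCod I z z')) f (P.Pi (𝒟.sub A f) (homotopyCod I y y')) n)
    (eb : b' ≫ homotopyArr I z z' = homotopyArr I y y' ≫ I.map B (𝒟.q A f))
    (eh : h₁.hom ≫ n = f ≫ h.hom) :
    (I.cell (betaTerm hn hβ h₁)).wr n = (I.cell (betaTerm hn hβ h)).wl f := by
  have e := funextTerm_reind hy hy' hb hP eb eh
  have e₁ := (isAppSec_betaTerm hn hβ h₁).wr hb hP
  have e₂ := (isAppSec_betaTerm hn hβ h).wl f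
  rw [Cell.wr_one, AxiomaticPi.evalSec_reind .mk hb hP eh] at e₁
  rw [Cell.wl_one] at e₂
  refine e₁.left_unique e₂ ?_ ?_
  · exact (congrArg (· ≫ n) (cell_src _)).trans
      ((happlyAt_reind _ _ hP e).trans (congrArg (f ≫ ·) (cell_src _)).symm)
  · exact (congrArg (· ≫ n) (cell_tgt _)).trans
      (eh.trans (congrArg (f ≫ ·) (cell_tgt _)).symm)

end Stability

/-- Function extensionality, when `β` is an identity and the display maps are normal. -/
def funextRules (hn : 𝒟.Normal)
    (hβ : ∀ {Γ X : 𝒞} (A : 𝒟.Ty Γ) (B : 𝒟.Ty A.tot) (f : X ⟶ Γ)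
      (b : SliceHom B.proj (𝒟.q A f)), IsIdentity ((P.lam A B f).β.hom.app b).1) :
    FunextRules (I.idRules hn) (P.piRules hβ) where
  happly A B := happly I P A B
  happly_spec A B := happly_spec I P A B hn
  happlyAt p := happlyAt p
  happlyAt_spec p := Sec.cast_same _ _
  funext h := funextTerm h
  beta h := betaTerm hn hβ h
  eta p := (exists_eta hn hβ p).choose
  beta_sub {Γ Ω A B z z'} h f := by
    have hy := (P.reind_map A B f).hom_of_same (Sec.cast_same (P.Pi_sub A B f) (𝒟.subSec z f))
    have hy' := (P.reind_map A B f).hom_of_same (Sec.cast_same (P.Pi_sub A B f) (𝒟.subSec z' f))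
    obtain ⟨b', n, hb, hP, eb⟩ := homotopy_reind (I := I) hy hy'
    let h₁ := hP.sec (f ≫ h.hom)
      ((Category.assoc _ _ _).trans ((congrArg (f ≫ ·) h.hom_proj).trans (Category.comp_id f)))
    have eh : h₁.hom ≫ n = f ≫ h.hom := hP.sec_hom _ _
    have e := funextTerm_reind hy hy' hb hP eb eh
    exact ⟨h₁, (hP.same_subSec eh).symm, AxiomaticId.same_of_cell (P.reind_map A B f) e,
      AxiomaticId.same_of_cell hP (betaTerm_reind hy hy' hn hβ hb hP eb eh)⟩
  eta_sub {Γ Ω A B z z'} p f := by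
    have hy := (P.reind_map A B f).hom_of_same (Sec.cast_same (P.Pi_sub A B f) (𝒟.subSec z f))
    have hy' := (P.reind_map A B f).hom_of_same (Sec.cast_same (P.Pi_sub A B f) (𝒟.subSec z' f))
    obtain ⟨n, p₁, hn₁, e⟩ := AxiomaticId.exists_reind_term (P.reind_map A B f) hy hy' p
    refine ⟨p₁, (hn₁.same_subSec e).symm, AxiomaticId.same_of_cell hn₁ ?_⟩
    rw [(exists_eta hn hβ p).choose_spec, (exists_eta hn hβ p₁).choose_spec, Cell.wr_one,
      Cell.wl_one, e]

end Funext

end AxiomaticTypes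

theorem mainTheorem7 {𝒞 : Type u} [Bicategory.{w, v} 𝒞] [Bicategory.Strict 𝒞]
    [Bicategory.IsLocallyGroupoid 𝒞] (𝒟 : AxiomaticTypes.DisplayMap2Category 𝒞)
    (I : AxiomaticTypes.AxiomaticId 𝒟) (S : AxiomaticTypes.AxiomaticSigma 𝒟)
    (P : AxiomaticTypes.AxiomaticPi 𝒟) (Z : AxiomaticTypes.AxiomaticZero 𝒟)
    (O : AxiomaticTypes.AxiomaticOne 𝒟) (T : AxiomaticTypes.AxiomaticTwo 𝒟)
    (N : AxiomaticTypes.AxiomaticNat 𝒟)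
    (hβ_sigma : ∀ {Γ : 𝒞} (A : 𝒟.Ty Γ) (B : 𝒟.Ty A.tot), AxiomaticTypes.IsIdentity (S.β A B))
    (hβ_pi : ∀ {Γ X : 𝒞} (A : 𝒟.Ty Γ) (B : 𝒟.Ty A.tot) (f : X ⟶ Γ)
      (b : AxiomaticTypes.SliceHom B.proj (𝒟.q A f)),
      AxiomaticTypes.IsIdentity ((P.lam A B f).β.hom.app b).1)
    (hβ_one : ∀ {Γ : 𝒞} (C : 𝒟.Ty (O.ty Γ).tot)
      (c : AxiomaticTypes.SliceHom C.proj (O.star Γ).hom),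
      AxiomaticTypes.IsIdentity ((O.ind C).β.hom.app c).1)
    (hβ_two : ∀ {Γ : 𝒞} (C : 𝒟.Ty (T.ty Γ).tot)
      (c : AxiomaticTypes.SliceHom C.proj (T.bot Γ).hom)
      (d : AxiomaticTypes.SliceHom C.proj (T.top Γ).hom),
      AxiomaticTypes.IsIdentity ((T.ind C).β.hom.app (c, d)).1.1 ∧
        AxiomaticTypes.IsIdentity ((T.ind C).β.hom.app (c, d)).2.1)
    (hβ_nat : ∀ {Γ : 𝒞} (C : 𝒟.Ty (N.ty Γ).tot)
      (c : AxiomaticTypes.SliceHom C.proj (N.zero Γ).hom)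
      (d : AxiomaticTypes.SliceHom C.proj (C.proj ≫ N.s Γ)),
      AxiomaticTypes.IsIdentity (N.βzero c d) ∧ AxiomaticTypes.IsIdentity (N.βsucc c d))
    (hnormal : 𝒟.Normal) :
    ∃ M : AxiomaticTypes.ITTModel I.toIdForm S.toSigmaForm P.toPiForm Z.toZeroForm
        O.toOneForm T.toTwoForm N.toNatForm,
      (∀ {Γ : 𝒞} (A : 𝒟.Ty Γ),
        AxiomaticTypes.Cell.mk (Bicategory.whiskerLeft (M.id.r A) (I.α A)) =
          AxiomaticTypes.Cell.mk (𝟙 (𝟙 A.tot))) ∧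
      (∀ {Γ : 𝒞} (A : 𝒟.Ty Γ) (B : 𝒟.Ty A.tot), M.sigma.p A B = S.p A B) ∧
      (∀ {Γ : 𝒞} (A : 𝒟.Ty Γ) (B : 𝒟.Ty A.tot) (v : AxiomaticTypes.Sec B),
        (M.pi.lam v).hom = ((P.lam A B (𝟙 Γ)).inv.obj
          ⟨𝒟.q A (𝟙 Γ) ≫ v.hom, by rw [Category.assoc, v.hom_proj, Category.comp_id]⟩).hom) ∧
      (∀ {Γ : 𝒞} (A : 𝒟.Ty Γ) (B : 𝒟.Ty A.tot),
        (M.pi.ev A B).hom ≫ 𝒟.q B (𝒟.q A (P.Pi A B).proj) =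
          ((P.app A B (P.Pi A B).proj).obj ⟨𝟙 _, Category.id_comp _⟩).hom) := by
  refine ⟨{ id := I.idRules hnormal
            sigma := AxiomaticTypes.AxiomaticSigma.sigmaRules hβ_sigma hnormal
            pi := P.piRules hβ_pi
            funext := AxiomaticTypes.funextRules hnormal hβ_pi
            zero := Z.zeroRules
            one := O.oneRules hβ_one
            two := T.twoRules hβ_two
            nat := N.natRules hβ_nat }, fun A => ?_, fun A B => ?_, fun A B v => rfl,
    fun A B => P.piEval_ev_q A B⟩
  · exact (congrArg (fun x => AxiomaticTypes.Cell.wl x (I.αc A)) (I.idIntro_r A)).trans (I.wl_r A)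
  · exact S.sigmaIntro_p A B
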